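/- Let $n$ be the dimension, let $\lambda,\mu\in\mathbb{C}$, put $\delta=\mu-\lambda$ and assume $\delta\neq 1+\frac{\ell}{n+1}$ for all $\ell=0,1,2,\dots$. Let $c\in\mathbb{C}\setminus\{0\}$ (for instance $c=-i\hbar$). Let $\mathbb{R}^n$ be an affine chart of $S^n$ (the rays of $\mathbb{R}^{n+1}$), with coordinates $x^i$ and dual fibre coordinates $\xi_i$ on the cotangent bundle. Let $\mathrm{sl}(n+1,\mathbb{R})$ be the Lie algebra of vector fields spanned by $\partial_i$, $x^i\partial_j$ and $\sum_j x^ix^j\partial_j$. Let $\mathcal{F}_\lambda$ be the space of smooth complex-valued densities $\varphi\,|dx|^\lambda$ of degree $\lambda$, $\mathcal{D}_{\lambda,\mu}$ the space of linear differential operators $\mathcal{F}_\lambda\to\mathcal{F}_\mu$ with smooth coefficients, and $\mathcal{S}_\delta$ the space of polynomials $P(x,\xi)$ in $\xi$ with coefficients in $C^\infty(\mathbb{R}^n,\mathbb{C})$, regarded as symbols with values in $\delta$-densities. All three carry their natural actions of vector fields by Lie derivative. Let $\mathcal{I}:\mathcal{S}_\delta\to\mathcal{D}_{\lambda,\mu}$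 be normal ordering, $f(x)\,\xi_{i_1}\cdots\xi_{i_k}\mapsto c^k f(x)\,\partial_{i_1}\cdots\partial_{i_k}$, and let $$\mathcal{E}=\sum_i\xi_i\frac{\partial}{\partial\xi_i},\qquad \mathrm{D}=\sum_i\frac{\partial}{\partial x^i}\frac{\partial}{\partial\xi_i}.$$ A projectively equivariant quantization map is a linear map $\mathcal{Q}:\mathcal{S}_\delta\to\mathcal{D}_{\lambda,\mu}$ that commutes with the actions of $\mathrm{sl}(n+1,\mathbb{R})$ and preserves principal symbols: for every $P$ homogeneous of degree $k$ in $\xi$, $\mathcal{Q}(P)-\mathcal{I}(P)$ has order less than $k$. Then: (1) There is exactly one projectively equivariant quantization map $\mathcal{Q}_{\lambda,\mu}$, and it is bijective. It is independent of the affine chart, hence globally defined on $S^n$: if $\psi$ is the fractional linear transformation given by some $g\in\mathrm{SL}(n+1,\mathbb{R})$, $U\subset\mathbb{R}^n$ is an open set that $g$ maps into the chart, and if on $U$ the symbol $P$ is the pull-back $\psi^*P'$ of a symbol $P'$ and the $\lambda$-density $\varphi$ is the pull-back $\psi^*\varphi'$ of a $\lambda$-density $\varphi'$, then on $U$ the $\mu$-density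 $\mathcal{Q}_{\lambda,\mu}(P)\varphi$ is the pull-back by $\psi$ of $\mathcal{Q}_{\lambda,\mu}(P')\varphi'$. (2) Normal ordering $\mathcal{I}$ is bijective, and under the resulting identification of $\mathcal{D}_{\lambda,\mu}$ with $\mathcal{S}_\delta$ the projectively equivariant symbol map $\sigma_{\lambda,\mu}=(\mathcal{Q}_{\lambda,\mu})^{-1}$ is a confluent hypergeometric function: $$\sigma_{\lambda,\mu}\circ\mathcal{I}=F\left(\left.\begin{array}{l}\mathcal{E}+(n+1)\lambda\\ 2\mathcal{E}+(n+1)(1-\delta)\end{array}\right|-c\,\mathrm{D}\right).$$ Here, for operators $A,B,Z$, $$F\left(\left.\begin{array}{c}A\\ B\end{array}\right|Z\right)=\sum_{m=0}^\infty\frac{1}{m!}\,(A)_m\,\big((B)_m\big)^{-1}Z^m,\qquad (A)_m=A(A+1)\cdots(A+m-1),$$ with the powers of $Z$ on the right. For the operators above, all $(B)_m$ are invertible on $\mathcal{S}_\delta$, and for every $P\in\mathcal{S}_\delta$ one has $Z^mP=0$ for all large $m$, so that the sum is finite on every symbol. In particular, for $c=-i\hbar=\hbar/i$ the variable is $-\frac{\hbar}{i}\mathrm{D}$,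 and for $c=\frac{1}{i\hbar}$ it is $-\frac{\mathrm{D}}{i\hbar}$. -/

import Mathlib

open scoped ContDiff Matrix

noncomputable section

namespace ProjQuant

/-! ### Functions, densities, vector fields on an affine chart `ℝⁿ` of `Sⁿ` -/

/-- The smooth functions `ℝⁿ → ℂ`, as a subalgebra of all functions. -/
def smoothSubalgebra (n : ℕ) : Subalgebra ℂ ((Fin n → ℝ) → ℂ) where
  carrier := {f | ContDiff ℝ ∞ f}
  mul_mem' := fun {f g} (hf : ContDiff ℝ ∞ f) (hg : ContDiff ℝ ∞ g) => ContDiff.mul hf hg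
  add_mem' := fun {f g} (hf : ContDiff ℝ ∞ f) (hg : ContDiff ℝ ∞ g) => ContDiff.add hf hg
  algebraMap_mem' := fun c => (contDiff_const : ContDiff ℝ ∞ (fun _ : Fin n → ℝ => c))

/-- The algebra `C^∞(ℝⁿ, ℂ)`.  In the affine coordinates a tensor density
`φ |dx¹ ∧ ⋯ ∧ dxⁿ|^lam` of degree `lam` is represented by its coefficient `φ`; the degree enters
through the action of vector fields and of transformations. -/
def SmoothFn (n : ℕ) : Type := smoothSubalgebra n

instance (n : ℕ) : CommRing (SmoothFn n) := inferInstanceAs (CommRing (smoothSubalgebra n))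

instance (n : ℕ) : Algebra ℂ (SmoothFn n) := inferInstanceAs (Algebra ℂ (smoothSubalgebra n))

/-- The underlying function, as an algebra homomorphism. -/
def SmoothFn.toFun {n : ℕ} : SmoothFn n →ₐ[ℂ] ((Fin n → ℝ) → ℂ) := (smoothSubalgebra n).val

instance (n : ℕ) : CoeFun (SmoothFn n) (fun _ => (Fin n → ℝ) → ℂ) := ⟨fun f => f.toFun⟩

theorem SmoothFn.contDiff {n : ℕ} (f : SmoothFn n) : ContDiff ℝ ∞ f.toFun := f.2

theorem SmoothFn.differentiableAt {n : ℕ} (f : SmoothFn n) (x : Fin n → ℝ) :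
    DifferentiableAt ℝ f.toFun x :=
  f.contDiff.differentiable (by simp) x

theorem SmoothFn.ext {n : ℕ} {f g : SmoothFn n} (h : ∀ x, f x = g x) : f = g :=
  Subtype.ext (funext h)

/-- The element of `SmoothFn n` given by a smooth function. -/
def SmoothFn.mk {n : ℕ} (f : (Fin n → ℝ) → ℂ) (hf : ContDiff ℝ ∞ f) : SmoothFn n := ⟨f, hf⟩

theorem SmoothFn.mk_apply {n : ℕ} (f : (Fin n → ℝ) → ℂ) (hf : ContDiff ℝ ∞ f) (x : Fin n → ℝ) :
    SmoothFn.mk f hf x = f x := rfl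

/-- The partial derivative `∂/∂xⁱ` of smooth functions. -/
def partialD {n : ℕ} (i : Fin n) : Module.End ℂ (SmoothFn n) where
  toFun f := SmoothFn.mk (fun x => fderiv ℝ f.toFun x (Pi.single i 1))
    ((f.contDiff.fderiv_right (m := ∞) (by simp)).clm_apply contDiff_const)
  map_add' f g := by
    apply SmoothFn.ext
    intro x
    change fderiv ℝ (f.toFun + g.toFun) x (Pi.single i 1) = _
    rw [fderiv_add (f.differentiableAt x) (g.differentiableAt x)]
    rfl
  map_smul' c f := by
    apply SmoothFn.ext
    intro x
    change fderiv ℝ (c • f.toFun) x (Pi.single i 1) = _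
    rw [fderiv_const_smul (f.differentiableAt x)]
    rfl

theorem partialD_apply {n : ℕ} (i : Fin n) (f : SmoothFn n) (x : Fin n → ℝ) :
    partialD i f x = fderiv ℝ f.toFun x (Pi.single i 1) := rfl

/-- The coordinate function `xⁱ`. -/
def coordFn {n : ℕ} (i : Fin n) : SmoothFn n :=
  SmoothFn.mk (fun x => ((x i : ℝ) : ℂ)) (Complex.ofRealCLM.contDiff.comp (contDiff_apply ℝ ℝ i))

/-- A vector field `Xⁱ ∂/∂xⁱ`, given by its components. -/
abbrev VField (n : ℕ) : Type := Fin n → SmoothFn n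

/-- The divergence `∂Xⁱ/∂xⁱ` of a vector field. -/
def vdiv {n : ℕ} (X : VField n) : SmoothFn n := ∑ i, partialD i (X i)

/-- The Lie algebra `sl(n+1, ℝ)` of vector fields on `ℝⁿ`: the real span of
`∂/∂xⁱ`, `xⁱ ∂/∂xʲ` and `xⁱ xʲ ∂/∂xʲ` (summed over `j`). -/
def projFields (n : ℕ) : Submodule ℝ (VField n) :=
  Submodule.span ℝ
    (Set.range (fun i : Fin n => (Pi.single i 1 : VField n)) ∪
      Set.range (fun p : Fin n × Fin n => (Pi.single p.2 (coordFn p.1) : VField n)) ∪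
      Set.range (fun i : Fin n => (fun j => coordFn i * coordFn j : VField n)))

/-- Multiplication by a smooth function. -/
def mulOp {n : ℕ} : SmoothFn n →ₗ[ℂ] Module.End ℂ (SmoothFn n) := LinearMap.mul ℂ (SmoothFn n)

/-- The Lie derivative of `lam`-densities: `L_X φ = Xⁱ ∂φ/∂xⁱ + lam (∂Xⁱ/∂xⁱ) φ`. -/
def lieDensity {n : ℕ} (lam : ℂ) (X : VField n) : Module.End ℂ (SmoothFn n) :=
  ∑ i, mulOp (X i) * partialD i + lam • mulOp (vdiv X)

/-! ### Symbols -/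

/-- Symbols `P(x)^{i₁…iₖ} ξ_{i₁} ⋯ ξ_{iₖ}`: polynomials in `ξ` with coefficients in `C^∞(ℝⁿ, ℂ)`. -/
abbrev Symb (n : ℕ) : Type := MvPolynomial (Fin n) (SmoothFn n)

/-- The linear map `∑_α f_α ξ^α ↦ ∑_α F_α f_α` given by linear maps `F_α`. -/
def coeffSum {n : ℕ} {V : Type*} [AddCommMonoid V] [Module ℂ V]
    (F : (Fin n →₀ ℕ) → SmoothFn n →ₗ[ℂ] V) : Symb n →ₗ[ℂ] V :=
  (Finsupp.lsum ℂ F).comp (AddMonoidAlgebra.coeffLinearEquiv ℂ).toLinearMap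

theorem coeffSum_monomial {n : ℕ} {V : Type*} [AddCommMonoid V] [Module ℂ V]
    (F : (Fin n →₀ ℕ) → SmoothFn n →ₗ[ℂ] V) (α : Fin n →₀ ℕ) (f : SmoothFn n) :
    coeffSum F (MvPolynomial.monomial α f) = F α f := by
  change Finsupp.lsum ℂ F (Finsupp.single α f) = F α f
  simp

/-- The partial derivative `∂/∂xⁱ` of symbols at constant `ξ`. -/
def xD {n : ℕ} (i : Fin n) : Module.End ℂ (Symb n) :=
  coeffSum fun α =>
    ((MvPolynomial.monomial α : SmoothFn n →ₗ[SmoothFn n] Symb n).restrictScalars ℂ).comp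
      (partialD i)

theorem xD_monomial {n : ℕ} (i : Fin n) (α : Fin n →₀ ℕ) (f : SmoothFn n) :
    xD i (MvPolynomial.monomial α f) = MvPolynomial.monomial α (partialD i f) :=
  coeffSum_monomial _ _ _

/-- The partial derivative `∂/∂ξᵢ` of symbols. -/
def xiD {n : ℕ} (i : Fin n) : Module.End ℂ (Symb n) :=
  ((MvPolynomial.pderiv i : Derivation (SmoothFn n) (Symb n) (Symb n)) :
    Symb n →ₗ[SmoothFn n] Symb n).restrictScalars ℂ

/-- Multiplication of symbols by a symbol. -/
def mulSymb {n : ℕ} : Symb n →ₗ[ℂ] Module.End ℂ (Symb n) := LinearMap.mul ℂ (Symb n)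

/-- The Euler operator `ξᵢ ∂/∂ξᵢ`. -/
def euler (n : ℕ) : Module.End ℂ (Symb n) := ∑ i, mulSymb (MvPolynomial.X i) * xiD i

/-- The divergence operator `D = ∂/∂xⁱ ∂/∂ξᵢ`. -/
def divD (n : ℕ) : Module.End ℂ (Symb n) := ∑ i, xD i * xiD i

/-- The Lie derivative of symbols of weight `δ`:
`L_X P = Xⁱ ∂P/∂xⁱ - (∂Xⁱ/∂xʲ) ξᵢ ∂P/∂ξⱼ + δ (∂Xⁱ/∂xⁱ) P`. -/
def lieSymb {n : ℕ} (δ : ℂ) (X : VField n) : Module.End ℂ (Symb n) :=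
  ∑ i, mulSymb (MvPolynomial.C (X i)) * xD i
    - ∑ i, ∑ j, mulSymb (MvPolynomial.C (partialD j (X i)) * MvPolynomial.X i) * xiD j
    + δ • mulSymb (MvPolynomial.C (vdiv X))

/-- The value `P(x, ξ)` of a symbol at a point of the cotangent bundle. -/
def symbEval {n : ℕ} (P : Symb n) (x ξ : Fin n → ℝ) : ℂ :=
  MvPolynomial.eval₂ ((Pi.evalRingHom (fun _ : Fin n → ℝ => ℂ) x).comp (SmoothFn.toFun (n := n)).toRingHom)
    (fun i => ((ξ i : ℝ) : ℂ)) P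

/-! ### Differential operators -/

/-- `∂^α = (∂/∂x¹)^{α₁} ⋯ (∂/∂xⁿ)^{αₙ}`. -/
def partialPow {n : ℕ} (α : Fin n →₀ ℕ) : Module.End ℂ (SmoothFn n) :=
  (List.ofFn fun i => partialD i ^ α i).prod

/-- Linear differential operators (with smooth coefficients) on `ℝⁿ`. -/
def DiffOp (n : ℕ) : Submodule ℂ (Module.End ℂ (SmoothFn n)) :=
  Submodule.span ℂ {A | ∃ (f : SmoothFn n) (α : Fin n →₀ ℕ), A = mulOp f * partialPow α}

/-- Linear differential operators of order strictly less than `k` (only `0` for `k = 0`). -/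
def DiffOpLT (n k : ℕ) : Submodule ℂ (Module.End ℂ (SmoothFn n)) :=
  Submodule.span ℂ
    {A | ∃ (f : SmoothFn n) (α : Fin n →₀ ℕ), α.degree < k ∧ A = mulOp f * partialPow α}

/-- The action of vector fields on operators from `lam`-densities to `mu`-densities. -/
def lieOp {n : ℕ} (lam mu : ℂ) (X : VField n) (A : Module.End ℂ (SmoothFn n)) :
    Module.End ℂ (SmoothFn n) :=
  lieDensity mu X * A - A * lieDensity lam X

/-- Normal ordering `f(x) ξ^α ↦ c^{|α|} f(x) ∂^α`, i.e. `ξᵢ` is replaced by `c ∂/∂xⁱ`, the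
derivatives standing to the right (`c = -iℏ` in quantum mechanics). -/
def normalOrder (n : ℕ) (c : ℂ) : Symb n →ₗ[ℂ] DiffOp n :=
  coeffSum fun α =>
    { toFun := fun f => ⟨c ^ α.degree • (mulOp f * partialPow α),
        Submodule.smul_mem _ _ (Submodule.subset_span ⟨f, α, rfl⟩)⟩
      map_add' := fun f g => by
        apply Subtype.ext
        simp [add_mul]
      map_smul' := fun a f => by
        apply Subtype.ext
        simp [smul_comm a] }

theorem normalOrder_monomial {n : ℕ} (c : ℂ) (α : Fin n →₀ ℕ) (f : SmoothFn n) :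
    (normalOrder n c (MvPolynomial.monomial α f) : Module.End ℂ (SmoothFn n)) =
      c ^ α.degree • (mulOp f * partialPow α) := by
  rw [normalOrder, coeffSum_monomial]
  rfl

/-! ### Projectively equivariant quantization -/

/-- `Q` is a projectively equivariant quantization map from symbols of weight `mu - lam` to
differential operators from `lam`-densities to `mu`-densities: it is a linear map that commutes
with the action of `sl(n+1, ℝ)`, and the principal symbol of `Q P` is `P` (where `ξᵢ`
corresponds to `c ∂/∂xⁱ`). -/
structure IsProjEquivQuantization (n : ℕ) (lam mu c : ℂ) (Q : Symb n →ₗ[ℂ] DiffOp n) : Prop where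
  equivariant : ∀ X ∈ projFields n, ∀ P : Symb n,
    (Q (lieSymb (mu - lam) X P) : Module.End ℂ (SmoothFn n)) = lieOp lam mu X (Q P)
  principal : ∀ (k : ℕ) (P : Symb n), P.IsHomogeneous k →
    (Q P : Module.End ℂ (SmoothFn n)) - normalOrder n c P ∈ DiffOpLT n k

/-! ### Change of affine chart -/

/-- The homogeneous coordinates `g (1, x)` of the image of `x` under `g ∈ SL(n+1, ℝ)`. -/
def projVec {n : ℕ} (g : Matrix.SpecialLinearGroup (Fin (n + 1)) ℝ) (x : Fin n → ℝ) :
    Fin (n + 1) → ℝ :=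
  (g : Matrix (Fin (n + 1)) (Fin (n + 1)) ℝ) *ᵥ (Fin.cons 1 x : Fin (n + 1) → ℝ)

/-- The fractional linear transformation of `ℝⁿ` defined by `g ∈ SL(n+1, ℝ)`.  The affine chart
is the open hemisphere of rays of `ℝ^{n+1}` on which the coordinate with index `0` is positive, so
this is the action of `g` on `Sⁿ` at those `x` for which `projVec g x 0 > 0`. -/
def projMap {n : ℕ} (g : Matrix.SpecialLinearGroup (Fin (n + 1)) ℝ) (x : Fin n → ℝ) : Fin n → ℝ :=
  fun i => projVec g x i.succ / projVec g x 0

/-- The factor `|det dψ(x)|^s`, `ψ = projMap g`. -/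
def jacPow {n : ℕ} (g : Matrix.SpecialLinearGroup (Fin (n + 1)) ℝ) (s : ℂ) (x : Fin n → ℝ) : ℂ :=
  ((|(fderiv ℝ (projMap g) x).det| : ℝ) : ℂ) ^ s

/-- On `U`, the `s`-density `φ` is the pull-back of the `s`-density `φ'` by `ψ = projMap g`:
`φ(x) = |det dψ(x)|^s φ'(ψ(x))`. -/
def DensityRelated {n : ℕ} (g : Matrix.SpecialLinearGroup (Fin (n + 1)) ℝ) (U : Set (Fin n → ℝ))
    (s : ℂ) (φ φ' : SmoothFn n) : Prop :=
  ∀ x ∈ U, φ x = jacPow g s x * φ' (projMap g x)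

/-- On `U`, the symbol `P` of weight `δ` is the pull-back of `P'` by `ψ = projMap g`:
`P(x, dψ(x)ᵀ η) = |det dψ(x)|^δ P'(ψ(x), η)` for all covectors `η` at `ψ(x)`. -/
def SymbRelated {n : ℕ} (g : Matrix.SpecialLinearGroup (Fin (n + 1)) ℝ) (U : Set (Fin n → ℝ))
    (δ : ℂ) (P P' : Symb n) : Prop :=
  ∀ x ∈ U, ∀ η : Fin n → ℝ,
    symbEval P x (fun j => ∑ i, η i * fderiv ℝ (projMap g) x (Pi.single j 1) i) =
      jacPow g δ x * symbEval P' (projMap g x) η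

/-- `Q` does not depend on the affine chart of `Sⁿ`: if on an open set two symbols, and two
densities, are related by a change of affine chart, then so are the images of the densities under
the operators associated with the symbols. -/
def IsChartIndependent (n : ℕ) (lam mu : ℂ) (Q : Symb n →ₗ[ℂ] DiffOp n) : Prop :=
  ∀ (g : Matrix.SpecialLinearGroup (Fin (n + 1)) ℝ) (U : Set (Fin n → ℝ)), IsOpen U →
    (∀ x ∈ U, 0 < projVec g x 0) →
    ∀ P P' : Symb n, SymbRelated g U (mu - lam) P P' →
      ∀ φ φ' : SmoothFn n, DensityRelated g U lam φ φ' →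
        DensityRelated g U mu ((Q P : Module.End ℂ (SmoothFn n)) φ)
          ((Q P' : Module.End ℂ (SmoothFn n)) φ')

/-! ### Hypergeometric functions of operators -/

section Hypergeometric

variable {V : Type*} [AddCommGroup V] [Module ℂ V]

/-- The Pochhammer symbol `(A)ₘ = A (A + 1) ⋯ (A + m - 1)` of an operator. -/
def pochOp (A : Module.End ℂ V) (m : ℕ) : Module.End ℂ V :=
  Polynomial.aeval A (ascPochhammer ℂ m)

/-- The confluent hypergeometric function `F(A ; B | Z) = ∑ₘ (A)ₘ (B)ₘ⁻¹ Zᵐ / m!` with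
operator-valued parameters `A`, `B` and variable `Z`, the powers of `Z` standing to the right,
applied to a vector.  It is meaningful when all `(B)ₘ` are invertible and only finitely many terms
of the series are nonzero. -/
def confluentF (A B Z : Module.End ℂ V) (v : V) : V :=
  ∑ᶠ m : ℕ, ((m.factorial : ℂ)⁻¹) • (pochOp A m * Ring.inverse (pochOp B m) * Z ^ m) v

end Hypergeometric

end ProjQuant

end

noncomputable section

namespace ProjQuant

open MvPolynomial (C X monomial)

variable {n : ℕ}

/-! ### Calculus of smooth functions -/

/-! Write `E` for the Euler operator, `D` for the divergence, `a = (n+1)λ` and `b = (n+1)(1-δ)`. The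
assumption on `δ` says exactly that `l + b ≠ 0` for every natural number `l`.

Existence. Normal ordering carries the action on differential operators to an action on symbols. For
affine fields this is the usual Lie derivative, which commutes with `D`. For the quadratic field
with index `s` the transported action has the extra term `-c (E + a) ∂/∂ξₛ` (`lieOp_quadField`),
while the commutator of the usual Lie derivative with `D` is `(2E + b) ∂/∂ξₛ`
(`lieSymb_quadField_mul_divD`). For a map `∑ hₘ(E) (-cD)ᵐ` to intertwine the two actions it suffices
that `(m+1)(2k+b+m) hₘ₊₁(k) = (k+m+a) hₘ(k)` in each degree `k`. With `h₀ = 1` this is solved by the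
confluent hypergeometric coefficients (`hypCoeff_succ`). The resulting map is the identity up to
lower degree, hence bijective, and `Q` is its inverse followed by normal ordering.

Uniqueness. If `Q'` is another quantization, then `Q⁻¹Q'` commutes with the Lie derivatives of
symbols, hence with their Casimir operator. That operator is a scalar on each degree
(`casimir_lieSymb`), and different degrees have different scalars (`casimirValue_ne`). So `Q⁻¹Q'`
preserves the degree, and since it is the identity up to lower degree, it is the identity
(`eq_self_of_commute_lieSymb`).

Chart independence. No flow is integrated. In homogeneous coordinates the projective fields are
matrix units, which a change of chart conjugates by `g` (`densityRelated_lieDensity_slField`). Hence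
`K : A ↦ ∑ L_ab A L_ba` is compatible with changes of chart (`OpRelated.casimirKernel`).
Equivariance makes `K` act on quantizations of symbols of degree `k` by a scalar that determines
`k`, so a polynomial in `K` sends every operator with principal symbol `P` of degree `k` to a
nonzero multiple of `Q P` (`casimirProj_eq`). It is therefore enough to have, near each point, some
related operators with the prescribed principal symbols (`exists_local_model_monomial`). Locality of
`Q` then replaces the local model by the given symbol. -/

theorem partialD_mul (i : Fin n) (f g : SmoothFn n) :
    partialD i (f * g) = partialD i f * g + f * partialD i g := by
  apply SmoothFn.ext
  intro x
  change fderiv ℝ (f.toFun * g.toFun) x (Pi.single i 1) = _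
  rw [fderiv_mul (f.differentiableAt x) (g.differentiableAt x)]
  simp [partialD_apply]
  ring

theorem partialD_coordFn (i j : Fin n) :
    partialD i (coordFn j) = if i = j then 1 else 0 := by
  apply SmoothFn.ext
  intro x
  have h : HasFDerivAt (coordFn j : SmoothFn n).toFun
      (Complex.ofRealCLM.comp (ContinuousLinearMap.proj (R := ℝ) (φ := fun _ : Fin n => ℝ) j)) x :=
    (Complex.ofRealCLM.comp
      (ContinuousLinearMap.proj (R := ℝ) (φ := fun _ : Fin n => ℝ) j)).hasFDerivAt
  rw [partialD_apply, h.fderiv]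
  by_cases hij : i = j
  · subst hij; simp
  · simp [hij, Ne.symm hij]

theorem partialD_comm (i j : Fin n) : Commute (partialD (n := n) i) (partialD j) := by
  apply LinearMap.ext
  intro f
  apply SmoothFn.ext
  intro x
  have key : ∀ v w : Fin n → ℝ,
      fderiv ℝ (fun y => fderiv ℝ f.toFun y v) x w = fderiv ℝ (fderiv ℝ f.toFun) x w v := by
    intro v w
    have hd : DifferentiableAt ℝ (fderiv ℝ f.toFun) x :=
      (f.contDiff.fderiv_right (m := ∞) (by simp)).differentiable (by simp) x
    rw [fderiv_clm_apply hd (differentiableAt_const v)]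
    simp
  have hs : IsSymmSndFDerivAt ℝ f.toFun x :=
    f.contDiff.contDiffAt.isSymmSndFDerivAt
      (by simpa using (WithTop.coe_le_coe.2 le_top : ((2 : ℕ∞) : ℕ∞ω) ≤ ∞))
  change fderiv ℝ (fun y => fderiv ℝ f.toFun y (Pi.single j 1)) x (Pi.single i 1) =
    fderiv ℝ (fun y => fderiv ℝ f.toFun y (Pi.single i 1)) x (Pi.single j 1)
  rw [key, key]
  exact hs _ _

theorem mulOp_apply (f g : SmoothFn n) : mulOp f g = f * g := rfl

theorem mulOp_mul (f g : SmoothFn n) : mulOp (f * g) = mulOp f * mulOp g := by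
  ext h; simp [mulOp_apply, mul_assoc]

theorem mulOp_one : mulOp (1 : SmoothFn n) = 1 := by
  ext h; simp [mulOp_apply]

theorem mulOp_commute (f g : SmoothFn n) : Commute (mulOp f) (mulOp g) := by
  rw [Commute, SemiconjBy, ← mulOp_mul, ← mulOp_mul, mul_comm]

theorem partialD_mul_mulOp (i : Fin n) (f : SmoothFn n) :
    partialD i * mulOp f = mulOp (partialD i f) + mulOp f * partialD i := by
  apply LinearMap.ext
  intro g
  simp [mulOp_apply, partialD_mul]

/-- Endomorphisms do not commute in general, so `partialPow` is an ordered product. This reordering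
is what makes `partialPow` additive in the exponent. -/
theorem prod_ofFn_mul {M : Type*} [Monoid M] :
    ∀ {m : ℕ} (f g : Fin m → M), (∀ i j, Commute (f i) (g j)) →
      (List.ofFn fun i => f i * g i).prod = (List.ofFn f).prod * (List.ofFn g).prod
  | 0, f, g, _ => by simp
  | m + 1, f, g, h => by
    have hc : Commute (g 0) (List.ofFn fun i => f (Fin.succ i)).prod := by
      apply Commute.list_prod_right
      intro a ha
      obtain ⟨i, rfl⟩ := (List.mem_ofFn' _ _).1 ha
      exact (h _ _).symm
    rw [List.ofFn_succ, List.ofFn_succ, List.ofFn_succ, List.prod_cons, List.prod_cons,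
      List.prod_cons, prod_ofFn_mul (fun i => f i.succ) (fun i => g i.succ) fun i j => h _ _]
    simp only [mul_assoc]
    rw [← mul_assoc (g 0), hc.eq, mul_assoc]

theorem prod_ofFn_single {M : Type*} [Monoid M] :
    ∀ {m : ℕ} (a : Fin m → M) (i : Fin m),
      (List.ofFn fun j => a j ^ (Finsupp.single i 1 : Fin m →₀ ℕ) j).prod = a i
  | 0, _, i => i.elim0
  | m + 1, a, i => by
    rw [List.ofFn_succ, List.prod_cons]
    refine Fin.cases ?_ (fun k => ?_) i
    · have : (List.ofFn fun j : Fin m =>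
          a j.succ ^ (Finsupp.single (0 : Fin (m + 1)) 1 : Fin (m + 1) →₀ ℕ) j.succ).prod = 1 := by
        apply List.prod_eq_one
        intro x hx
        obtain ⟨j, rfl⟩ := (List.mem_ofFn' _ _).1 hx
        simp
      rw [this]; simp
    · have := prod_ofFn_single (fun j => a j.succ) k
      simpa [Finsupp.single_apply, Fin.succ_ne_zero] using this

theorem partialPow_zero : partialPow (0 : Fin n →₀ ℕ) = 1 := by
  apply List.prod_eq_one
  intro x hx
  obtain ⟨j, rfl⟩ := (List.mem_ofFn' _ _).1 hx
  simp

theorem partialPow_single (i : Fin n) : partialPow (Finsupp.single i 1) = partialD i :=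
  prod_ofFn_single _ _

theorem partialPow_add (α β : Fin n →₀ ℕ) :
    partialPow (α + β) = partialPow α * partialPow β := by
  rw [partialPow, partialPow, partialPow, ← prod_ofFn_mul]
  · simp [pow_add]
  · intro i j
    exact (partialD_comm i j).pow_pow _ _

/-! ### Calculus of symbols -/

theorem symb_end_ext {V : Type*} [AddCommMonoid V] [Module ℂ V] {A B : Symb n →ₗ[ℂ] V}
    (h : ∀ α f, A (monomial α f) = B (monomial α f)) : A = B := by
  apply LinearMap.ext
  intro P
  induction P using MvPolynomial.monomial_add_induction_on with
  | C a => exact h 0 a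
  | monomial_add a b f _ _ ih => rw [map_add, map_add, ih, h]

theorem mulSymb_apply (P R : Symb n) : mulSymb P R = P * R := rfl

theorem mulSymb_mul (P R : Symb n) : mulSymb (P * R) = mulSymb P * mulSymb R := by
  apply LinearMap.ext
  intro h; simp [mulSymb_apply, mul_assoc]

theorem mulSymb_one : mulSymb (1 : Symb n) = 1 := by
  apply LinearMap.ext
  intro h; simp [mulSymb_apply]

theorem mulSymb_commute (P R : Symb n) : Commute (mulSymb P) (mulSymb R) := by
  rw [Commute, SemiconjBy, ← mulSymb_mul, ← mulSymb_mul, mul_comm]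

theorem monomial_mul_X (α : Fin n →₀ ℕ) (f : SmoothFn n) (i : Fin n) :
    monomial α f * (X i : Symb n) = monomial (α + Finsupp.single i 1) f := by
  rw [X, MvPolynomial.monomial_mul, mul_one]

theorem xiD_apply (i : Fin n) (P : Symb n) : xiD i P = MvPolynomial.pderiv i P := rfl

theorem xiD_mulSymb (i : Fin n) (P : Symb n) :
    xiD i * mulSymb P = mulSymb P * xiD i + mulSymb (xiD i P) := by
  apply LinearMap.ext
  intro R
  simp [mulSymb_apply, xiD_apply]
  ring

/-- `xD` is defined coefficientwise, so its Leibniz rule has to be proved. The rules for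
multiplication by functions and by `ξⱼ` are the two special cases used later. -/
theorem xD_mul_monomial (i : Fin n) (α : Fin n →₀ ℕ) (f : SmoothFn n) (P : Symb n) :
    xD i (monomial α f * P) = monomial α f * xD i P + monomial α (partialD i f) * P := by
  induction P using MvPolynomial.monomial_add_induction_on with
  | C a =>
    rw [← MvPolynomial.monomial_zero', MvPolynomial.monomial_mul, xD_monomial, xD_monomial,
      partialD_mul, MvPolynomial.monomial_mul, MvPolynomial.monomial_mul, map_add, add_comm]
  | monomial_add β g R _ _ ih =>
    rw [mul_add, map_add, ih, MvPolynomial.monomial_mul, xD_monomial, map_add, xD_monomial,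
      partialD_mul, map_add, mul_add, mul_add, MvPolynomial.monomial_mul,
      MvPolynomial.monomial_mul]
    abel

theorem xD_mulSymb_C (i : Fin n) (f : SmoothFn n) :
    xD i * mulSymb (C f) = mulSymb (C f) * xD i + mulSymb (C (partialD i f)) := by
  apply LinearMap.ext
  intro P
  exact xD_mul_monomial i 0 f P

theorem partialD_one (i : Fin n) : partialD i (1 : SmoothFn n) = 0 := by
  have := partialD_mul i (1 : SmoothFn n) 1
  simpa using this

theorem xD_mulSymb_X (i j : Fin n) :
    Commute (xD i) (mulSymb (X j : Symb n)) := by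
  apply LinearMap.ext
  intro P
  have := xD_mul_monomial i (Finsupp.single j 1) 1 P
  simpa [partialD_one, mulSymb_apply, X] using this

theorem xiD_mulSymb_C (i : Fin n) (f : SmoothFn n) :
    Commute (xiD i) (mulSymb (C f)) := by
  rw [Commute, SemiconjBy, xiD_mulSymb]
  simp [xiD_apply]

theorem xiD_mulSymb_X (i j : Fin n) :
    xiD i * mulSymb (X j : Symb n) = mulSymb (X j) * xiD i + if i = j then 1 else 0 := by
  rw [xiD_mulSymb]
  congr 1
  rw [xiD_apply, MvPolynomial.pderiv_X]
  by_cases h : i = j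
  · subst h; simp [mulSymb_one]
  · simp [h, Ne.symm h]

theorem xiD_monomial (i : Fin n) (α : Fin n →₀ ℕ) (f : SmoothFn n) :
    xiD i (monomial α f) = monomial (α - Finsupp.single i 1) ((α i : ℂ) • f) := by
  rw [xiD_apply, MvPolynomial.pderiv_monomial]
  congr 1
  rw [Algebra.smul_def, map_natCast, mul_comm]

theorem xD_commute (i j : Fin n) : Commute (xD (n := n) i) (xD j) := by
  apply symb_end_ext
  intro α f
  simp only [Module.End.mul_apply, xD_monomial]
  congr 1
  exact LinearMap.congr_fun (partialD_comm i j).eq f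

theorem xD_xiD_commute (i j : Fin n) : Commute (xD (n := n) i) (xiD j) := by
  apply symb_end_ext
  intro α f
  simp [Module.End.mul_apply, xD_monomial, xiD_monomial]

theorem xiD_commute (i j : Fin n) : Commute (xiD (n := n) i) (xiD j) := by
  apply symb_end_ext
  intro α f
  simp only [Module.End.mul_apply, xiD_monomial]
  by_cases h : i = j
  · subst h; rfl
  · have h1 : (α - (Finsupp.single j 1 : Fin n →₀ ℕ)) i = α i := by
      simp [Ne.symm h]
    have h2 : (α - (Finsupp.single i 1 : Fin n →₀ ℕ)) j = α j := by
      simp [h]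
    rw [h1, h2, tsub_right_comm, smul_comm]

/-! ### Degree -/

/-- The operator that multiplies the symbols of degree `k` by `g k`. -/
def degOp (g : ℕ → ℂ) : Module.End ℂ (Symb n) :=
  coeffSum fun α =>
    ((monomial α : SmoothFn n →ₗ[SmoothFn n] Symb n).restrictScalars ℂ).comp
      (g α.degree • LinearMap.id)

theorem degOp_monomial (g : ℕ → ℂ) (α : Fin n →₀ ℕ) (f : SmoothFn n) :
    degOp g (monomial α f) = g α.degree • monomial α f := by
  rw [degOp, coeffSum_monomial]
  simp

theorem coeff_coeffSum_monomial (F : (Fin n →₀ ℕ) → Module.End ℂ (SmoothFn n)) (P : Symb n)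
    (α : Fin n →₀ ℕ) :
    (coeffSum (fun α => ((monomial α : SmoothFn n →ₗ[SmoothFn n] Symb n).restrictScalars ℂ).comp
      (F α)) P).coeff α = F α (P.coeff α) := by
  induction P using MvPolynomial.monomial_add_induction_on with
  | C a =>
    rw [← MvPolynomial.monomial_zero', coeffSum_monomial]
    simp only [LinearMap.comp_apply, LinearMap.restrictScalars_apply, MvPolynomial.coeff_monomial]
    by_cases h : 0 = α
    · subst h; simp
    · simp [h]
  | monomial_add β g R _ _ ih =>
    rw [map_add, MvPolynomial.coeff_add, ih, MvPolynomial.coeff_add, map_add, coeffSum_monomial]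
    simp only [LinearMap.comp_apply, LinearMap.restrictScalars_apply, MvPolynomial.coeff_monomial]
    by_cases h : β = α
    · subst h; simp
    · simp [h]

theorem coeff_xD (i : Fin n) (P : Symb n) (α : Fin n →₀ ℕ) :
    (xD i P).coeff α = partialD i (P.coeff α) :=
  coeff_coeffSum_monomial (fun _ => partialD i) P α

theorem coeff_degOp (g : ℕ → ℂ) (P : Symb n) (α : Fin n →₀ ℕ) :
    (degOp g P).coeff α = g α.degree • P.coeff α :=
  coeff_coeffSum_monomial (fun α => g α.degree • LinearMap.id) P α

theorem degOp_mul (g h : ℕ → ℂ) : degOp (n := n) g * degOp h = degOp (g * h) := by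
  apply symb_end_ext
  intro α f
  simp [degOp_monomial, smul_smul, mul_comm]

theorem degOp_add (g h : ℕ → ℂ) : degOp (n := n) (g + h) = degOp g + degOp h := by
  apply symb_end_ext
  intro α f
  simp [degOp_monomial, add_smul]

theorem degOp_smul (c : ℂ) (g : ℕ → ℂ) : degOp (n := n) (c • g) = c • degOp g := by
  apply symb_end_ext
  intro α f
  simp [degOp_monomial, smul_smul]

theorem degOp_const (c : ℂ) : degOp (n := n) (fun _ => c) = c • 1 := by
  apply symb_end_ext
  intro α f
  simp [degOp_monomial]

theorem euler_eq_degOp : euler n = degOp (fun k => (k : ℂ)) := by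
  apply symb_end_ext
  intro α f
  rw [degOp_monomial, euler]
  simp only [LinearMap.sum_apply, Module.End.mul_apply, mulSymb_apply, xiD_apply,
    MvPolynomial.X_mul_pderiv_monomial]
  rw [← Finset.sum_smul, Finsupp.degree_eq_sum, Nat.cast_smul_eq_nsmul]

theorem degOp_commute_xD (g : ℕ → ℂ) (i : Fin n) : Commute (degOp g) (xD i) := by
  apply symb_end_ext
  intro α f
  simp [degOp_monomial, xD_monomial]

theorem degOp_commute_C (g : ℕ → ℂ) (f : SmoothFn n) : Commute (degOp g) (mulSymb (C f)) := by
  apply symb_end_ext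
  intro α h
  simp [degOp_monomial, mulSymb_apply, MvPolynomial.C_mul_monomial]

theorem degOp_mul_X (g : ℕ → ℂ) (i : Fin n) :
    degOp g * mulSymb (X i : Symb n) = mulSymb (X i) * degOp (fun k => g (k + 1)) := by
  apply symb_end_ext
  intro α h
  simp only [Module.End.mul_apply, degOp_monomial, mulSymb_apply]
  rw [mul_smul_comm, mul_comm, monomial_mul_X, degOp_monomial]
  simp

theorem xiD_mul_degOp (g : ℕ → ℂ) (i : Fin n) :
    xiD i * degOp g = degOp (fun k => g (k + 1)) * xiD i := by
  apply symb_end_ext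
  intro α h
  simp only [Module.End.mul_apply, degOp_monomial, map_smul, xiD_monomial]
  by_cases hi : α i = 0
  · simp [hi]
  · have : (α - Finsupp.single i 1).degree + 1 = α.degree := by
      conv_rhs => rw [← tsub_add_cancel_of_le
        (show Finsupp.single i 1 ≤ α by simpa using Nat.one_le_iff_ne_zero.2 hi)]
      simp
    rw [this]

/-- The symbols of degree less than `k`. -/
def symbLT (n k : ℕ) : Submodule ℂ (Symb n) where
  carrier := {P | ∀ α, k ≤ α.degree → P.coeff α = 0}
  add_mem' hP hR α hα := by simp [hP α hα, hR α hα]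
  zero_mem' α _ := by simp
  smul_mem' c P hP α hα := by
    rw [MvPolynomial.coeff_smul, hP α hα, smul_zero]

theorem symbLT_mono {k l : ℕ} (h : k ≤ l) : symbLT n k ≤ symbLT n l :=
  fun _ hP α hα => hP α (h.trans hα)

theorem symbLT_zero : symbLT n 0 = ⊥ := by
  rw [eq_bot_iff]
  intro P hP
  exact MvPolynomial.ext _ _ fun α => by simpa using hP α (Nat.zero_le _)

theorem exists_mem_symbLT (P : Symb n) : ∃ k, P ∈ symbLT n k := by
  refine ⟨P.support.sup Finsupp.degree + 1, fun α hα => ?_⟩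
  by_contra h
  have := Finset.le_sup (f := Finsupp.degree) (MvPolynomial.mem_support_iff.2 h)
  omega

theorem mem_symbLT_of_isHomogeneous {k : ℕ} {P : Symb n} (h : P.IsHomogeneous k) :
    P ∈ symbLT n (k + 1) := by
  intro α hα
  exact h.coeff_eq_zero (by omega)

theorem symbLT_induction {k : ℕ} {p : Symb n → Prop} (h0 : p 0)
    (hadd : ∀ P R, p P → p R → p (P + R))
    (hmon : ∀ α f, α.degree < k → p (monomial α f)) {P : Symb n} (hP : P ∈ symbLT n k) : p P := by
  rw [MvPolynomial.as_sum P]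
  refine Finset.sum_induction _ p hadd h0 fun α hα => hmon _ _ ?_
  by_contra h
  exact (MvPolynomial.mem_support_iff.1 hα) (hP α (by omega))

theorem monomial_mem_symbLT {k : ℕ} {α : Fin n →₀ ℕ} {f : SmoothFn n} (h : α.degree < k) :
    monomial α f ∈ symbLT n k := by
  intro β hβ
  rw [MvPolynomial.coeff_monomial, if_neg]
  rintro rfl
  omega

theorem degOp_mem (g : ℕ → ℂ) {k : ℕ} {P : Symb n} (h : P ∈ symbLT n k) :
    degOp g P ∈ symbLT n k := by
  intro α hα
  rw [coeff_degOp, h α hα, smul_zero]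

theorem xD_mem (i : Fin n) {k : ℕ} {P : Symb n} (h : P ∈ symbLT n k) :
    xD i P ∈ symbLT n k := by
  intro α hα
  rw [coeff_xD, h α hα, map_zero]

theorem C_mul_mem (f : SmoothFn n) {k : ℕ} {P : Symb n} (h : P ∈ symbLT n k) :
    mulSymb (C f) P ∈ symbLT n k := by
  intro α hα
  rw [mulSymb_apply, MvPolynomial.coeff_C_mul, h α hα, mul_zero]

theorem X_mul_mem (i : Fin n) {k : ℕ} {P : Symb n} (h : P ∈ symbLT n k) :
    mulSymb (X i) P ∈ symbLT n (k + 1) := by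
  refine symbLT_induction (p := fun P => mulSymb (X i) P ∈ symbLT n (k + 1)) ?_ ?_ ?_ h
  · simp
  · intro P R hP hR
    rw [map_add]
    exact add_mem hP hR
  · intro α f hα
    rw [mulSymb_apply, mul_comm, monomial_mul_X]
    exact monomial_mem_symbLT (by simpa using hα)

theorem xiD_mem (i : Fin n) {k : ℕ} {P : Symb n} (h : P ∈ symbLT n (k + 1)) :
    xiD i P ∈ symbLT n k := by
  intro α hα
  rw [xiD_apply, MvPolynomial.coeff_pderiv, h _ (by simpa using hα), zero_mul]

theorem divD_mem {k : ℕ} {P : Symb n} (h : P ∈ symbLT n (k + 1)) : divD n P ∈ symbLT n k := by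
  rw [divD, LinearMap.sum_apply]
  exact Submodule.sum_mem _ fun i _ => xD_mem i (xiD_mem i h)

theorem divD_pow_eq_zero {k : ℕ} : ∀ {P : Symb n}, P ∈ symbLT n k → (divD n ^ k) P = 0 := by
  induction k with
  | zero =>
    intro P h
    rw [symbLT_zero] at h
    simpa using h
  | succ k ih =>
    intro P h
    rw [pow_succ, Module.End.mul_apply]
    exact ih (divD_mem h)

theorem degOp_isHomogeneous (g : ℕ → ℂ) {k : ℕ} {P : Symb n} (h : P.IsHomogeneous k) :
    degOp g P = g k • P := by
  apply MvPolynomial.ext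
  intro α
  rw [coeff_degOp, MvPolynomial.coeff_smul]
  by_cases hα : α.degree = k
  · rw [hα]
  · rw [h.coeff_eq_zero hα, smul_zero, smul_zero]

/-! ### Unipotent operators on symbols -/

/-- Induction on the degree: correct `P` by a preimage of the lower-degree error `T P - P`. The
invariant subspace `W` is carried along so that the inverse of `T` also preserves `W`; this is
applied to the degree filtration and to symbols vanishing on an open set. -/
theorem exists_preimage_of_unipotent {T : Module.End ℂ (Symb n)}
    (hT : ∀ k, ∀ P ∈ symbLT n (k + 1), T P - P ∈ symbLT n k)
    {W : Submodule ℂ (Symb n)} (hW : ∀ P ∈ W, T P ∈ W) :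
    ∀ k, ∀ P ∈ symbLT n k, P ∈ W → ∃ R ∈ W, T R = P ∧ R ∈ symbLT n k := by
  intro k
  induction k with
  | zero =>
    intro P hP _
    rw [symbLT_zero, Submodule.mem_bot] at hP
    exact ⟨0, zero_mem _, by simp [hP], zero_mem _⟩
  | succ k ih =>
    intro P hP hPW
    obtain ⟨R, hR, hTR, hk⟩ := ih (T P - P) (hT k P hP) (sub_mem (hW P hPW) hPW)
    exact ⟨P - R, sub_mem hPW hR, by rw [map_sub, hTR]; abel,
      sub_mem hP (symbLT_mono (Nat.le_succ k) hk)⟩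

theorem injective_of_unipotent {T : Module.End ℂ (Symb n)}
    (hT : ∀ k, ∀ P ∈ symbLT n (k + 1), T P - P ∈ symbLT n k) : Function.Injective T := by
  rw [injective_iff_map_eq_zero]
  have : ∀ k, ∀ P ∈ symbLT n k, T P = 0 → P = 0 := by
    intro k
    induction k with
    | zero =>
      intro P hP _
      rwa [symbLT_zero, Submodule.mem_bot] at hP
    | succ k ih =>
      intro P hP h0
      have := hT k P hP
      rw [h0, zero_sub, neg_mem_iff] at this
      exact ih P this h0
  intro P
  obtain ⟨k, hk⟩ := exists_mem_symbLT P
  exact this k P hk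

theorem bijective_of_unipotent {T : Module.End ℂ (Symb n)}
    (hT : ∀ k, ∀ P ∈ symbLT n (k + 1), T P - P ∈ symbLT n k) : Function.Bijective T := by
  refine ⟨injective_of_unipotent hT, fun P => ?_⟩
  obtain ⟨k, hk⟩ := exists_mem_symbLT P
  obtain ⟨R, -, hR, -⟩ := exists_preimage_of_unipotent hT (W := ⊤) (by simp) k P hk (by simp)
  exact ⟨R, hR⟩

/-! ### Normal ordering -/

/-- Normal ordering with values in all endomorphisms. -/
def normalEnd (n : ℕ) (c : ℂ) : Symb n →ₗ[ℂ] Module.End ℂ (SmoothFn n) :=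
  (DiffOp n).subtype ∘ₗ normalOrder n c

theorem normalEnd_apply (c : ℂ) (P : Symb n) :
    normalEnd n c P = (normalOrder n c P : Module.End ℂ (SmoothFn n)) := rfl

theorem normalEnd_monomial (c : ℂ) (α : Fin n →₀ ℕ) (f : SmoothFn n) :
    normalEnd n c (monomial α f) = c ^ α.degree • (mulOp f * partialPow α) :=
  normalOrder_monomial c α f

theorem normalEnd_C (c : ℂ) (f : SmoothFn n) : normalEnd n c (C f) = mulOp f := by
  rw [← MvPolynomial.monomial_zero', normalEnd_monomial]
  simp [partialPow_zero]

/-- Functions stand on the left and derivatives on the right, so left multiplication by functions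
and right multiplication by derivatives are plain multiplications of symbols. The opposite sides
produce the correction terms of `partialD_mul_normalEnd` and `normalEnd_mul_coord`. -/
theorem normalEnd_C_mul (c : ℂ) (f : SmoothFn n) (P : Symb n) :
    normalEnd n c (mulSymb (C f) P) = mulOp f * normalEnd n c P := by
  induction P using MvPolynomial.monomial_add_induction_on with
  | C a => rw [mulSymb_apply, ← map_mul, normalEnd_C, normalEnd_C, mulOp_mul]
  | monomial_add α g R _ _ ih =>
    rw [map_add, map_add, ih, map_add, mul_add, mulSymb_apply, MvPolynomial.C_mul_monomial,
      normalEnd_monomial, normalEnd_monomial, mulOp_mul, mul_smul_comm, mul_assoc]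

theorem normalEnd_X_mul (c : ℂ) (i : Fin n) (P : Symb n) :
    normalEnd n c (mulSymb (X i) P) = c • (normalEnd n c P * partialD i) := by
  have key : ∀ α f, normalEnd n c (mulSymb (X i) (monomial α f)) =
      c • (normalEnd n c (monomial α f) * partialD i) := by
    intro α g
    rw [mulSymb_apply, mul_comm, monomial_mul_X, normalEnd_monomial,
      normalEnd_monomial, partialPow_add, partialPow_single]
    simp only [map_add, Finsupp.degree_single, pow_succ, smul_mul_assoc, smul_smul, mul_assoc]
    rw [mul_comm]
  induction P using MvPolynomial.monomial_add_induction_on with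
  | C a => exact key 0 a
  | monomial_add α g R _ _ ih =>
    rw [map_add, map_add, ih, map_add, key, add_mul, smul_add]

theorem partialD_mul_normalEnd (c : ℂ) (i : Fin n) (P : Symb n) :
    partialD i * normalEnd n c P = normalEnd n c (xD i P) + normalEnd n c P * partialD i := by
  have key : ∀ α f, partialD i * normalEnd n c (monomial α f) =
      normalEnd n c (xD i (monomial α f)) + normalEnd n c (monomial α f) * partialD i := by
    intro α g
    rw [xD_monomial, normalEnd_monomial, normalEnd_monomial, mul_smul_comm, ← mul_assoc,
      partialD_mul_mulOp, add_mul, smul_add, smul_mul_assoc, mul_assoc, mul_assoc,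
      ← partialPow_single i, ← partialPow_add, ← partialPow_add, add_comm α]
  induction P using MvPolynomial.monomial_add_induction_on with
  | C a => exact key 0 a
  | monomial_add α g R _ _ ih =>
    rw [map_add, map_add, mul_add, key, ih, map_add, add_mul]
    abel

theorem normalEnd_mul_coord (c : ℂ) (i : Fin n) (P : Symb n) :
    normalEnd n c P * mulOp (coordFn i) =
      normalEnd n c (mulSymb (C (coordFn i)) P) + c • normalEnd n c (xiD i P) := by
  induction P using MvPolynomial.induction_on with
  | C a =>
    rw [mulSymb_apply, ← map_mul, normalEnd_C, normalEnd_C, mulOp_mul, (mulOp_commute _ _).eq]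
    simp [xiD_apply]
  | add P R hP hR =>
    rw [map_add, add_mul, hP, hR]
    simp only [map_add, smul_add]
    abel
  | mul_X P j ih =>
    have e1 : P * X j = mulSymb (X j) P := by rw [mulSymb_apply, mul_comm]
    have e2 : mulSymb (C (coordFn i)) (mulSymb (X j) P) =
        mulSymb (X j) (mulSymb (C (coordFn i)) P) :=
      LinearMap.congr_fun (mulSymb_commute (C (coordFn i)) (X j)).eq P
    have e3 : xiD i (mulSymb (X j) P) = mulSymb (X j) (xiD i P) + if i = j then P else 0 := by
      have := LinearMap.congr_fun (xiD_mulSymb_X i j) P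
      rw [Module.End.mul_apply] at this
      rw [this]
      split_ifs <;> simp
    rw [e1, e2, e3, map_add, normalEnd_X_mul, normalEnd_X_mul, normalEnd_X_mul, smul_mul_assoc,
      mul_assoc, partialD_mul_mulOp, mul_add, ← mul_assoc, ih, partialD_coordFn,
      add_mul, smul_add, smul_add, smul_add, smul_mul_assoc]
    by_cases h : j = i
    · subst h
      simp [mulOp_one]
      abel
    · simp [h, Ne.symm h]

/-- The commutator with `xⁱ` corresponds to `c ∂/∂ξᵢ`. If the operator of `P` vanishes, then so do
those of all `∂P/∂ξᵢ`, which have lower degree. By induction these derivatives are zero, Euler's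
identity leaves only the part of degree zero, and a multiplication operator is determined by its
value at `1`. -/
theorem normalEnd_injective {c : ℂ} (hc : c ≠ 0) : Function.Injective (normalEnd n c) := by
  rw [injective_iff_map_eq_zero]
  have key : ∀ k, ∀ P ∈ symbLT n k, normalEnd n c P = 0 → P = 0 := by
    intro k
    induction k with
    | zero =>
      intro P hP _
      rwa [symbLT_zero, Submodule.mem_bot] at hP
    | succ k ih =>
      intro P hP h0
      have h1 : ∀ i, xiD i P = 0 := by
        intro i
        apply ih _ (xiD_mem i hP)
        have := normalEnd_mul_coord c i P
        rw [normalEnd_C_mul, h0, zero_mul, mul_zero, zero_add] at this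
        exact (smul_eq_zero.1 this.symm).resolve_left hc
      have h2 : euler n P = 0 := by
        rw [euler, LinearMap.sum_apply]
        exact Finset.sum_eq_zero fun i _ => by rw [Module.End.mul_apply, h1, map_zero]
      have h3 : P = C (P.coeff 0) := by
        apply MvPolynomial.ext
        intro α
        rw [MvPolynomial.coeff_C]
        split_ifs with hα
        · rw [hα]
        · have := congrArg (MvPolynomial.coeff α) h2
          rw [euler_eq_degOp, coeff_degOp, MvPolynomial.coeff_zero, smul_eq_zero] at this
          refine this.resolve_left fun h => hα ?_
          rw [Nat.cast_eq_zero, Finsupp.degree_eq_zero_iff] at h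
          exact h.symm
      rw [h3, normalEnd_C] at h0
      have := LinearMap.congr_fun h0 1
      rw [mulOp_apply, mul_one, LinearMap.zero_apply] at this
      rw [h3, this, map_zero]
  intro P
  obtain ⟨k, hk⟩ := exists_mem_symbLT P
  exact key k P hk

/-- This translates statements about the order of operators into statements about the degree of
symbols. -/
theorem map_symbLT_normalEnd {c : ℂ} (hc : c ≠ 0) (k : ℕ) :
    (symbLT n k).map (normalEnd n c) = DiffOpLT n k := by
  apply le_antisymm
  · rw [Submodule.map_le_iff_le_comap]
    intro P hP
    refine symbLT_induction (p := fun P => P ∈ (DiffOpLT n k).comap (normalEnd n c))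
      (zero_mem _) (fun _ _ => add_mem) (fun α f hα => ?_) hP
    rw [Submodule.mem_comap, normalEnd_monomial]
    exact Submodule.smul_mem _ _ (Submodule.subset_span ⟨f, α, hα, rfl⟩)
  · rw [DiffOpLT, Submodule.span_le]
    rintro _ ⟨f, α, hα, rfl⟩
    refine ⟨monomial α ((c ^ α.degree)⁻¹ • f), monomial_mem_symbLT hα, ?_⟩
    rw [normalEnd_monomial, map_smul, smul_mul_assoc, smul_smul,
      mul_inv_cancel₀ (pow_ne_zero _ hc), one_smul]

theorem normalOrder_bijective {c : ℂ} (hc : c ≠ 0) : Function.Bijective (normalOrder n c) := by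
  constructor
  · intro P R h
    apply normalEnd_injective hc
    rw [normalEnd_apply, normalEnd_apply, h]
  · rw [← LinearMap.range_eq_top, eq_top_iff]
    have : (DiffOp n) ≤ (LinearMap.range (normalOrder n c)).map (DiffOp n).subtype := by
      refine Submodule.span_le.2 ?_
      rintro _ ⟨f, α, rfl⟩
      refine ⟨_, ⟨monomial α ((c ^ α.degree)⁻¹ • f), rfl⟩, ?_⟩
      rw [Submodule.subtype_apply, normalOrder_monomial, map_smul, smul_mul_assoc, smul_smul,
        mul_inv_cancel₀ (pow_ne_zero _ hc), one_smul]
    rintro ⟨A, hA⟩ -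
    obtain ⟨B, hB, h⟩ := this hA
    obtain rfl : B = ⟨A, hA⟩ := Subtype.ext h
    exact hB

/-! ### The projective Lie algebra inside the Weyl algebra of `x` and `ξ` -/

/-! ### The operators `xⁱ`, `ξᵢ`, `∂/∂xⁱ`, `∂/∂ξᵢ` and their commutation relations -/

/-- Multiplication of symbols by `xⁱ`. -/
def coordOp (i : Fin n) : Module.End ℂ (Symb n) := mulSymb (C (coordFn i))

/-- Multiplication of symbols by `ξᵢ`. -/
def momOp (i : Fin n) : Module.End ℂ (Symb n) := mulSymb (X i)

/-- The Euler operator `xⁱ ∂/∂xⁱ`. -/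
def coordEuler (n : ℕ) : Module.End ℂ (Symb n) := ∑ i, coordOp i * xD i

/-- Multiplication of symbols by `xⁱ ξᵢ`. -/
def pairingOp (n : ℕ) : Module.End ℂ (Symb n) := ∑ i, coordOp i * momOp i

theorem coordOp_commute (i j : Fin n) : Commute (coordOp i) (coordOp j) := mulSymb_commute _ _

theorem coordOp_momOp (i j : Fin n) : Commute (coordOp i) (momOp j) := mulSymb_commute _ _

/-- Together with `xiD_mul_momOp` and the vanishing commutators these are the Weyl relations. The
Lie derivatives along the generating projective fields are polynomials in these operators, so the
computations with `D` and the Casimir operator become pure algebra. -/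
theorem xD_mul_coordOp (i j : Fin n) :
    xD i * coordOp j = coordOp j * xD i + if i = j then 1 else 0 := by
  rw [coordOp, xD_mulSymb_C, partialD_coordFn]
  split_ifs <;> simp [mulSymb_one]

theorem xD_momOp (i j : Fin n) : Commute (xD i) (momOp j) := xD_mulSymb_X i j

theorem xiD_coordOp (i j : Fin n) : Commute (xiD i) (coordOp j) := xiD_mulSymb_C i _

theorem xiD_mul_momOp (i j : Fin n) :
    xiD i * momOp j = momOp j * xiD i + if i = j then 1 else 0 := xiD_mulSymb_X i j

theorem euler_eq_sum : euler n = ∑ i, momOp i * xiD i := rfl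

theorem xD_mul_coordEuler (s : Fin n) :
    xD s * coordEuler n = coordEuler n * xD s + xD s := by
  simp only [coordEuler, Finset.sum_mul, Finset.mul_sum]
  simp only [← mul_assoc, xD_mul_coordOp, add_mul, ite_mul, one_mul, zero_mul,
    Finset.sum_add_distrib, Finset.sum_ite_eq, Finset.mem_univ, if_true]
  refine congrArg (· + _) ?_
  refine Finset.sum_congr rfl fun i _ => ?_
  rw [mul_assoc, (xD_commute s i).eq, mul_assoc]

theorem coordEuler_xiD (s : Fin n) : Commute (coordEuler n) (xiD s) :=
  Commute.sum_left _ _ _ fun i _ => (xiD_coordOp s i).symm.mul_left (xD_xiD_commute i s)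

theorem euler_coordOp (s : Fin n) : Commute (euler n) (coordOp s) := by
  rw [euler_eq_degOp]; exact degOp_commute_C _ _

theorem euler_xD (s : Fin n) : Commute (euler n) (xD s) := by
  rw [euler_eq_degOp]; exact degOp_commute_xD _ _

theorem euler_coordEuler : Commute (euler n) (coordEuler n) :=
  Commute.sum_right _ _ _ fun i _ => (euler_coordOp i).mul_right (euler_xD i)

theorem xiD_mul_euler (s : Fin n) : xiD s * euler n = euler n * xiD s + xiD s := by
  simp only [euler_eq_sum, Finset.sum_mul, Finset.mul_sum]
  simp only [← mul_assoc, xiD_mul_momOp, add_mul, ite_mul, one_mul, zero_mul,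
    Finset.sum_add_distrib, Finset.sum_ite_eq, Finset.mem_univ, if_true]
  refine congrArg (· + _) ?_
  refine Finset.sum_congr rfl fun i _ => ?_
  rw [mul_assoc, (xiD_commute s i).eq, mul_assoc]

theorem sum_xD_mul_coordOp : ∑ i, xD i * coordOp i = coordEuler n + (n : ℂ) • 1 := by
  simp only [xD_mul_coordOp, if_true, Finset.sum_add_distrib, coordEuler]
  simp [Nat.cast_smul_eq_nsmul]

theorem sum_xiD_mul_momOp : ∑ i, xiD i * momOp i = euler n + (n : ℂ) • 1 := by
  simp only [xiD_mul_momOp, if_true, Finset.sum_add_distrib, euler_eq_sum]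
  simp [Nat.cast_smul_eq_nsmul]

theorem divD_commute_xD (s : Fin n) : Commute (divD n) (xD s) :=
  Commute.sum_left _ _ _ fun i _ => (xD_commute i s).mul_left (xD_xiD_commute s i).symm

theorem divD_commute_xiD (s : Fin n) : Commute (divD n) (xiD s) :=
  Commute.sum_left _ _ _ fun i _ => (xD_xiD_commute i s).mul_left (xiD_commute i s)

theorem divD_mul_coordOp (s : Fin n) :
    divD n * coordOp s = coordOp s * divD n + xiD s := by
  have : ∀ i, xD i * xiD i * coordOp s =
      coordOp s * (xD i * xiD i) + if i = s then xiD i else 0 := by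
    intro i
    rw [mul_assoc, (xiD_coordOp i s).eq, ← mul_assoc, xD_mul_coordOp, add_mul, mul_assoc]
    split_ifs <;> simp
  simp only [divD, Finset.sum_mul, Finset.mul_sum, this, Finset.sum_add_distrib,
    Finset.sum_ite_eq', Finset.mem_univ, if_true]

theorem divD_mul_momOp (s : Fin n) :
    divD n * momOp s = momOp s * divD n + xD s := by
  have : ∀ i, xD i * xiD i * momOp s =
      momOp s * (xD i * xiD i) + if i = s then xD i else 0 := by
    intro i
    rw [mul_assoc, xiD_mul_momOp, mul_add, ← mul_assoc, (xD_momOp i s).eq, mul_assoc]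
    split_ifs <;> simp
  simp only [divD, Finset.sum_mul, Finset.mul_sum, this, Finset.sum_add_distrib,
    Finset.sum_ite_eq', Finset.mem_univ, if_true]

theorem divD_mul_coordEuler : divD n * coordEuler n = coordEuler n * divD n + divD n := by
  conv_lhs => rw [coordEuler, Finset.mul_sum]
  conv_rhs => rw [coordEuler, Finset.sum_mul]; arg 2; rw [divD]
  rw [← Finset.sum_add_distrib]
  refine Finset.sum_congr rfl fun i _ => ?_
  rw [← mul_assoc, divD_mul_coordOp, add_mul, mul_assoc, (divD_commute_xD i).eq, mul_assoc,
    (xD_xiD_commute i i).eq]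

theorem divD_mul_euler : divD n * euler n = euler n * divD n + divD n := by
  conv_lhs => rw [euler_eq_sum, Finset.mul_sum]
  conv_rhs => rw [euler_eq_sum, Finset.sum_mul]; arg 2; rw [divD]
  rw [← Finset.sum_add_distrib]
  refine Finset.sum_congr rfl fun i _ => ?_
  rw [← mul_assoc, divD_mul_momOp, add_mul, mul_assoc, (divD_commute_xiD i).eq, mul_assoc]

theorem divD_mul_pairingOp :
    divD n * pairingOp n = pairingOp n * divD n + coordEuler n + euler n + (n : ℂ) • 1 := by
  have : ∀ i, divD n * (coordOp i * momOp i) =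
      coordOp i * momOp i * divD n + coordOp i * xD i + xiD i * momOp i := by
    intro i
    rw [← mul_assoc, divD_mul_coordOp, add_mul, mul_assoc, divD_mul_momOp, mul_add, mul_assoc]
  rw [pairingOp, Finset.mul_sum, Finset.sum_mul]
  simp only [this, Finset.sum_add_distrib]
  rw [sum_xiD_mul_momOp, ← coordEuler, add_assoc, add_assoc, add_assoc]

/-! ### The Lie derivatives along projective vector fields -/

/-- The vector field `∂/∂xʲ`. -/
def transField (j : Fin n) : VField n := Pi.single j 1

/-- The vector field `xⁱ ∂/∂xʲ`. -/
def linField (i j : Fin n) : VField n := Pi.single j (coordFn i)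

/-- The vector field `xˢ xʲ ∂/∂xʲ`. -/
def quadField (s : Fin n) : VField n := fun j => coordFn s * coordFn j

theorem vdiv_transField (j : Fin n) : vdiv (transField j) = 0 := by
  rw [vdiv]
  refine Finset.sum_eq_zero fun i _ => ?_
  by_cases h : i = j
  · subst h; simp [transField, partialD_one]
  · simp [transField, h]

theorem partialD_linField (i j p q : Fin n) :
    partialD q (linField i j p) = if p = j then if q = i then 1 else 0 else 0 := by
  by_cases h : p = j
  · subst h; simp [linField, partialD_coordFn]
  · simp [linField, h]

theorem vdiv_linField (i j : Fin n) : vdiv (linField i j) = if i = j then 1 else 0 := by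
  simp only [vdiv, partialD_linField, Finset.sum_ite_eq', Finset.mem_univ, if_true]
  simp [eq_comm]

theorem partialD_quadField (s p q : Fin n) :
    partialD q (quadField s p) =
      (if q = s then coordFn p else 0) + if q = p then coordFn s else 0 := by
  rw [quadField, partialD_mul, partialD_coordFn, partialD_coordFn]
  split_ifs <;> simp

theorem vdiv_quadField (s : Fin n) : vdiv (quadField s) = ((n : ℂ) + 1) • coordFn s := by
  simp only [vdiv, partialD_quadField, Finset.sum_add_distrib, Finset.sum_ite_eq',
    Finset.mem_univ, if_true]
  simp [add_smul, add_comm, Nat.cast_smul_eq_nsmul]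

theorem lieSymb_transField (δ : ℂ) (j : Fin n) : lieSymb δ (transField j) = xD j := by
  have h1 : ∀ i, mulSymb (C (transField j i)) * xD i = if i = j then xD i else 0 := by
    intro i
    by_cases h : i = j
    · subst h; simp [transField, mulSymb_one]
    · simp [transField, h]
  have h2 : ∀ p q, partialD q (transField j p) = 0 := by
    intro p q
    by_cases h : p = j
    · subst h; simp [transField, partialD_one]
    · simp [transField, h]
  simp [lieSymb, h1, h2, vdiv_transField]

theorem lieSymb_linField (δ : ℂ) (i j : Fin n) :
    lieSymb δ (linField i j) =
      coordOp i * xD j - momOp j * xiD i + if i = j then δ • 1 else 0 := by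
  have h1 : ∀ p, mulSymb (C (linField i j p)) * xD p =
      if p = j then coordOp i * xD p else 0 := by
    intro p
    by_cases h : p = j
    · subst h; simp [linField, coordOp]
    · simp [linField, h]
  have h2 : ∀ p q, mulSymb (C (partialD q (linField i j p)) * X p) * xiD q =
      if q = i then if p = j then momOp p * xiD q else 0 else 0 := by
    intro p q
    rw [partialD_linField]
    split_ifs <;> simp [momOp]
  simp only [lieSymb, h1, h2, vdiv_linField, Finset.sum_ite_eq', Finset.mem_univ, if_true]
  congr 1
  split_ifs <;> simp [mulSymb_one]

theorem lieSymb_quadField (δ : ℂ) (s : Fin n) :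
    lieSymb δ (quadField s) = coordOp s * coordEuler n - pairingOp n * xiD s
      - coordOp s * euler n + (((n : ℂ) + 1) * δ) • coordOp s := by
  have h2 : ∀ p q, mulSymb (C (partialD q (quadField s p)) * X p) * xiD q =
      (if q = s then coordOp p * momOp p * xiD q else 0) +
        if q = p then coordOp s * (momOp p * xiD q) else 0 := by
    intro p q
    rw [partialD_quadField, map_add, add_mul, map_add, add_mul]
    congr 1
    · split_ifs <;> simp [momOp, coordOp, mulSymb_mul]
    · split_ifs <;> simp [momOp, coordOp, mulSymb_mul, mul_assoc]
  have h1 : ∀ p, mulSymb (C (quadField s p)) * xD p = coordOp s * (coordOp p * xD p) := by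
    intro p
    rw [quadField, map_mul, mulSymb_mul, mul_assoc]
    rfl
  simp only [lieSymb, h1, h2, vdiv_quadField, Finset.sum_add_distrib,
    Finset.sum_ite_eq', Finset.mem_univ, if_true, ← Finset.mul_sum, ← Finset.sum_mul]
  rw [← coordEuler, ← pairingOp, ← euler_eq_sum, sub_sub]
  congr 1
  have : mulSymb (C (((n : ℂ) + 1) • coordFn s)) = ((n : ℂ) + 1) • coordOp s := by
    apply LinearMap.ext
    intro P
    simp [mulSymb_apply, coordOp, MvPolynomial.C_mul', smul_assoc]
  rw [this, smul_smul, mul_comm]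

theorem lieDensity_transField (lam : ℂ) (j : Fin n) :
    lieDensity lam (transField j) = partialD j := by
  have h1 : ∀ i, mulOp (transField j i) * partialD i = if i = j then partialD i else 0 := by
    intro i
    by_cases h : i = j
    · subst h; simp [transField, mulOp_one]
    · simp [transField, h]
  simp [lieDensity, h1, vdiv_transField]

theorem lieDensity_linField (lam : ℂ) (i j : Fin n) :
    lieDensity lam (linField i j) =
      mulOp (coordFn i) * partialD j + if i = j then lam • 1 else 0 := by
  have h1 : ∀ p, mulOp (linField i j p) * partialD p =
      if p = j then mulOp (coordFn i) * partialD p else 0 := by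
    intro p
    by_cases h : p = j
    · subst h; simp [linField]
    · simp [linField, h]
  simp only [lieDensity, h1, vdiv_linField, Finset.sum_ite_eq', Finset.mem_univ, if_true]
  congr 1
  split_ifs <;> simp [mulOp_one]

theorem lieDensity_quadField (lam : ℂ) (s : Fin n) :
    lieDensity lam (quadField s) = ∑ j, mulOp (coordFn s) * (mulOp (coordFn j) * partialD j)
      + (((n : ℂ) + 1) * lam) • mulOp (coordFn s) := by
  have h1 : ∀ p, mulOp (quadField s p) * partialD p =
      mulOp (coordFn s) * (mulOp (coordFn p) * partialD p) := by
    intro p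
    rw [quadField, mulOp_mul, mul_assoc]
  simp only [lieDensity, h1, vdiv_quadField, map_smul, smul_smul]
  rw [mul_comm lam]

theorem mulSymb_C_smul (a : ℂ) (f : SmoothFn n) : mulSymb (C (a • f)) = a • mulSymb (C f) := by
  apply LinearMap.ext
  intro P
  simp [mulSymb_apply, MvPolynomial.C_mul', smul_assoc]

theorem vdiv_add (Y Z : VField n) : vdiv (Y + Z) = vdiv Y + vdiv Z := by
  simp [vdiv, Finset.sum_add_distrib]

theorem vdiv_smul (a : ℂ) (Y : VField n) : vdiv (a • Y) = a • vdiv Y := by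
  simp [vdiv, Finset.smul_sum]

/-- The Lie derivative of symbols, as a linear function of the vector field. -/
def lieSymbHom (δ : ℂ) : VField n →ₗ[ℂ] Module.End ℂ (Symb n) where
  toFun := lieSymb δ
  map_add' Y Z := by
    simp only [lieSymb, Pi.add_apply, map_add, add_mul, Finset.sum_add_distrib, vdiv_add, smul_add]
    abel
  map_smul' a Y := by
    have h : ∀ i j, mulSymb (C (a • partialD j (Y i)) * X i : Symb n) =
        a • mulSymb (C (partialD j (Y i)) * X i : Symb n) := by
      intro i j
      rw [mulSymb_mul, mulSymb_C_smul, smul_mul_assoc, mulSymb_mul]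
    simp only [lieSymb, Pi.smul_apply, map_smul, vdiv_smul, mulSymb_C_smul, h, smul_mul_assoc,
      ← Finset.smul_sum, RingHom.id_apply, smul_add, smul_sub]
    rw [smul_comm]

theorem lieSymbHom_apply (δ : ℂ) (Y : VField n) : lieSymbHom δ Y = lieSymb δ Y := rfl

/-- The Lie derivative of densities, as a linear function of the vector field. -/
def lieDensityHom (lam : ℂ) : VField n →ₗ[ℂ] Module.End ℂ (SmoothFn n) where
  toFun := lieDensity lam
  map_add' Y Z := by
    simp only [lieDensity, Pi.add_apply, map_add, add_mul, Finset.sum_add_distrib, vdiv_add,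
      smul_add]
    abel
  map_smul' a Y := by
    simp only [lieDensity, Pi.smul_apply, map_smul, vdiv_smul, smul_mul_assoc,
      ← Finset.smul_sum, RingHom.id_apply, smul_add]
    rw [smul_comm]

theorem lieDensityHom_apply (lam : ℂ) (Y : VField n) :
    lieDensityHom lam Y = lieDensity lam Y := rfl

/-- Densities are the symbols of degree zero of the same weight. This lets `casimir_lieDensity` be
read off from the computation on symbols. -/
theorem lieSymb_C (lam : ℂ) (Y : VField n) (f : SmoothFn n) :
    lieSymb lam Y (C f) = C (lieDensity lam Y f) := by
  have h1 : ∀ i, xD i (C f : Symb n) = C (partialD i f) := fun i => xD_monomial i 0 f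
  have h2 : ∀ i, xiD i (C f : Symb n) = 0 := fun i => by simp [xiD_apply]
  have h3 : ∀ a : ℂ, ∀ g : SmoothFn n, (C (a • g) : Symb n) = a • C g := by
    intro a g
    rw [← MvPolynomial.monomial_zero', MvPolynomial.smul_monomial]
  simp [lieSymb, lieDensity, h1, h2, mulSymb_apply, mulOp_apply, h3]

/-! ### Lie derivatives and the divergence operator -/

theorem lieSymb_transField_commute_divD (δ : ℂ) (j : Fin n) :
    Commute (lieSymb δ (transField j)) (divD n) := by
  rw [lieSymb_transField]
  exact (divD_commute_xD j).symm

theorem lieSymb_linField_commute_divD (δ : ℂ) (i j : Fin n) :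
    Commute (lieSymb δ (linField i j)) (divD n) := by
  rw [lieSymb_linField]
  refine Commute.add_left ?_ ?_
  · rw [Commute, SemiconjBy, sub_mul, mul_sub, ← mul_assoc, ← mul_assoc, divD_mul_coordOp,
      divD_mul_momOp, add_mul, add_mul, mul_assoc, mul_assoc, mul_assoc, mul_assoc,
      (divD_commute_xD j).eq, (divD_commute_xiD i).eq, (xD_xiD_commute j i).eq]
    abel
  · split_ifs
    · exact (Commute.one_left _).smul_left _
    · exact Commute.zero_left _

/-- The divergence is invariant under affine fields only. Its defect under the quadratic fields is
the origin of the lower parameter `2E + (n+1)(1-δ)` of the hypergeometric function. -/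
theorem lieSymb_quadField_mul_divD (δ : ℂ) (s : Fin n) :
    lieSymb δ (quadField s) * divD n = divD n * lieSymb δ (quadField s) +
      ((2 : ℂ) • euler n + (((n : ℂ) + 1) * (1 - δ)) • 1) * xiD s := by
  have h1 : divD n * (coordOp s * coordEuler n) =
      coordOp s * coordEuler n * divD n + coordOp s * divD n + coordEuler n * xiD s := by
    rw [← mul_assoc, divD_mul_coordOp, add_mul, mul_assoc, divD_mul_coordEuler, mul_add,
      (coordEuler_xiD s).eq, mul_assoc]
  have h2 : divD n * (pairingOp n * xiD s) = pairingOp n * xiD s * divD n +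
      coordEuler n * xiD s + euler n * xiD s + (n : ℂ) • xiD s := by
    rw [← mul_assoc, divD_mul_pairingOp]
    simp only [add_mul, mul_assoc, (divD_commute_xiD s).eq, smul_mul_assoc, one_mul]
  have h3 : divD n * (coordOp s * euler n) = coordOp s * euler n * divD n +
      coordOp s * divD n + euler n * xiD s + xiD s := by
    rw [← mul_assoc, divD_mul_coordOp, add_mul, mul_assoc, divD_mul_euler, mul_add,
      xiD_mul_euler, mul_assoc, add_assoc, add_assoc, add_assoc]
  rw [lieSymb_quadField]
  simp only [mul_add, mul_sub, add_mul, sub_mul, h1, h2, h3, mul_smul_comm, divD_mul_coordOp,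
    smul_mul_assoc, one_mul]
  module

/-! ### The Casimir operator of `sl(n+1, ℝ)` -/

/-- The projective vector fields that correspond to the matrix units of `gl(n+1, ℝ)`, made
trace-free. -/
def slField (a b : Fin (n + 1)) : VField n :=
  Fin.cases (Fin.cases (-∑ i, linField i i) (fun j => transField j) b)
    (fun i => Fin.cases (-quadField i) (fun j => linField i j) b) a

theorem slField_zero_zero : slField (0 : Fin (n + 1)) 0 = -∑ i, linField i i := rfl

theorem slField_zero_succ (j : Fin n) : slField 0 j.succ = transField j := rfl

theorem slField_succ_zero (i : Fin n) : slField i.succ 0 = -quadField i := rfl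

theorem slField_succ_succ (i j : Fin n) : slField i.succ j.succ = linField i j := rfl

theorem transField_mem (j : Fin n) : transField j ∈ projFields n :=
  Submodule.subset_span (Or.inl (Or.inl ⟨j, rfl⟩))

theorem linField_mem (i j : Fin n) : linField i j ∈ projFields n :=
  Submodule.subset_span (Or.inl (Or.inr ⟨(i, j), rfl⟩))

theorem quadField_mem (i : Fin n) : quadField i ∈ projFields n :=
  Submodule.subset_span (Or.inr ⟨i, rfl⟩)

theorem slField_mem (a b : Fin (n + 1)) : slField a b ∈ projFields n := by
  refine Fin.cases ?_ (fun i => ?_) a <;> refine Fin.cases ?_ (fun j => ?_) b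
  · exact neg_mem (Submodule.sum_mem _ fun i _ => linField_mem i i)
  · exact transField_mem j
  · exact neg_mem (quadField_mem i)
  · exact linField_mem i j

/-- The eigenvalue of the Casimir operator on symbols of degree `k` and weight `δ`. -/
def casimirValue (n : ℕ) (δ : ℂ) (k : ℕ) : ℂ :=
  2 * (k : ℂ) ^ 2 + 2 * k * (n - δ * (n + 1)) + n * (n + 1) * δ * (δ - 1)

theorem sum_lieSymb_linField (δ : ℂ) :
    ∑ i : Fin n, lieSymb δ (linField i i) = coordEuler n - euler n + ((n : ℂ) * δ) • 1 := by
  simp only [lieSymb_linField, if_true, Finset.sum_add_distrib, Finset.sum_sub_distrib]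
  rw [← coordEuler, ← euler_eq_sum]
  simp [← Nat.cast_smul_eq_nsmul ℂ, smul_smul]

theorem sum_lieSymb_linField_mul (δ : ℂ) :
    ∑ i : Fin n, ∑ j : Fin n, lieSymb δ (linField i j) * lieSymb δ (linField j i) =
      coordEuler n * coordEuler n + ((n : ℂ) - 1 + 2 * δ) • coordEuler n
        + euler n * euler n + ((n : ℂ) - 1 - 2 * δ) • euler n
        - (2 : ℂ) • (pairingOp n * divD n) + ((n : ℂ) * δ ^ 2) • 1 := by
  -- The factors are grouped so that each double sum collapses to `coordEuler`, `euler` or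
  -- `pairingOp * divD`.
  have h : ∀ i j : Fin n, lieSymb δ (linField i j) * lieSymb δ (linField j i) =
      coordOp i * (xD j * coordOp j) * xD i - (coordOp i * momOp i) * (xD j * xiD j)
        - (coordOp j * momOp j) * (xD i * xiD i) + momOp j * (xiD i * momOp i) * xiD j
        + if i = j then ((2 * δ) • (coordOp i * xD i) - (2 * δ) • (momOp i * xiD i)
          + (δ ^ 2) • 1) else 0 := by
    intro i j
    have e1 : coordOp i * xD j * (momOp i * xiD j) = (coordOp i * momOp i) * (xD j * xiD j) := by
      rw [mul_assoc, ← mul_assoc (xD j), (xD_momOp j i).eq]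
      simp only [mul_assoc]
    have e2 : momOp j * xiD i * (coordOp j * xD i) = (coordOp j * momOp j) * (xD i * xiD i) := by
      rw [mul_assoc, ← mul_assoc (xiD i), (xiD_coordOp i j).eq, (xD_xiD_commute i i).eq,
        (coordOp_momOp j j).eq]
      simp only [mul_assoc]
    rw [lieSymb_linField, lieSymb_linField]
    by_cases hij : i = j
    · subst hij
      simp only [if_true]
      have e3 : momOp i * xiD i * (coordOp i * xD i) = coordOp i * xD i * (momOp i * xiD i) :=
        e2.trans e1.symm
      rw [← e1]
      simp only [mul_assoc] at e3
      simp only [mul_add, add_mul, mul_sub, sub_mul, smul_mul_assoc, mul_smul_comm, one_mul,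
        mul_one, mul_assoc, e3]
      module
    · simp only [hij, Ne.symm hij, if_false, add_zero, ← e1, ← e2, mul_sub, sub_mul, mul_assoc]
      abel
  have h1 : ∑ i : Fin n, ∑ j : Fin n, coordOp i * (xD j * coordOp j) * xD i =
      coordEuler n * coordEuler n + ((n : ℂ) - 1) • coordEuler n := by
    have : ∀ i : Fin n, ∑ j : Fin n, coordOp i * (xD j * coordOp j) * xD i =
        coordOp i * xD i * coordEuler n + ((n : ℂ) - 1) • (coordOp i * xD i) := by
      intro i
      rw [← Finset.sum_mul, ← Finset.mul_sum, sum_xD_mul_coordOp]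
      have := xD_mul_coordEuler i
      rw [mul_assoc, mul_assoc, this]
      simp only [mul_add, add_mul, smul_mul_assoc, one_mul, mul_smul_comm]
      module
    simp only [this, Finset.sum_add_distrib, ← Finset.sum_mul, ← Finset.smul_sum]
    rfl
  have h4 : ∑ i : Fin n, ∑ j : Fin n, momOp j * (xiD i * momOp i) * xiD j =
      euler n * euler n + ((n : ℂ) - 1) • euler n := by
    have : ∀ j : Fin n, ∑ i : Fin n, momOp j * (xiD i * momOp i) * xiD j =
        momOp j * xiD j * euler n + ((n : ℂ) - 1) • (momOp j * xiD j) := by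
      intro i
      rw [← Finset.sum_mul, ← Finset.mul_sum, sum_xiD_mul_momOp]
      have := xiD_mul_euler i
      rw [mul_assoc, mul_assoc, this]
      simp only [mul_add, add_mul, smul_mul_assoc, one_mul, mul_smul_comm]
      module
    rw [Finset.sum_comm]
    simp only [this, Finset.sum_add_distrib, ← Finset.sum_mul, ← Finset.smul_sum]
    rfl
  have h2 : ∑ i : Fin n, ∑ j : Fin n, (coordOp i * momOp i) * (xD j * xiD j) =
      pairingOp n * divD n := by
    rw [pairingOp, divD, Finset.sum_mul_sum]
  have h3 : ∑ i : Fin n, ∑ j : Fin n, (coordOp j * momOp j) * (xD i * xiD i) =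
      pairingOp n * divD n := by
    rw [Finset.sum_comm, h2]
  simp only [h, Finset.sum_add_distrib, Finset.sum_sub_distrib, h1, h2, h3, h4,
    Finset.sum_ite_eq, Finset.mem_univ, if_true, ← Finset.smul_sum]
  rw [← coordEuler, ← euler_eq_sum]
  simp only [Finset.sum_const, Finset.card_univ, Fintype.card_fin, ← Nat.cast_smul_eq_nsmul ℂ]
  module

theorem sum_lieSymb_quadField_mul (δ : ℂ) :
    ∑ s : Fin n, lieSymb δ (quadField s) * xD s =
      coordEuler n * coordEuler n - coordEuler n - pairingOp n * divD n
        - coordEuler n * euler n + (((n : ℂ) + 1) * δ) • coordEuler n := by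
  have h : ∀ s : Fin n, lieSymb δ (quadField s) * xD s =
      coordOp s * xD s * coordEuler n - coordOp s * xD s - pairingOp n * (xD s * xiD s)
        - coordOp s * xD s * euler n + (((n : ℂ) + 1) * δ) • (coordOp s * xD s) := by
    intro s
    have e : coordEuler n * xD s = xD s * coordEuler n - xD s := by
      rw [xD_mul_coordEuler]; abel
    rw [lieSymb_quadField]
    simp only [add_mul, sub_mul, smul_mul_assoc, mul_assoc, e, (euler_xD s).eq, mul_sub,
      (xD_xiD_commute s s).eq]
  simp only [h, Finset.sum_add_distrib, Finset.sum_sub_distrib, ← Finset.sum_mul,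
    ← Finset.mul_sum, ← Finset.smul_sum]
  rw [← coordEuler, ← divD]

theorem sum_mul_lieSymb_quadField (δ : ℂ) :
    ∑ s : Fin n, xD s * lieSymb δ (quadField s) =
      ∑ s : Fin n, lieSymb δ (quadField s) * xD s + ((n : ℂ) + 1) • coordEuler n
        - ((n : ℂ) + 1) • euler n + (((n : ℂ) + 1) * δ * n) • 1 := by
  have h : ∀ s : Fin n, xD s * lieSymb δ (quadField s) =
      lieSymb δ (quadField s) * xD s + coordEuler n + coordOp s * xD s
        - momOp s * xiD s - euler n + (((n : ℂ) + 1) * δ) • 1 := by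
    intro s
    have e1 : xD s * (coordOp s * coordEuler n) =
        coordOp s * coordEuler n * xD s + coordEuler n + coordOp s * xD s := by
      rw [← mul_assoc, xD_mul_coordOp, if_pos rfl, add_mul, mul_assoc, xD_mul_coordEuler,
        mul_add, one_mul, mul_assoc]
      abel
    have e0 : xD s * pairingOp n = pairingOp n * xD s + momOp s := by
      have : ∀ i, xD s * (coordOp i * momOp i) =
          coordOp i * momOp i * xD s + if s = i then momOp i else 0 := by
        intro i
        rw [← mul_assoc, xD_mul_coordOp, add_mul, mul_assoc, (xD_momOp s i).eq, mul_assoc]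
        split_ifs <;> simp
      simp only [pairingOp, Finset.mul_sum, Finset.sum_mul, this, Finset.sum_add_distrib,
        Finset.sum_ite_eq, Finset.mem_univ, if_true]
    have e2 : xD s * (pairingOp n * xiD s) = pairingOp n * xiD s * xD s + momOp s * xiD s := by
      rw [← mul_assoc, e0, add_mul, mul_assoc, (xD_xiD_commute s s).eq, mul_assoc]
    have e3 : xD s * (coordOp s * euler n) = coordOp s * euler n * xD s + euler n := by
      rw [← mul_assoc, xD_mul_coordOp, if_pos rfl, add_mul, mul_assoc, ← (euler_xD s).eq,
        one_mul, mul_assoc]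
    have e4 : xD s * coordOp s = coordOp s * xD s + 1 := by rw [xD_mul_coordOp, if_pos rfl]
    rw [lieSymb_quadField]
    simp only [mul_add, mul_sub, e1, e2, e3, mul_smul_comm, e4, add_mul, sub_mul, smul_mul_assoc,
      smul_add]
    abel
  simp only [h, Finset.sum_add_distrib, Finset.sum_sub_distrib]
  rw [← coordEuler, ← euler_eq_sum]
  simp only [Finset.sum_const, Finset.card_univ, Fintype.card_fin, ← Nat.cast_smul_eq_nsmul ℂ]
  module

/-- Matrix units `E_ab` and `E_ba` are dual for the trace form, which explains the pairing of
indices. The contributions of `pairingOp * divD` and of `coordEuler` from the linear and the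
quadratic fields cancel, and a quadratic polynomial in the Euler operator remains. -/
theorem casimir_lieSymb (δ : ℂ) :
    ∑ a : Fin (n + 1), ∑ b : Fin (n + 1), lieSymb δ (slField a b) * lieSymb δ (slField b a) =
      degOp (casimirValue n δ) := by
  have hneg : ∀ Y : VField n, lieSymb δ (-Y) = -lieSymb δ Y := fun Y => map_neg (lieSymbHom δ) Y
  have hsum : lieSymb δ (∑ i : Fin n, linField i i) = ∑ i : Fin n, lieSymb δ (linField i i) :=
    map_sum (lieSymbHom δ) _ _
  have hval : degOp (n := n) (casimirValue n δ) = (2 : ℂ) • (euler n * euler n)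
      + (2 * ((n : ℂ) - δ * (n + 1))) • euler n + ((n : ℂ) * (n + 1) * δ * (δ - 1)) • 1 := by
    rw [euler_eq_degOp, degOp_mul, ← degOp_smul, ← degOp_smul, ← degOp_const, ← degOp_add,
      ← degOp_add]
    congr 1
    ext k
    simp [casimirValue]
    ring
  have hmn : ∀ A B : Module.End ℂ (Symb n), A * -B = -(A * B) := fun A B => mul_neg A B
  have hnm : ∀ A B : Module.End ℂ (Symb n), -A * B = -(A * B) := fun A B => neg_mul A B
  have hsn : ∀ F : Fin n → Module.End ℂ (Symb n), ∑ i, -F i = -∑ i, F i :=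
    fun F => Finset.sum_neg_distrib F
  simp only [Fin.sum_univ_succ, slField_zero_zero, slField_zero_succ, slField_succ_zero,
    slField_succ_succ, hneg, hsum, lieSymb_transField, Finset.sum_add_distrib, hmn, hnm, hsn,
    neg_neg]
  rw [sum_lieSymb_linField_mul, sum_mul_lieSymb_quadField, sum_lieSymb_quadField_mul,
    sum_lieSymb_linField, hval]
  simp only [mul_add, add_mul, mul_sub, sub_mul, smul_mul_assoc, mul_smul_comm, one_mul, mul_one,
    euler_coordEuler.eq]
  module

theorem casimir_lieDensity (lam : ℂ) :
    ∑ a : Fin (n + 1), ∑ b : Fin (n + 1),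
      lieDensity lam (slField a b) * lieDensity lam (slField b a) =
      casimirValue n lam 0 • (1 : Module.End ℂ (SmoothFn n)) := by
  apply LinearMap.ext
  intro f
  have := LinearMap.congr_fun (casimir_lieSymb (n := n) lam) (C f)
  have hd : degOp (casimirValue n lam) (C f : Symb n) = C (casimirValue n lam 0 • f) := by
    rw [← MvPolynomial.monomial_zero', degOp_monomial, MvPolynomial.smul_monomial]
    simp
  simp only [LinearMap.sum_apply, Module.End.mul_apply, lieSymb_C, ← map_sum, hd] at this
  simpa using MvPolynomial.C_injective _ _ this

/-! ### Lie derivatives of differential operators under normal ordering -/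

theorem coordFn_mul_normalEnd (c : ℂ) (i : Fin n) (P : Symb n) :
    mulOp (coordFn i) * normalEnd n c P = normalEnd n c (coordOp i P) :=
  (normalEnd_C_mul c (coordFn i) P).symm

theorem normalEnd_mul_coordFn (c : ℂ) (i : Fin n) (P : Symb n) :
    normalEnd n c P * mulOp (coordFn i) = normalEnd n c ((coordOp i + c • xiD i) P) := by
  rw [normalEnd_mul_coord, LinearMap.add_apply, LinearMap.smul_apply, map_add, map_smul, coordOp]

theorem normalEnd_mul_partialD {c : ℂ} (hc : c ≠ 0) (i : Fin n) (P : Symb n) :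
    normalEnd n c P * partialD i = normalEnd n c ((c⁻¹ • momOp i) P) := by
  rw [LinearMap.smul_apply, map_smul, momOp, normalEnd_X_mul, smul_smul, inv_mul_cancel₀ hc,
    one_smul]

theorem partialD_mul_normalEnd' {c : ℂ} (hc : c ≠ 0) (i : Fin n) (P : Symb n) :
    partialD i * normalEnd n c P = normalEnd n c ((xD i + c⁻¹ • momOp i) P) := by
  rw [partialD_mul_normalEnd, normalEnd_mul_partialD hc, ← map_add, LinearMap.add_apply]

theorem lieOp_transField {c : ℂ} (lam mu : ℂ) (j : Fin n) (P : Symb n) :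
    lieOp lam mu (transField j) (normalEnd n c P) =
      normalEnd n c (lieSymb (mu - lam) (transField j) P) := by
  rw [lieOp, lieDensity_transField, lieDensity_transField, partialD_mul_normalEnd,
    add_sub_cancel_right, lieSymb_transField]

theorem lieOp_linField {c : ℂ} (hc : c ≠ 0) (lam mu : ℂ) (i j : Fin n) (P : Symb n) :
    lieOp lam mu (linField i j) (normalEnd n c P) =
      normalEnd n c (lieSymb (mu - lam) (linField i j) P) := by
  have key : lieSymb (mu - lam) (linField i j) =
      coordOp i * (xD j + c⁻¹ • momOp j) + (if i = j then mu • 1 else 0)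
        - (c⁻¹ • momOp j * (coordOp i + c • xiD i) + (if i = j then lam • 1 else 0)) := by
    have : (c⁻¹ • momOp j) * (coordOp i + c • xiD i) =
        c⁻¹ • (coordOp i * momOp j) + momOp j * xiD i := by
      rw [mul_add, smul_mul_assoc, smul_mul_assoc, mul_smul_comm, smul_smul, inv_mul_cancel₀ hc,
        one_smul, (coordOp_momOp i j).eq]
    rw [lieSymb_linField, this, mul_add, mul_smul_comm]
    split_ifs <;> module
  rw [lieOp, lieDensity_linField, lieDensity_linField, key, add_mul, mul_add, mul_assoc,
    ← mul_assoc (normalEnd n c P), partialD_mul_normalEnd' hc, normalEnd_mul_coordFn,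
    normalEnd_mul_partialD hc, coordFn_mul_normalEnd]
  split_ifs <;> simp [Module.End.mul_apply]

/-- Left and right multiplications by `xʲ` and `∂/∂xʲ` are first transported to symbols. The extra
term comes from moving derivatives to the right: past the product `xˢ xʲ` it gives `E ∂/∂ξₛ`, and
past the divergence term of the `lam`-density it gives `(n+1) lam ∂/∂ξₛ`. This is the source of the
upper parameter. -/
theorem lieOp_quadField {c : ℂ} (hc : c ≠ 0) (lam mu : ℂ) (s : Fin n) (P : Symb n) :
    lieOp lam mu (quadField s) (normalEnd n c P) =
      normalEnd n c ((lieSymb (mu - lam) (quadField s)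
        + (-c) • ((euler n + (((n : ℂ) + 1) * lam) • 1) * xiD s)) P) := by
  have key : lieSymb (mu - lam) (quadField s)
        + (-c) • ((euler n + (((n : ℂ) + 1) * lam) • 1) * xiD s) =
      (∑ j, coordOp s * (coordOp j * (xD j + c⁻¹ • momOp j))
          + (((n : ℂ) + 1) * mu) • coordOp s)
        - (∑ j, c⁻¹ • momOp j * ((coordOp j + c • xiD j) * (coordOp s + c • xiD s))
          + (((n : ℂ) + 1) * lam) • (coordOp s + c • xiD s)) := by
    have h1 : ∑ j, coordOp s * (coordOp j * (xD j + c⁻¹ • momOp j)) =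
        coordOp s * coordEuler n + c⁻¹ • (coordOp s * pairingOp n) := by
      simp only [← Finset.mul_sum, mul_add, mul_smul_comm, Finset.sum_add_distrib,
        ← Finset.smul_sum]
      rfl
    have h2 : ∀ j : Fin n, c⁻¹ • momOp j * ((coordOp j + c • xiD j) * (coordOp s + c • xiD s)) =
        c⁻¹ • (coordOp j * momOp j * coordOp s) + coordOp j * momOp j * xiD s
          + momOp j * xiD j * coordOp s + c • (momOp j * xiD j * xiD s) := by
      intro j
      rw [(coordOp_momOp j j).eq]
      simp only [mul_add, add_mul, smul_mul_assoc, mul_smul_comm, smul_add, smul_smul, mul_assoc]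
      have h' : c⁻¹ * c = 1 := inv_mul_cancel₀ hc
      simp only [mul_comm c c⁻¹, h', one_smul, mul_one]
      abel
    have h3 : pairingOp n * coordOp s = coordOp s * pairingOp n :=
      (Commute.sum_left _ _ _ fun i _ =>
        (coordOp_commute i s).mul_left (coordOp_momOp s i).symm : Commute _ _).eq
    have h4 : (euler n + (((n : ℂ) + 1) * lam) • 1) * xiD s =
        euler n * xiD s + (((n : ℂ) + 1) * lam) • xiD s := by
      rw [add_mul, smul_mul_assoc, one_mul]
    simp only [h1, h2, Finset.sum_add_distrib, ← Finset.smul_sum, ← Finset.sum_mul]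
    rw [← pairingOp, ← euler_eq_sum, lieSymb_quadField, h3, (euler_coordOp s).eq, h4]
    module
  rw [lieOp, lieDensity_quadField, lieDensity_quadField, key, add_mul, mul_add, Finset.sum_mul,
    Finset.mul_sum]
  have e1 : ∀ j, mulOp (coordFn s) * (mulOp (coordFn j) * partialD j) * normalEnd n c P =
      normalEnd n c ((coordOp s * (coordOp j * (xD j + c⁻¹ • momOp j))) P) := by
    intro j
    rw [mul_assoc, mul_assoc, partialD_mul_normalEnd' hc, coordFn_mul_normalEnd,
      coordFn_mul_normalEnd]
    rfl
  have e2 : ∀ j, normalEnd n c P * (mulOp (coordFn s) * (mulOp (coordFn j) * partialD j)) =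
      normalEnd n c ((c⁻¹ • momOp j * ((coordOp j + c • xiD j) * (coordOp s + c • xiD s))) P) := by
    intro j
    rw [← mul_assoc, ← mul_assoc, normalEnd_mul_coordFn, normalEnd_mul_coordFn,
      normalEnd_mul_partialD hc]
    rfl
  simp only [e1, e2, smul_mul_assoc, mul_smul_comm, coordFn_mul_normalEnd, normalEnd_mul_coordFn]
  simp only [← map_sum, ← map_smul, ← map_add, ← map_sub]
  congr 1
  simp only [LinearMap.sub_apply, LinearMap.add_apply, LinearMap.sum_apply, LinearMap.smul_apply,
    map_smul]

/-! ### Existence: the hypergeometric intertwiner -/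

/-! ### Functional calculus for the degree -/

/-- `degOp` as a homomorphism of algebras. -/
def degHom (n : ℕ) : (ℕ → ℂ) →ₐ[ℂ] Module.End ℂ (Symb n) :=
  AlgHom.ofLinearMap
    { toFun := degOp
      map_add' := degOp_add
      map_smul' := degOp_smul }
    ((degOp_const 1).trans (one_smul _ _)) (fun g h => (degOp_mul g h).symm)

theorem degHom_apply (g : ℕ → ℂ) : degHom n g = degOp g := rfl

theorem degOp_one : degOp (n := n) 1 = 1 := map_one (degHom n)

theorem pochOp_degOp (g : ℕ → ℂ) (m : ℕ) :
    pochOp (degOp (n := n) g) m = degOp (fun k => (ascPochhammer ℂ m).eval (g k)) := by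
  rw [pochOp, ← degHom_apply, Polynomial.aeval_algHom_apply, degHom_apply]
  congr 1
  ext k
  have := Polynomial.aeval_algHom_apply (Pi.evalAlgHom ℂ (fun _ : ℕ => ℂ) k) g (ascPochhammer ℂ m)
  rw [Pi.evalAlgHom_apply, Pi.evalAlgHom_apply] at this
  rw [← this, Polynomial.coe_aeval_eq_eval]

theorem isUnit_degOp {g : ℕ → ℂ} (hg : ∀ k, g k ≠ 0) : IsUnit (degOp (n := n) g) :=
  (isUnit_iff_exists_inv.2 ⟨g⁻¹, funext fun k => mul_inv_cancel₀ (hg k)⟩ : IsUnit g).map (degHom n)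

theorem inverse_degOp {g : ℕ → ℂ} (hg : ∀ k, g k ≠ 0) :
    Ring.inverse (degOp (n := n) g) = degOp g⁻¹ := by
  have h : degOp (n := n) g * degOp g⁻¹ = 1 := by
    rw [degOp_mul, ← degOp_one]
    congr 1
    exact funext fun k => mul_inv_cancel₀ (hg k)
  have := Ring.inverse_mul_cancel _ (isUnit_degOp (n := n) hg)
  calc Ring.inverse (degOp (n := n) g)
      = Ring.inverse (degOp g) * (degOp g * degOp g⁻¹) := by rw [h, mul_one]
    _ = degOp g⁻¹ := by rw [← mul_assoc, this, one_mul]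

theorem euler_add_smul (a : ℂ) : euler n + a • 1 = degOp (fun k => k + a) := by
  rw [euler_eq_degOp, ← degOp_const, ← degOp_add]
  rfl

theorem two_smul_euler_add_smul (b : ℂ) :
    (2 : ℂ) • euler n + b • 1 = degOp (fun k => 2 * k + b) := by
  rw [euler_eq_degOp, ← degOp_const, ← degOp_smul, ← degOp_add]
  rfl

theorem divD_mul_degOp (g : ℕ → ℂ) :
    divD n * degOp g = degOp (fun k => g (k + 1)) * divD n := by
  rw [divD, Finset.sum_mul, Finset.mul_sum]
  refine Finset.sum_congr rfl fun i _ => ?_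
  rw [mul_assoc, xiD_mul_degOp, ← mul_assoc, ← (degOp_commute_xD _ i).eq, mul_assoc]

theorem divD_pow_mul_degOp (g : ℕ → ℂ) (m : ℕ) :
    divD n ^ m * degOp g = degOp (fun k => g (k + m)) * divD n ^ m := by
  induction m generalizing g with
  | zero => simp
  | succ m ih =>
    rw [pow_succ, mul_assoc, divD_mul_degOp, ← mul_assoc, ih, mul_assoc]
    simp only [add_assoc]

/-- Lie derivatives of symbols preserve the degree: every `∂/∂ξⱼ` in them is accompanied by one
factor `ξᵢ`. -/
theorem degOp_commute_lieSymb (g : ℕ → ℂ) (δ : ℂ) (Y : VField n) :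
    Commute (degOp g) (lieSymb δ Y) := by
  rw [lieSymb]
  refine Commute.add_right (Commute.sub_right ?_ ?_) ?_
  · exact Commute.sum_right _ _ _ fun i _ => (degOp_commute_C g _).mul_right (degOp_commute_xD g i)
  · refine Commute.sum_right _ _ _ fun i _ => Commute.sum_right _ _ _ fun j _ => ?_
    rw [mulSymb_mul, mul_assoc]
    refine (degOp_commute_C g _).mul_right ?_
    rw [Commute, SemiconjBy, ← mul_assoc, degOp_mul_X, mul_assoc, ← xiD_mul_degOp, mul_assoc]
  · exact (degOp_commute_C g _).smul_right δ

/-! ### The hypergeometric symbol map -/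

/-- The coefficient `(k + a)ₘ / (m! (2k + b)ₘ)` of the symbol map. -/
def hypCoeff (a b : ℂ) (m k : ℕ) : ℂ :=
  (m.factorial : ℂ)⁻¹ * ((ascPochhammer ℂ m).eval (k + a) *
    ((ascPochhammer ℂ m).eval (2 * k + b))⁻¹)

theorem ascPochhammer_eval_ne_zero {z : ℂ} (hz : ∀ j : ℕ, z + j ≠ 0) (m : ℕ) :
    (ascPochhammer ℂ m).eval z ≠ 0 := by
  induction m with
  | zero => simp
  | succ m ih =>
    rw [ascPochhammer_succ_eval]
    exact mul_ne_zero ih (hz m)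

theorem hypCoeff_zero (a b : ℂ) (k : ℕ) : hypCoeff a b 0 k = 1 := by simp [hypCoeff]

/-- The recursion in `m` behind equivariance under the quadratic fields, written without division.
The factor `2k + b + m` is nonzero by the assumption at `l = 2k + m`. -/
theorem hypCoeff_succ {a b : ℂ} (hb : ∀ l : ℕ, (l : ℂ) + b ≠ 0) (m k : ℕ) :
    hypCoeff a b (m + 1) k * ((m + 1) * (2 * k + b + m)) = hypCoeff a b m k * (k + m + a) := by
  have h1 : (2 * (k : ℂ) + b + m) ≠ 0 := by
    have := hb (2 * k + m)
    push_cast at this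
    intro h
    exact this (by rw [← h]; ring)
  have h2 : ((m : ℂ) + 1) ≠ 0 := Nat.cast_add_one_ne_zero m
  simp only [hypCoeff, ascPochhammer_succ_eval, Nat.factorial_succ, Nat.cast_mul, Nat.cast_add,
    Nat.cast_one, mul_inv]
  have e1 := inv_mul_cancel₀ h1
  have e2 := inv_mul_cancel₀ h2
  generalize (2 * (k : ℂ) + b + m)⁻¹ = u at *
  generalize ((m : ℂ) + 1)⁻¹ = v at *
  generalize (m.factorial : ℂ)⁻¹ = w
  generalize ((ascPochhammer ℂ m).eval (2 * (k : ℂ) + b))⁻¹ = q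
  generalize (ascPochhammer ℂ m).eval ((k : ℂ) + a) = p
  linear_combination (w * p * q * (k + m + a)) * (v * (m + 1) * e1 + e2)

/-- The `m`-th term of the symbol map. -/
def hypTerm (n : ℕ) (a b c : ℂ) (m : ℕ) : Module.End ℂ (Symb n) :=
  degOp (hypCoeff a b m) * (-c • divD n) ^ m

theorem hypTerm_eq_zero (a b c : ℂ) {k m : ℕ} (h : k ≤ m) {P : Symb n} (hP : P ∈ symbLT n k) :
    hypTerm n a b c m P = 0 := by
  rw [hypTerm, smul_pow, Module.End.mul_apply, LinearMap.smul_apply,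
    divD_pow_eq_zero (symbLT_mono h hP), smul_zero, map_zero]

theorem finsum_hypTerm (a b c : ℂ) {k : ℕ} {P : Symb n} (hP : P ∈ symbLT n k) :
    ∑ᶠ m, hypTerm n a b c m P = ∑ m ∈ Finset.range k, hypTerm n a b c m P := by
  apply finsum_eq_sum_of_support_subset
  intro m hm
  rw [Function.mem_support] at hm
  rw [Finset.coe_range, Set.mem_Iio]
  by_contra h
  exact hm (hypTerm_eq_zero a b c (not_lt.1 h) hP)

/-- The projectively equivariant symbol map, on normally ordered symbols. -/
def symbolMap (n : ℕ) (a b c : ℂ) : Module.End ℂ (Symb n) where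
  toFun P := ∑ᶠ m, hypTerm n a b c m P
  map_add' P R := by
    obtain ⟨k, hP⟩ := exists_mem_symbLT P
    obtain ⟨l, hR⟩ := exists_mem_symbLT R
    have hP' := symbLT_mono (le_max_left k l) hP
    have hR' := symbLT_mono (le_max_right k l) hR
    rw [finsum_hypTerm a b c hP', finsum_hypTerm a b c hR', finsum_hypTerm a b c (add_mem hP' hR')]
    simp only [map_add, Finset.sum_add_distrib]
  map_smul' z P := by
    obtain ⟨k, hP⟩ := exists_mem_symbLT P
    rw [finsum_hypTerm a b c hP, finsum_hypTerm a b c (Submodule.smul_mem _ z hP)]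
    simp only [map_smul, Finset.smul_sum, RingHom.id_apply]

theorem symbolMap_eq_sum (a b c : ℂ) {k : ℕ} {P : Symb n} (hP : P ∈ symbLT n k) :
    symbolMap n a b c P = ∑ m ∈ Finset.range k, hypTerm n a b c m P :=
  finsum_hypTerm a b c hP

theorem pochOp_denominator {b : ℂ} (hb : ∀ l : ℕ, (l : ℂ) + b ≠ 0) (m k : ℕ) :
    (ascPochhammer ℂ m).eval (2 * (k : ℂ) + b) ≠ 0 := by
  apply ascPochhammer_eval_ne_zero
  intro j h
  apply hb (2 * k + j)
  rw [← h]
  push_cast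
  ring

theorem symbolMap_eq_confluentF (a c : ℂ) {b : ℂ} (hb : ∀ l : ℕ, (l : ℂ) + b ≠ 0) (P : Symb n) :
    symbolMap n a b c P =
      confluentF (euler n + a • 1) ((2 : ℂ) • euler n + b • 1) (-c • divD n) P := by
  change ∑ᶠ m, hypTerm n a b c m P = _
  rw [confluentF]
  congr 1
  ext1 m
  rw [euler_add_smul, two_smul_euler_add_smul, pochOp_degOp, pochOp_degOp,
    inverse_degOp (pochOp_denominator hb m), degOp_mul, ← LinearMap.smul_apply,
    ← smul_mul_assoc, ← degOp_smul]
  rfl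

/-- The term `m = 0` is the identity, and every other term contains a factor `D`, which lowers the
degree. -/
theorem symbolMap_unipotent (a b c : ℂ) (k : ℕ) (P : Symb n) (hP : P ∈ symbLT n (k + 1)) :
    symbolMap n a b c P - P ∈ symbLT n k := by
  have h0 : hypTerm n a b c 0 P = P := by
    have : hypCoeff a b 0 = 1 := funext (hypCoeff_zero a b)
    rw [hypTerm, this, degOp_one, pow_zero, one_mul, Module.End.one_apply]
  rw [symbolMap_eq_sum a b c hP, Finset.sum_range_succ', h0, add_sub_cancel_right]
  refine Submodule.sum_mem _ fun m _ => ?_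
  rw [hypTerm, Module.End.mul_apply, smul_pow, LinearMap.smul_apply]
  refine degOp_mem _ (Submodule.smul_mem _ _ ?_)
  rw [pow_succ, Module.End.mul_apply]
  have : ∀ m : ℕ, ∀ R ∈ symbLT n k, (divD n ^ m) R ∈ symbLT n k := by
    intro m
    induction m with
    | zero => exact fun R hR => hR
    | succ m ih =>
      intro R hR
      rw [pow_succ, Module.End.mul_apply]
      exact ih _ (divD_mem (symbLT_mono (Nat.le_succ k) hR))
  exact this m _ (divD_mem hP)

/-- Each of the `m + 1` factors `D` contributes one commutator, and moving the powers of `D` past it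
shifts the degree. The coefficient is the arithmetic sum `∑_{j ≤ m} (2(k+j) + b) = (m+1)(2k+b+m)`,
where `b = (n+1)(1-δ)`. -/
theorem lieSymb_quadField_mul_divD_pow (δ : ℂ) (s : Fin n) (m : ℕ) :
    lieSymb δ (quadField s) * divD n ^ (m + 1) = divD n ^ (m + 1) * lieSymb δ (quadField s) +
      degOp (fun k => (m + 1) * (2 * k + ((n : ℂ) + 1) * (1 - δ) + m)) * (xiD s * divD n ^ m) := by
  induction m with
  | zero =>
    rw [zero_add, pow_one, lieSymb_quadField_mul_divD, two_smul_euler_add_smul]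
    simp
  | succ m ih =>
    rw [pow_succ, ← mul_assoc, ih, add_mul, mul_assoc, lieSymb_quadField_mul_divD, mul_add,
      two_smul_euler_add_smul, ← mul_assoc (divD n ^ (m + 1)), ← mul_assoc (divD n ^ (m + 1)),
      divD_pow_mul_degOp, mul_assoc (degOp _), mul_assoc (degOp _),
      ((divD_commute_xiD s).pow_left (m + 1)).eq, mul_assoc (xiD s), ← pow_succ, ← pow_succ,
      add_assoc,
      ← add_mul, ← degOp_add]
    congr 3
    ext k
    simp only [Pi.add_apply]
    push_cast
    ring

theorem lieSymb_mul_hypTerm_zero (δ a b c : ℂ) (Y : VField n) :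
    lieSymb δ Y * hypTerm n a b c 0 = hypTerm n a b c 0 * lieSymb δ Y := by
  rw [hypTerm, pow_zero, mul_one, (degOp_commute_lieSymb _ δ Y).eq]

/-- By the recursion, the failure of the term of index `m + 1` to commute with the field is the term
of index `m` applied to the extra term of `lieOp_quadField`. Summation over `m` therefore gives
equivariance. -/
theorem lieSymb_quadField_mul_hypTerm {δ : ℂ}
    (hb : ∀ l : ℕ, (l : ℂ) + ((n : ℂ) + 1) * (1 - δ) ≠ 0) (a c : ℂ) (s : Fin n) (m : ℕ) :
    lieSymb δ (quadField s) * hypTerm n a (((n : ℂ) + 1) * (1 - δ)) c (m + 1) =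
      hypTerm n a (((n : ℂ) + 1) * (1 - δ)) c (m + 1) * lieSymb δ (quadField s) +
        hypTerm n a (((n : ℂ) + 1) * (1 - δ)) c m * ((-c) • ((euler n + a • 1) * xiD s)) := by
  have h : degOp (n := n) (hypCoeff a (((n : ℂ) + 1) * (1 - δ)) (m + 1)) *
      degOp (fun k => (m + 1) * (2 * k + ((n : ℂ) + 1) * (1 - δ) + m)) =
      degOp (hypCoeff a (((n : ℂ) + 1) * (1 - δ)) m) * degOp (fun k => ((k + m : ℕ) : ℂ) + a) := by
    rw [degOp_mul, degOp_mul]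
    congr 1
    ext k
    rw [Pi.mul_apply, Pi.mul_apply, hypCoeff_succ hb]
    push_cast
    rfl
  simp only [hypTerm, smul_pow]
  rw [← mul_assoc, ← (degOp_commute_lieSymb _ _ _).eq, mul_assoc, mul_smul_comm,
    lieSymb_quadField_mul_divD_pow, smul_add, mul_add, mul_assoc, smul_mul_assoc, mul_smul_comm,
    mul_smul_comm, ← mul_assoc (degOp (hypCoeff a _ (m + 1))) (degOp _), h, euler_add_smul]
  congr 1
  simp only [mul_smul_comm, smul_mul_assoc, mul_assoc, smul_smul, pow_succ']
  rw [← mul_assoc (divD n ^ m), divD_pow_mul_degOp, mul_assoc,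
    ((divD_commute_xiD s).pow_left m).eq]

theorem symbolMap_lieSymb_of_commute (δ a b c : ℂ) {Y : VField n}
    (hY : Commute (lieSymb δ Y) (divD n)) (P : Symb n) :
    symbolMap n a b c (lieSymb δ Y P) = lieSymb δ Y (symbolMap n a b c P) := by
  obtain ⟨k, hP⟩ := exists_mem_symbLT P
  obtain ⟨l, hR⟩ := exists_mem_symbLT (lieSymb δ Y P)
  rw [symbolMap_eq_sum a b c (symbLT_mono (le_max_left k l) hP),
    symbolMap_eq_sum a b c (symbLT_mono (le_max_right k l) hR), map_sum]
  refine Finset.sum_congr rfl fun m _ => ?_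
  have : Commute (hypTerm n a b c m) (lieSymb δ Y) :=
    (degOp_commute_lieSymb _ δ Y).mul_left ((hY.symm.smul_left (-c)).pow_left m)
  exact LinearMap.congr_fun this.eq P

theorem symbolMap_lieSymb_quadField {δ : ℂ}
    (hb : ∀ l : ℕ, (l : ℂ) + ((n : ℂ) + 1) * (1 - δ) ≠ 0) (a c : ℂ) (s : Fin n) (P : Symb n) :
    symbolMap n a (((n : ℂ) + 1) * (1 - δ)) c
      ((lieSymb δ (quadField s) + (-c) • ((euler n + a • 1) * xiD s)) P) =
      lieSymb δ (quadField s) (symbolMap n a (((n : ℂ) + 1) * (1 - δ)) c P) := by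
  obtain ⟨k₁, h₁⟩ := exists_mem_symbLT P
  obtain ⟨k₂, h₂⟩ := exists_mem_symbLT (lieSymb δ (quadField s) P)
  obtain ⟨k₃, h₃⟩ := exists_mem_symbLT (((-c) • ((euler n + a • 1) * xiD s)) P)
  -- The sums with the Lie derivative get one summand more than the sum with the extra term, since
  -- correction `m` is matched with term `m + 1`. The term `m = 0` is treated separately.
  rw [LinearMap.add_apply, map_add,
    symbolMap_eq_sum _ _ _ (symbLT_mono (show k₁ ≤ k₁ + k₂ + k₃ + 1 by omega) h₁),
    symbolMap_eq_sum _ _ _ (symbLT_mono (show k₂ ≤ k₁ + k₂ + k₃ + 1 by omega) h₂),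
    symbolMap_eq_sum _ _ _ (symbLT_mono (show k₃ ≤ k₁ + k₂ + k₃ by omega) h₃), map_sum,
    Finset.sum_range_succ', Finset.sum_range_succ', add_right_comm, ← Finset.sum_add_distrib]
  refine congrArg₂ (· + ·) ?_ ?_
  · refine Finset.sum_congr rfl fun m _ => ?_
    have h := LinearMap.congr_fun (lieSymb_quadField_mul_hypTerm hb a c s m) P
    rw [Module.End.mul_apply, LinearMap.add_apply, Module.End.mul_apply,
      Module.End.mul_apply] at h
    exact h.symm
  · rw [← Module.End.mul_apply, ← Module.End.mul_apply, lieSymb_mul_hypTerm_zero]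

/-! ### The quantization map -/

/-- The hypergeometric symbol map for `lam`- and `mu`-densities, as a linear bijection. -/
def symbolEquiv (n : ℕ) (lam mu c : ℂ) : Symb n ≃ₗ[ℂ] Symb n :=
  LinearEquiv.ofBijective
    (symbolMap n (((n : ℂ) + 1) * lam) (((n : ℂ) + 1) * (1 - (mu - lam))) c)
    (bijective_of_unipotent (symbolMap_unipotent _ _ _))

theorem symbolEquiv_apply (lam mu c : ℂ) (P : Symb n) : symbolEquiv n lam mu c P =
    symbolMap n (((n : ℂ) + 1) * lam) (((n : ℂ) + 1) * (1 - (mu - lam))) c P := rfl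

/-- The projectively equivariant quantization map. -/
def quantization (n : ℕ) (lam mu : ℂ) {c : ℂ} (hc : c ≠ 0) : Symb n ≃ₗ[ℂ] DiffOp n :=
  (symbolEquiv n lam mu c).symm.trans
    (LinearEquiv.ofBijective (normalOrder n c) (normalOrder_bijective hc))

theorem quantization_symm_normalOrder (lam mu : ℂ) {c : ℂ} (hc : c ≠ 0) (P : Symb n) :
    (quantization n lam mu hc).symm (normalOrder n c P) = symbolEquiv n lam mu c P := by
  rw [LinearEquiv.symm_apply_eq, quantization, LinearEquiv.trans_apply,
    LinearEquiv.symm_apply_apply]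
  rfl

/-- The quantization map with values in all endomorphisms. -/
def quantEnd (n : ℕ) (lam mu : ℂ) {c : ℂ} (hc : c ≠ 0) :
    Symb n →ₗ[ℂ] Module.End ℂ (SmoothFn n) :=
  (DiffOp n).subtype ∘ₗ (quantization n lam mu hc).toLinearMap

theorem quantEnd_apply (lam mu : ℂ) {c : ℂ} (hc : c ≠ 0) (P : Symb n) :
    quantEnd n lam mu hc P = normalEnd n c ((symbolEquiv n lam mu c).symm P) := rfl

theorem quantEnd_symbolEquiv (lam mu : ℂ) {c : ℂ} (hc : c ≠ 0) (P : Symb n) :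
    quantEnd n lam mu hc (symbolEquiv n lam mu c P) = normalEnd n c P := by
  rw [quantEnd_apply, LinearEquiv.symm_apply_apply]

theorem quantEnd_injective (lam mu : ℂ) {c : ℂ} (hc : c ≠ 0) :
    Function.Injective (quantEnd n lam mu hc) :=
  (normalEnd_injective hc).comp (symbolEquiv n lam mu c).symm.injective

theorem symbolEquiv_symm_mem (lam mu c : ℂ) (W : Submodule ℂ (Symb n))
    (hW : ∀ P ∈ W, symbolEquiv n lam mu c P ∈ W) {P : Symb n} (hP : P ∈ W) :
    (symbolEquiv n lam mu c).symm P ∈ W := by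
  obtain ⟨k, hk⟩ := exists_mem_symbLT P
  obtain ⟨R, hR, hTR, -⟩ := exists_preimage_of_unipotent (T := symbolMap n _ _ c)
    (symbolMap_unipotent _ _ _) hW k P hk hP
  rw [← hTR, ← symbolEquiv_apply, LinearEquiv.symm_apply_apply]
  exact hR

theorem symbolEquiv_mem_symbLT (lam mu c : ℂ) {k : ℕ} {P : Symb n} (hP : P ∈ symbLT n k) :
    symbolEquiv n lam mu c P ∈ symbLT n k := by
  have := symbolMap_unipotent (((n : ℂ) + 1) * lam) (((n : ℂ) + 1) * (1 - (mu - lam))) c k P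
    (symbLT_mono (Nat.le_succ k) hP)
  rw [symbolEquiv_apply]
  simpa using add_mem this hP

theorem symbolEquiv_symm_mem_symbLT (lam mu c : ℂ) {k : ℕ} {P : Symb n} (hP : P ∈ symbLT n k) :
    (symbolEquiv n lam mu c).symm P ∈ symbLT n k :=
  symbolEquiv_symm_mem lam mu c _ (fun _ => symbolEquiv_mem_symbLT lam mu c) hP

theorem symbolEquiv_symm_sub_mem (lam mu c : ℂ) {k : ℕ} {P : Symb n} (hP : P ∈ symbLT n (k + 1)) :
    (symbolEquiv n lam mu c).symm P - P ∈ symbLT n k := by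
  have := symbolMap_unipotent (((n : ℂ) + 1) * lam) (((n : ℂ) + 1) * (1 - (mu - lam))) c k _
    (symbolEquiv_symm_mem_symbLT lam mu c hP)
  rw [← symbolEquiv_apply, LinearEquiv.apply_symm_apply] at this
  simpa using neg_mem this

theorem map_symbLT_quantEnd (lam mu : ℂ) {c : ℂ} (hc : c ≠ 0) (k : ℕ) :
    (symbLT n k).map (quantEnd n lam mu hc) = DiffOpLT n k := by
  rw [← map_symbLT_normalEnd hc]
  ext A
  constructor
  · rintro ⟨P, hP, rfl⟩
    exact ⟨_, symbolEquiv_symm_mem_symbLT lam mu c hP, rfl⟩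
  · rintro ⟨P, hP, rfl⟩
    exact ⟨_, symbolEquiv_mem_symbLT lam mu c hP, quantEnd_symbolEquiv lam mu hc P⟩

theorem quantEnd_sub_mem (lam mu : ℂ) {c : ℂ} (hc : c ≠ 0) {k : ℕ} {P : Symb n}
    (hP : P ∈ symbLT n (k + 1)) :
    quantEnd n lam mu hc P - normalEnd n c P ∈ DiffOpLT n k := by
  rw [← map_symbLT_normalEnd hc, quantEnd_apply, ← map_sub]
  exact ⟨_, symbolEquiv_symm_sub_mem lam mu c hP, rfl⟩

/-- The action of vector fields on operators, as a real linear function of the vector field. -/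
def lieOpHom (lam mu : ℂ) (A : Module.End ℂ (SmoothFn n)) :
    VField n →ₗ[ℂ] Module.End ℂ (SmoothFn n) :=
  LinearMap.mulRight ℂ A ∘ₗ lieDensityHom mu - LinearMap.mulLeft ℂ A ∘ₗ lieDensityHom lam

theorem lieOpHom_apply (lam mu : ℂ) (A : Module.End ℂ (SmoothFn n)) (Y : VField n) :
    lieOpHom lam mu A Y = lieOp lam mu Y A := rfl

theorem quantEnd_equivariant {lam mu : ℂ}
    (hb : ∀ l : ℕ, (l : ℂ) + ((n : ℂ) + 1) * (1 - (mu - lam)) ≠ 0) {c : ℂ} (hc : c ≠ 0)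
    {Y : VField n} (hY : Y ∈ projFields n) (P : Symb n) :
    quantEnd n lam mu hc (lieSymb (mu - lam) Y P) = lieOp lam mu Y (quantEnd n lam mu hc P) := by
  -- For a symbol in the image of the symbol map the quantization is the normal ordering of `R`. It
  -- remains to compare the transported actions on the generators of the Lie algebra.
  obtain ⟨R, rfl⟩ := (symbolEquiv n lam mu c).surjective P
  rw [quantEnd_symbolEquiv]
  rw [projFields] at hY
  induction hY using Submodule.span_induction with
  | mem Y hY =>
    obtain (⟨j, rfl⟩ | ⟨⟨i, j⟩, rfl⟩) | ⟨s, rfl⟩ := hY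
    · change quantEnd n lam mu hc (lieSymb (mu - lam) (transField j) _) =
        lieOp lam mu (transField j) _
      rw [lieOp_transField, symbolEquiv_apply,
        ← symbolMap_lieSymb_of_commute _ _ _ _ (lieSymb_transField_commute_divD _ j),
        ← symbolEquiv_apply, quantEnd_symbolEquiv]
    · change quantEnd n lam mu hc (lieSymb (mu - lam) (linField i j) _) =
        lieOp lam mu (linField i j) _
      rw [lieOp_linField hc, symbolEquiv_apply,
        ← symbolMap_lieSymb_of_commute _ _ _ _ (lieSymb_linField_commute_divD _ i j),
        ← symbolEquiv_apply, quantEnd_symbolEquiv]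
    · change quantEnd n lam mu hc (lieSymb (mu - lam) (quadField s) _) =
        lieOp lam mu (quadField s) _
      rw [lieOp_quadField hc, symbolEquiv_apply, ← symbolMap_lieSymb_quadField hb,
        ← symbolEquiv_apply, quantEnd_symbolEquiv]
  | zero =>
    rw [← lieSymbHom_apply, ← lieOpHom_apply, map_zero, map_zero, LinearMap.zero_apply, map_zero]
  | add Y Z _ _ hY hZ =>
    rw [← lieSymbHom_apply, ← lieOpHom_apply, map_add, map_add, LinearMap.add_apply, map_add,
      lieSymbHom_apply, lieSymbHom_apply, lieOpHom_apply, lieOpHom_apply, hY, hZ]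
  | smul r Y _ hY =>
    have : r • Y = (r : ℂ) • Y := rfl
    rw [this, ← lieSymbHom_apply, ← lieOpHom_apply, map_smul, map_smul, LinearMap.smul_apply,
      map_smul, lieSymbHom_apply, lieOpHom_apply, hY]

theorem isProjEquivQuantization_quantization {lam mu : ℂ}
    (hb : ∀ l : ℕ, (l : ℂ) + ((n : ℂ) + 1) * (1 - (mu - lam)) ≠ 0) {c : ℂ} (hc : c ≠ 0) :
    IsProjEquivQuantization n lam mu c (quantization n lam mu hc).toLinearMap where
  equivariant _ hY P := quantEnd_equivariant hb hc hY P
  principal _ _ hP := quantEnd_sub_mem lam mu hc (mem_symbLT_of_isHomogeneous hP)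

/-! ### Uniqueness -/

theorem casimirValue_ne {δ : ℂ} (hb : ∀ l : ℕ, (l : ℂ) + ((n : ℂ) + 1) * (1 - δ) ≠ 0) {k l : ℕ}
    (hkl : l < k) : casimirValue n δ l ≠ casimirValue n δ k := by
  intro h
  -- Half the difference of the two values factors in this way. The truncated subtraction `k + l -
  -- 1` is genuine because `l < k`.
  have h1 : (((k : ℂ) - l) * (((k + l - 1 : ℕ) : ℂ) + ((n : ℂ) + 1) * (1 - δ))) = 0 := by
    rw [Nat.cast_sub (by omega)]
    simp only [casimirValue] at h
    push_cast
    linear_combination (-1 / 2) * h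
  rcases mul_eq_zero.1 h1 with h2 | h2
  · rw [sub_eq_zero, Nat.cast_inj] at h2
    omega
  · exact hb _ h2

/-- For `P` of degree `k`, both `P` and `T P` are eigenvectors of the Casimir operator with the
value of degree `k`, hence so is `T P - P`. All components of the latter have degree below `k` and
belong to other eigenvalues, so they vanish. -/
theorem eq_self_of_commute_lieSymb {δ : ℂ}
    (hb : ∀ l : ℕ, (l : ℂ) + ((n : ℂ) + 1) * (1 - δ) ≠ 0) {T : Module.End ℂ (Symb n)}
    (hT : ∀ Y ∈ projFields n, Commute T (lieSymb δ Y))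
    (hp : ∀ k, ∀ P : Symb n, P.IsHomogeneous k → T P - P ∈ symbLT n k) : T = 1 := by
  have hC : Commute T (degOp (casimirValue n δ)) := by
    rw [← casimir_lieSymb]
    exact Commute.sum_right _ _ _ fun a _ => Commute.sum_right _ _ _ fun b _ =>
      (hT _ (slField_mem a b)).mul_right (hT _ (slField_mem b a))
  apply symb_end_ext
  intro α f
  have hhom : (monomial α f : Symb n).IsHomogeneous α.degree :=
    MvPolynomial.isHomogeneous_monomial _ rfl
  have hlow := hp _ _ hhom
  have h1 := LinearMap.congr_fun hC.eq (monomial α f)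
  rw [Module.End.mul_apply, Module.End.mul_apply, degOp_monomial, map_smul] at h1
  have h2 : degOp (casimirValue n δ) (T (monomial α f) - monomial α f) =
      casimirValue n δ α.degree • (T (monomial α f) - monomial α f) := by
    rw [map_sub, ← h1, degOp_monomial, smul_sub]
  rw [Module.End.one_apply, ← sub_eq_zero]
  apply MvPolynomial.ext
  intro β
  rw [MvPolynomial.coeff_zero]
  by_cases hβ : α.degree ≤ β.degree
  · exact hlow β hβ
  · have h3 := congrArg (MvPolynomial.coeff β) h2
    rw [coeff_degOp, MvPolynomial.coeff_smul, ← sub_eq_zero, ← sub_smul, smul_eq_zero] at h3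
    exact h3.resolve_left (sub_ne_zero.2 (casimirValue_ne hb (not_le.1 hβ)))

/-- The previous lemma is applied to the composite of `Q'` with the inverse of the constructed
quantization. -/
theorem quantization_unique {lam mu : ℂ}
    (hb : ∀ l : ℕ, (l : ℂ) + ((n : ℂ) + 1) * (1 - (mu - lam)) ≠ 0) {c : ℂ} (hc : c ≠ 0)
    {Q' : Symb n →ₗ[ℂ] DiffOp n} (hQ' : IsProjEquivQuantization n lam mu c Q') :
    Q' = (quantization n lam mu hc).toLinearMap := by
  have hq : ∀ P, quantEnd n lam mu hc ((quantization n lam mu hc).symm (Q' P)) = Q' P := by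
    intro P
    change ((quantization n lam mu hc) ((quantization n lam mu hc).symm (Q' P)) :
      Module.End ℂ (SmoothFn n)) = _
    rw [LinearEquiv.apply_symm_apply]
  have hT : (quantization n lam mu hc).symm.toLinearMap ∘ₗ Q' = 1 := by
    refine eq_self_of_commute_lieSymb hb (fun Y hY => ?_) (fun k P hP => ?_)
    · apply LinearMap.ext
      intro P
      apply quantEnd_injective lam mu hc
      simp only [Module.End.mul_apply, LinearMap.comp_apply, LinearEquiv.coe_coe]
      rw [hq, hQ'.equivariant Y hY, quantEnd_equivariant hb hc hY, hq]
    · have h1 := hQ'.principal k P hP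
      have h2 := quantEnd_sub_mem lam mu hc (mem_symbLT_of_isHomogeneous hP)
      have h3 := sub_mem h1 h2
      rw [normalEnd_apply, sub_sub_sub_cancel_right, ← hq, ← map_sub,
        ← map_symbLT_quantEnd lam mu hc] at h3
      obtain ⟨R, hR, hRe⟩ := h3
      change (quantization n lam mu hc).symm (Q' P) - P ∈ symbLT n k
      rwa [← quantEnd_injective lam mu hc hRe]
  apply LinearMap.ext
  intro P
  have := LinearMap.congr_fun hT P
  rw [LinearMap.comp_apply, LinearEquiv.coe_coe, LinearEquiv.symm_apply_eq] at this
  exact this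

/-! ### Naturality of the quantization under changes of affine chart -/

/-! ### The derivative of a fractional linear transformation -/

variable {g : Matrix.SpecialLinearGroup (Fin (n + 1)) ℝ}

theorem projVec_eq (x : Fin n → ℝ) (k : Fin (n + 1)) :
    projVec g x k = g k 0 + ∑ j : Fin n, g k j.succ * x j := by
  simp [projVec, Matrix.mulVec, dotProduct, Fin.sum_univ_succ]

/-- The derivative of a component of `projVec g`. -/
def projVecDeriv (g : Matrix.SpecialLinearGroup (Fin (n + 1)) ℝ) (k : Fin (n + 1)) :
    (Fin n → ℝ) →L[ℝ] ℝ :=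
  ∑ j : Fin n, g k j.succ • ContinuousLinearMap.proj (R := ℝ) (φ := fun _ : Fin n => ℝ) j

theorem projVecDeriv_single (k : Fin (n + 1)) (j : Fin n) :
    projVecDeriv g k (Pi.single j 1) = g k j.succ := by
  simp [projVecDeriv, Pi.single_apply]

theorem hasFDerivAt_projVec (k : Fin (n + 1)) (x : Fin n → ℝ) :
    HasFDerivAt (fun y => projVec g y k) (projVecDeriv g k) x := by
  have h : (fun y => projVec g y k) = fun y => g k 0 + projVecDeriv g k y := by
    ext y
    simp [projVec_eq, projVecDeriv]
  rw [h]
  exact (projVecDeriv g k).hasFDerivAt.const_add _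

theorem contDiff_projVec (k : Fin (n + 1)) : ContDiff ℝ ∞ (fun y => projVec g y k) := by
  have h : (fun y => projVec g y k) = fun y => g k 0 + projVecDeriv g k y := by
    ext y
    simp [projVec_eq, projVecDeriv]
  rw [h]
  exact contDiff_const.add (projVecDeriv g k).contDiff

/-- The Jacobian matrix of `projMap g`. -/
def projJac (g : Matrix.SpecialLinearGroup (Fin (n + 1)) ℝ) (x : Fin n → ℝ) :
    Matrix (Fin n) (Fin n) ℝ :=
  fun i j => (projVec g x 0)⁻¹ *
    (g i.succ j.succ - projVec g x i.succ * (g 0 j.succ / projVec g x 0))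

theorem hasFDerivAt_projMap {x : Fin n → ℝ} (hx : projVec g x 0 ≠ 0) :
    HasFDerivAt (projMap g) (Matrix.mulVecLin (projJac g x)).toContinuousLinearMap x := by
  rw [hasFDerivAt_pi']
  intro i
  have h := (hasFDerivAt_projVec (g := g) i.succ x).mul
    ((hasDerivAt_inv hx).comp_hasFDerivAt x (hasFDerivAt_projVec (g := g) 0 x))
  refine (h.congr_fderiv ?_).congr_of_eventuallyEq (Filter.Eventually.of_forall fun y => ?_)
  · ext v
    simp only [projVecDeriv, add_apply, smul_apply,
      sum_apply, ContinuousLinearMap.proj_apply, smul_eq_mul,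
      ContinuousLinearMap.comp_apply, LinearMap.coe_toContinuousLinearMap',
      Matrix.mulVecLin_apply, Matrix.mulVec, dotProduct, projJac, Function.comp]
    rw [Finset.mul_sum, Finset.mul_sum, Finset.mul_sum, ← Finset.sum_add_distrib]
    refine Finset.sum_congr rfl fun j _ => ?_
    field_simp
    ring
  · simp [projMap, div_eq_mul_inv]

theorem fderiv_projMap_single {x : Fin n → ℝ} (hx : projVec g x 0 ≠ 0) (i j : Fin n) :
    fderiv ℝ (projMap g) x (Pi.single j 1) i = projJac g x i j := by
  rw [(hasFDerivAt_projMap hx).fderiv]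
  simp

/-- Let `w = g (1, x)`. Replacing the first column of `g` by `w` keeps the determinant `1`.
Subtracting multiples of `w` from the other columns clears the rest of the first row and leaves the
block `w₀` times the Jacobian, so `1 = w₀ · w₀ⁿ · det`. -/
theorem det_projJac {x : Fin n → ℝ} (hx : projVec g x 0 ≠ 0) :
    (projJac g x).det = ((projVec g x 0) ^ (n + 1))⁻¹ := by
  set w := projVec g x with hw
  let G : Matrix (Fin (n + 1)) (Fin (n + 1)) ℝ := g
  have h1 : (G.updateCol 0 w).det = 1 := by
    have := Matrix.det_updateCol_sum G 0 (Fin.cons 1 x : Fin (n + 1) → ℝ)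
    rw [Fin.cons_zero, one_smul] at this
    have hG : G.det = 1 := g.2
    rw [← hG, ← this]
    congr 2
    ext k
    simp [hw, projVec, Matrix.mulVec, dotProduct, G, mul_comm]
  let B : Matrix (Fin (n + 1)) (Fin (n + 1)) ℝ := fun k b =>
    Fin.cases (w k) (fun j => g k j.succ - w k * (g 0 j.succ / w 0)) b
  have hB0 : ∀ k, B k 0 = w k := fun _ => rfl
  have hBs : ∀ k (j : Fin n), B k j.succ = G k j.succ - w k * (g 0 j.succ / w 0) := fun _ _ => rfl
  have h2 : B.det = 1 := by
    rw [← h1, ← Matrix.det_transpose B, ← Matrix.det_transpose (G.updateCol 0 w)]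
    symm
    refine Matrix.det_eq_of_forall_row_eq_smul_add_const
      (Fin.cases 0 fun j => g 0 j.succ / w 0) 0 rfl fun i j => ?_
    refine Fin.cases ?_ (fun i => ?_) i
    · rw [Matrix.transpose_apply, Matrix.transpose_apply, hB0]
      simp
    · rw [Matrix.transpose_apply, Matrix.transpose_apply, Matrix.transpose_apply, hB0, hBs,
        Matrix.updateCol_ne (Fin.succ_ne_zero i), Fin.cases_succ]
      ring
  rw [Matrix.det_succ_row_zero, Fin.sum_univ_succ] at h2
  have h3 : ∀ j : Fin n, B 0 j.succ = 0 := by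
    intro j
    rw [hBs]
    field_simp
    exact sub_self _
  have h4 : B.submatrix Fin.succ (Fin.succAbove 0) = w 0 • projJac g x := by
    ext i j
    rw [Matrix.submatrix_apply, Fin.zero_succAbove, hBs, Matrix.smul_apply, projJac, smul_eq_mul,
      ← hw, mul_inv_cancel_left₀ hx]
  rw [h4, Matrix.det_smul] at h2
  simp only [h3, hB0, Fin.val_zero, pow_zero, one_mul, mul_zero, zero_mul, Finset.sum_const_zero,
    add_zero, Fintype.card_fin] at h2
  rw [← mul_assoc, ← pow_succ'] at h2
  exact eq_inv_of_mul_eq_one_right h2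

/-- This identifies `s`-densities with homogeneous functions of degree `-(n+1)s` on the cone over
the chart. Positivity of `projVec g x 0` removes the absolute value and makes the laws of complex
powers available. -/
theorem jacPow_eq (s : ℂ) {x : Fin n → ℝ} (hx : 0 < projVec g x 0) :
    jacPow g s x = (projVec g x 0 : ℂ) ^ (-((n : ℂ) + 1) * s) := by
  have hdet : (fderiv ℝ (projMap g) x).det = ((projVec g x 0) ^ (n + 1))⁻¹ := by
    rw [(hasFDerivAt_projMap hx.ne').fderiv, ← det_projJac hx.ne', ContinuousLinearMap.det,
      LinearMap.coe_toContinuousLinearMap, ← Matrix.toLin'_apply', LinearMap.det_toLin']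
  have hpos : 0 < ((projVec g x 0) ^ (n + 1))⁻¹ := by positivity
  rw [jacPow, hdet, abs_of_pos hpos, Complex.cpow_def_of_ne_zero (by exact_mod_cast hpos.ne'),
    Complex.cpow_def_of_ne_zero (by exact_mod_cast hx.ne'), ← Complex.ofReal_log hpos.le,
    ← Complex.ofReal_log hx.le, Real.log_inv, Real.log_pow]
  congr 1
  push_cast
  ring

/-! ### Homogeneous coordinates on the cotangent spaces -/

/-- The derivatives in homogeneous coordinates, at `(1, x)`, of a homogeneous function of degree
`s` with value `f` and partial derivatives `v` at the point `x` of the chart. -/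
def homGrad (s f : ℂ) (x : Fin n → ℝ) (v : Fin n → ℂ) : Fin (n + 1) → ℂ :=
  Fin.cons (s * f - ∑ k, (x k : ℂ) * v k) v

/-- The gradient of a homogeneous function transforms by the transpose of `g`. The common factor
`(projVec g x 0) ^ s` has been divided out, which is why both sides carry the same value `f`; one
factor `projVec g x 0` remains because the gradient has degree `s - 1`. The components with positive
index are the chain rule, and the component `0` follows from Euler's identity. -/
theorem homGrad_projMap {x : Fin n → ℝ} (hx : projVec g x 0 ≠ 0) (s f : ℂ) (v v' : Fin n → ℂ)
    (h : ∀ j, v j = s * (g 0 j.succ / projVec g x 0) * f + ∑ i, v' i * projJac g x i j)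
    (b : Fin (n + 1)) :
    (projVec g x 0 : ℂ) * homGrad s f x v b =
      ∑ c, (g c b : ℂ) * homGrad s f (projMap g x) v' c := by
  have hw : (projVec g x 0 : ℂ) ≠ 0 := by exact_mod_cast hx
  have hsucc : ∀ j : Fin n, (projVec g x 0 : ℂ) * v j =
      ∑ c, (g c j.succ : ℂ) * homGrad s f (projMap g x) v' c := by
    intro j
    rw [Fin.sum_univ_succ, h]
    simp only [homGrad, Fin.cons_zero, Fin.cons_succ, projMap, projJac]
    push_cast
    rw [mul_add, mul_sub, Finset.mul_sum, Finset.mul_sum, sub_add, ← Finset.sum_sub_distrib,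
      sub_eq_add_neg, ← Finset.sum_neg_distrib]
    congr 1
    · field_simp
    · refine Finset.sum_congr rfl fun i _ => ?_
      field_simp
      ring
  refine Fin.cases ?_ (fun j => ?_) b
  -- Euler's identity at the point `projVec g x`.
  · have hE : ∑ c, (projVec g x c : ℂ) * homGrad s f (projMap g x) v' c =
        (projVec g x 0 : ℂ) * (s * f) := by
      rw [Fin.sum_univ_succ]
      simp only [homGrad, Fin.cons_zero, Fin.cons_succ, projMap]
      push_cast
      rw [mul_sub, Finset.mul_sum, sub_add, ← Finset.sum_sub_distrib, Finset.sum_eq_zero, sub_zero]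
      intro i _
      field_simp
      ring
    have h0 : ∀ c, (g c 0 : ℂ) = projVec g x c - ∑ k : Fin n, (x k : ℂ) * g c k.succ := by
      intro c
      rw [projVec_eq]
      push_cast
      rw [add_sub_assoc, ← Finset.sum_sub_distrib, Finset.sum_eq_zero, add_zero]
      intro i _
      ring
    simp only [h0, sub_mul, Finset.sum_sub_distrib, hE, Finset.sum_mul]
    rw [Finset.sum_comm]
    simp only [mul_assoc, ← Finset.mul_sum, ← hsucc]
    simp only [homGrad, Fin.cons_zero]
    rw [mul_sub, Finset.mul_sum]
    congr 1
    exact Finset.sum_congr rfl fun i _ => by ring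
  · rw [← hsucc]
    rfl

/-- The homogeneous coordinates `(1, x)`. -/
def homCoord (x : Fin n → ℝ) : Fin (n + 1) → ℂ := Fin.cons 1 fun k => (x k : ℂ)

theorem sum_mul_homCoord_projMap {x : Fin n → ℝ} (hx : projVec g x 0 ≠ 0) (c : Fin (n + 1)) :
    ∑ a, (g c a : ℂ) * homCoord x a = (projVec g x 0 : ℂ) * homCoord (projMap g x) c := by
  have hw : (projVec g x 0 : ℂ) ≠ 0 := by exact_mod_cast hx
  have h1 : ∑ a, (g c a : ℂ) * homCoord x a = projVec g x c := by
    rw [projVec_eq, Fin.sum_univ_succ]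
    simp [homCoord]
  rw [h1]
  refine Fin.cases ?_ (fun j => ?_) c
  · simp [homCoord]
  · simp only [homCoord, Fin.cons_succ, projMap]
    push_cast
    field_simp

theorem sum_inv_mul (a b : Fin (n + 1)) :
    ∑ c, ((g⁻¹ : Matrix.SpecialLinearGroup (Fin (n + 1)) ℝ) a c : ℂ) * (g c b : ℂ) =
      if a = b then 1 else 0 := by
  have : ((g⁻¹ * g : Matrix.SpecialLinearGroup (Fin (n + 1)) ℝ) a b : ℝ) =
      if a = b then 1 else 0 := by
    rw [inv_mul_cancel, Matrix.SpecialLinearGroup.coe_one, Matrix.one_apply]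
  rw [Matrix.SpecialLinearGroup.coe_mul, Matrix.mul_apply] at this
  have h := congrArg Complex.ofReal this
  rw [Complex.ofReal_sum] at h
  simpa only [Complex.ofReal_mul, apply_ite Complex.ofReal, Complex.ofReal_one,
    Complex.ofReal_zero] using h

theorem sum_mul_inv (a b : Fin (n + 1)) :
    ∑ c, (g a c : ℂ) * ((g⁻¹ : Matrix.SpecialLinearGroup (Fin (n + 1)) ℝ) c b : ℂ) =
      if a = b then 1 else 0 := by
  have : ((g * g⁻¹ : Matrix.SpecialLinearGroup (Fin (n + 1)) ℝ) a b : ℝ) =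
      if a = b then 1 else 0 := by
    rw [mul_inv_cancel, Matrix.SpecialLinearGroup.coe_one, Matrix.one_apply]
  rw [Matrix.SpecialLinearGroup.coe_mul, Matrix.mul_apply] at this
  have h := congrArg Complex.ofReal this
  rw [Complex.ofReal_sum] at h
  simpa only [Complex.ofReal_mul, apply_ite Complex.ofReal, Complex.ofReal_one,
    Complex.ofReal_zero] using h

theorem homCoord_eq {x : Fin n → ℝ} (hx : projVec g x 0 ≠ 0) (a : Fin (n + 1)) :
    homCoord x a = (projVec g x 0 : ℂ) *
      ∑ d, ((g⁻¹ : Matrix.SpecialLinearGroup (Fin (n + 1)) ℝ) a d : ℂ) *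
        homCoord (projMap g x) d := by
  have h : ∀ d, (projVec g x 0 : ℂ) *
      (((g⁻¹ : Matrix.SpecialLinearGroup (Fin (n + 1)) ℝ) a d : ℂ) * homCoord (projMap g x) d) =
      ∑ b, ((g⁻¹ : Matrix.SpecialLinearGroup (Fin (n + 1)) ℝ) a d : ℂ) * (g d b : ℂ) *
        homCoord x b := by
    intro d
    rw [mul_left_comm, ← sum_mul_homCoord_projMap hx, Finset.mul_sum]
    simp only [mul_assoc]
  rw [Finset.mul_sum, Finset.sum_congr rfl fun d _ => h d, Finset.sum_comm]
  simp only [← Finset.sum_mul, sum_inv_mul, ite_mul, one_mul, zero_mul, Finset.sum_ite_eq,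
    Finset.mem_univ, if_true]

/-! ### Lie derivatives of densities in homogeneous coordinates -/

theorem lieDensity_neg (lam : ℂ) (Y : VField n) : lieDensity lam (-Y) = -lieDensity lam Y :=
  map_neg (lieDensityHom lam) Y

theorem coordFn_apply (i : Fin n) (x : Fin n → ℝ) : coordFn i x = (x i : ℂ) := rfl

/-- On homogeneous functions of degree `-(n+1) lam` the field with indices `a`, `b` acts as `x_a ∂_b
+ lam δ_ab`. The constant makes the sum over `a = b` vanish, in agreement with Euler's identity. -/
theorem lieDensity_slField_apply (lam : ℂ) (a b : Fin (n + 1)) (φ : SmoothFn n) (x : Fin n → ℝ) :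
    lieDensity lam (slField a b) φ x =
      homCoord x a * homGrad (-((n : ℂ) + 1) * lam) (φ x) x (fun j => partialD j φ x) b
        + if a = b then lam * φ x else 0 := by
  have hl : ∀ i j, lieDensity lam (linField i j) φ x =
      (x i : ℂ) * partialD j φ x + if i = j then lam * φ x else 0 := by
    intro i j
    rw [lieDensity_linField]
    split_ifs <;> simp [mulOp_apply, coordFn_apply]
  refine Fin.cases ?_ (fun i => ?_) a <;> refine Fin.cases ?_ (fun j => ?_) b
  · rw [slField_zero_zero, lieDensity_neg]
    have : lieDensity lam (∑ i : Fin n, linField i i) = ∑ i : Fin n, lieDensity lam (linField i i) :=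
      map_sum (lieDensityHom lam) _ _
    rw [this]
    simp only [LinearMap.neg_apply, LinearMap.sum_apply, map_neg, map_sum, Pi.neg_apply,
      Finset.sum_apply, hl, if_true, homCoord, homGrad, Fin.cons_zero, Finset.sum_add_distrib]
    simp
    ring
  · rw [slField_zero_succ, lieDensity_transField]
    simp [homCoord, homGrad, (Fin.succ_ne_zero j).symm]
  · rw [slField_succ_zero, lieDensity_neg, lieDensity_quadField]
    simp only [LinearMap.neg_apply, LinearMap.sum_apply, LinearMap.add_apply, map_neg, map_sum,
      map_add, Pi.neg_apply, Pi.add_apply, Finset.sum_apply, homCoord, homGrad, Fin.cons_zero,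
      Fin.cons_succ, Module.End.mul_apply, mulOp_apply, LinearMap.smul_apply, map_smul,
      Pi.smul_apply, map_mul, Pi.mul_apply, coordFn_apply, Fin.succ_ne_zero, if_false,
      ← Finset.mul_sum, smul_eq_mul]
    ring
  · rw [slField_succ_succ, hl]
    simp [homCoord, homGrad]

theorem hasFDerivAt_projVec_cpow (s : ℂ) {x : Fin n → ℝ} (hx : 0 < projVec g x 0) :
    HasFDerivAt (fun y => (projVec g y 0 : ℂ) ^ s)
      ((s * (projVec g x 0 : ℂ) ^ (s - 1)) • Complex.ofRealCLM.comp (projVecDeriv g 0)) x := by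
  have h1 : HasFDerivAt (fun y => (projVec g y 0 : ℂ)) (Complex.ofRealCLM.comp (projVecDeriv g 0)) x :=
    Complex.ofRealCLM.hasFDerivAt.comp x (hasFDerivAt_projVec 0 x)
  have h2 : HasDerivAt (fun z : ℂ => z ^ s) (s * (projVec g x 0 : ℂ) ^ (s - 1))
      (projVec g x 0 : ℂ) := by
    simpa using (hasDerivAt_id (projVec g x 0 : ℂ)).cpow_const
      (Complex.ofReal_mem_slitPlane.2 hx) (c := s)
  exact h2.comp_hasFDerivAt x h1

theorem partialD_of_densityRelated {U : Set (Fin n → ℝ)} (hU : IsOpen U)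
    (hpos : ∀ x ∈ U, 0 < projVec g x 0) {lam : ℂ} {φ φ' : SmoothFn n}
    (h : DensityRelated g U lam φ φ') {x : Fin n → ℝ} (hx : x ∈ U) (j : Fin n) :
    partialD j φ x = (projVec g x 0 : ℂ) ^ (-((n : ℂ) + 1) * lam) *
      (-((n : ℂ) + 1) * lam * (g 0 j.succ / projVec g x 0) * φ' (projMap g x) +
        ∑ i, partialD i φ' (projMap g x) * projJac g x i j) := by
  set s : ℂ := -((n : ℂ) + 1) * lam with hs
  have hw : (projVec g x 0 : ℂ) ≠ 0 := by exact_mod_cast (hpos x hx).ne'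
  have hev : φ.toFun =ᶠ[nhds x] fun y => (projVec g y 0 : ℂ) ^ s * φ' (projMap g y) := by
    filter_upwards [hU.mem_nhds hx] with y hy
    rw [h y hy, jacPow_eq lam (hpos y hy)]
  have hφ' : HasFDerivAt φ'.toFun (fderiv ℝ φ'.toFun (projMap g x)) (projMap g x) :=
    (φ'.differentiableAt _).hasFDerivAt
  have hcomp := hφ'.comp x (hasFDerivAt_projMap (g := g) (hpos x hx).ne')
  have hd := ((hasFDerivAt_projVec_cpow s (hpos x hx)).mul hcomp).congr_of_eventuallyEq hev
  have hsum : fderiv ℝ φ'.toFun (projMap g x) (projJac g x *ᵥ Pi.single j 1) =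
      ∑ i, partialD i φ' (projMap g x) * projJac g x i j := by
    rw [Matrix.mulVec_single_one]
    conv_lhs => rw [← Finset.univ_sum_single ((projJac g x).col j)]
    rw [map_sum]
    refine Finset.sum_congr rfl fun i _ => ?_
    have : (Pi.single i ((projJac g x).col j i) : Fin n → ℝ) =
        projJac g x i j • Pi.single i (1 : ℝ) := by
      rw [← Pi.single_smul, smul_eq_mul, mul_one]
      rfl
    rw [this, map_smul, partialD_apply, Complex.real_smul, mul_comm]
  rw [partialD_apply, hd.fderiv]
  simp only [add_apply, smul_apply,
    ContinuousLinearMap.comp_apply, LinearMap.coe_toContinuousLinearMap',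
    Matrix.mulVecLin_apply, hsum, projVecDeriv_single, smul_eq_mul, Function.comp,
    Complex.ofRealCLM_apply]
  rw [Complex.cpow_sub _ _ hw, Complex.cpow_one]
  field_simp
  ring

theorem homGrad_of_densityRelated {U : Set (Fin n → ℝ)} (hU : IsOpen U)
    (hpos : ∀ x ∈ U, 0 < projVec g x 0) {lam : ℂ} {φ φ' : SmoothFn n}
    (h : DensityRelated g U lam φ φ') {x : Fin n → ℝ} (hx : x ∈ U) (b : Fin (n + 1)) :
    (projVec g x 0 : ℂ) *
      homGrad (-((n : ℂ) + 1) * lam) (φ x) x (fun j => partialD j φ x) b =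
      jacPow g lam x * ∑ c, (g c b : ℂ) * homGrad (-((n : ℂ) + 1) * lam) (φ' (projMap g x))
        (projMap g x) (fun j => partialD j φ' (projMap g x)) c := by
  rw [← homGrad_projMap (hpos x hx).ne' (-((n : ℂ) + 1) * lam) (φ' (projMap g x)) (fun j =>
      -((n : ℂ) + 1) * lam * (g 0 j.succ / projVec g x 0) * φ' (projMap g x) +
        ∑ i, partialD i φ' (projMap g x) * projJac g x i j) _ (fun j => rfl) b]
  rw [mul_left_comm]
  congr 1
  have h2 : ∀ j, partialD j φ x = _ := fun j => partialD_of_densityRelated hU hpos h hx j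
  simp only [← jacPow_eq lam (hpos x hx)] at h2
  refine Fin.cases ?_ (fun j => ?_) b
  · simp only [homGrad, Fin.cons_zero, h2]
    rw [h x hx, mul_sub, Finset.mul_sum]
    congr 1
    · ring
    · exact Finset.sum_congr rfl fun i _ => by ring
  · simp only [homGrad, Fin.cons_succ]
    rw [h2]

/-- Homogeneous coordinates transform by `g⁻¹` and gradients by the transpose of `g`, so the matrix
units undergo the adjoint action. The constant `lam δ_ab` is unchanged since `g⁻¹ g = 1`. -/
theorem densityRelated_lieDensity_slField {U : Set (Fin n → ℝ)} (hU : IsOpen U)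
    (hpos : ∀ x ∈ U, 0 < projVec g x 0) {lam : ℂ} {φ φ' : SmoothFn n}
    (h : DensityRelated g U lam φ φ') (a b : Fin (n + 1)) :
    DensityRelated g U lam (lieDensity lam (slField a b) φ)
      (∑ c, ∑ d, ((g c b : ℂ) * ((g⁻¹ : Matrix.SpecialLinearGroup (Fin (n + 1)) ℝ) a d : ℂ)) •
        lieDensity lam (slField d c) φ') := by
  intro x hx
  have hw : (projVec g x 0 : ℂ) ≠ 0 := by exact_mod_cast (hpos x hx).ne'
  have h1 := homGrad_of_densityRelated hU hpos h hx b
  simp only [map_sum, map_smul, Finset.sum_apply, Pi.smul_apply, smul_eq_mul,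
    lieDensity_slField_apply, mul_add, Finset.sum_add_distrib]
  congr 1
  · rw [homCoord_eq (hpos x hx).ne', mul_right_comm, h1, mul_assoc, Finset.sum_mul_sum]
    congr 1
    refine Finset.sum_congr rfl fun c _ => Finset.sum_congr rfl fun d _ => ?_
    ring
  · have h3 : ∀ c, ∑ d, (g c b : ℂ) *
        ((g⁻¹ : Matrix.SpecialLinearGroup (Fin (n + 1)) ℝ) a d : ℂ) *
          (if d = c then lam * φ' (projMap g x) else 0) =
        ((g⁻¹ : Matrix.SpecialLinearGroup (Fin (n + 1)) ℝ) a c : ℂ) * (g c b : ℂ) *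
          (lam * φ' (projMap g x)) := by
      intro c
      simp only [mul_ite, mul_zero, Finset.sum_ite_eq', Finset.mem_univ, if_true]
      ring
    simp only [h3, ← Finset.sum_mul, sum_inv_mul]
    rw [h x hx]
    split_ifs <;> ring

variable {U : Set (Fin n → ℝ)}

/-! ### Related densities and operators -/

theorem DensityRelated.mono {V : Set (Fin n → ℝ)} (hVU : V ⊆ U) {s : ℂ} {φ φ' : SmoothFn n}
    (h : DensityRelated g U s φ φ') : DensityRelated g V s φ φ' :=
  fun x hx => h x (hVU hx)

theorem DensityRelated.add {s : ℂ} {φ φ' χ χ' : SmoothFn n} (h : DensityRelated g U s φ φ')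
    (h' : DensityRelated g U s χ χ') : DensityRelated g U s (φ + χ) (φ' + χ') := by
  intro x hx
  rw [map_add, map_add, Pi.add_apply, Pi.add_apply, h x hx, h' x hx, mul_add]

theorem DensityRelated.smul {s : ℂ} {φ φ' : SmoothFn n} (h : DensityRelated g U s φ φ') (a : ℂ) :
    DensityRelated g U s (a • φ) (a • φ') := by
  intro x hx
  rw [map_smul, map_smul, Pi.smul_apply, Pi.smul_apply, h x hx, mul_smul_comm]

theorem DensityRelated.sum {ι : Type*} (t : Finset ι) {s : ℂ} {φ φ' : ι → SmoothFn n}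
    (h : ∀ i, DensityRelated g U s (φ i) (φ' i)) :
    DensityRelated g U s (∑ i ∈ t, φ i) (∑ i ∈ t, φ' i) := by
  intro x hx
  rw [map_sum, map_sum, Finset.sum_apply, Finset.sum_apply, Finset.mul_sum]
  exact Finset.sum_congr rfl fun i _ => h i x hx

/-- On `U`, the operator `A` from `lam`-densities to `mu`-densities is the pull-back of `A'` by
`projMap g`. -/
def OpRelated (g : Matrix.SpecialLinearGroup (Fin (n + 1)) ℝ) (U : Set (Fin n → ℝ)) (lam mu : ℂ)
    (A A' : Module.End ℂ (SmoothFn n)) : Prop :=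
  ∀ φ φ' : SmoothFn n, DensityRelated g U lam φ φ' → DensityRelated g U mu (A φ) (A' φ')

theorem OpRelated.smul {lam mu : ℂ} {A A' : Module.End ℂ (SmoothFn n)}
    (h : OpRelated g U lam mu A A') (a : ℂ) : OpRelated g U lam mu (a • A) (a • A') :=
  fun φ φ' hφ => (h φ φ' hφ).smul a

theorem OpRelated.add {lam mu : ℂ} {A A' B B' : Module.End ℂ (SmoothFn n)}
    (h : OpRelated g U lam mu A A') (h' : OpRelated g U lam mu B B') :
    OpRelated g U lam mu (A + B) (A' + B') :=
  fun φ φ' hφ => (h φ φ' hφ).add (h' φ φ' hφ)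

theorem OpRelated.mul {lam mu nu : ℂ} {A A' B B' : Module.End ℂ (SmoothFn n)}
    (h : OpRelated g U mu nu A A') (h' : OpRelated g U lam mu B B') :
    OpRelated g U lam nu (A * B) (A' * B') :=
  fun φ φ' hφ => h _ _ (h' φ φ' hφ)

/-! ### The kernel of the Casimir operator -/

theorem sum_mul_inv_smul {V : Type*} [AddCommGroup V] [Module ℂ V]
    (S : Fin (n + 1) → V) (j : Fin (n + 1)) :
    ∑ b, ∑ c, ((g j b : ℂ) * ((g⁻¹ : Matrix.SpecialLinearGroup (Fin (n + 1)) ℝ) b c : ℂ)) • S c =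
      S j := by
  rw [Finset.sum_comm]
  simp only [← Finset.sum_smul, sum_mul_inv, ite_smul, one_smul, zero_smul, Finset.sum_ite_eq,
    Finset.mem_univ, if_true]

theorem sum_inv_mul_smul {V : Type*} [AddCommGroup V] [Module ℂ V]
    (S : Fin (n + 1) → V) (j : Fin (n + 1)) :
    ∑ b, ∑ c, ((g c b : ℂ) * ((g⁻¹ : Matrix.SpecialLinearGroup (Fin (n + 1)) ℝ) b j : ℂ)) • S c =
      S j := by
  rw [Finset.sum_comm]
  simp only [← Finset.sum_smul, sum_mul_inv, ite_smul, one_smul, zero_smul, Finset.sum_ite_eq',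
    Finset.mem_univ, if_true]

/-- The inverse of the adjoint action of `densityRelated_lieDensity_slField`. It supplies the
coefficients of `pullField`. -/
theorem sum_adjoint_smul {V : Type*} [AddCommGroup V] [Module ℂ V]
    (S : Fin (n + 1) → Fin (n + 1) → V) (i j : Fin (n + 1)) :
    ∑ a, ∑ b, ((g i a : ℂ) * ((g⁻¹ : Matrix.SpecialLinearGroup (Fin (n + 1)) ℝ) b j : ℂ)) •
      ∑ c, ∑ d, ((g c b : ℂ) * ((g⁻¹ : Matrix.SpecialLinearGroup (Fin (n + 1)) ℝ) a d : ℂ)) •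
        S d c = S i j := by
  have h : ∀ a b, ((g i a : ℂ) * ((g⁻¹ : Matrix.SpecialLinearGroup (Fin (n + 1)) ℝ) b j : ℂ)) •
      ∑ c, ∑ d, ((g c b : ℂ) * ((g⁻¹ : Matrix.SpecialLinearGroup (Fin (n + 1)) ℝ) a d : ℂ)) •
        S d c =
      ∑ c, ((g c b : ℂ) * ((g⁻¹ : Matrix.SpecialLinearGroup (Fin (n + 1)) ℝ) b j : ℂ)) •
        ∑ d, ((g i a : ℂ) * ((g⁻¹ : Matrix.SpecialLinearGroup (Fin (n + 1)) ℝ) a d : ℂ)) •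
          S d c := by
    intro a b
    simp only [Finset.smul_sum, smul_smul]
    refine Finset.sum_congr rfl fun c _ => Finset.sum_congr rfl fun d _ => ?_
    congr 1
    ring
  simp only [h, sum_inv_mul_smul]
  exact sum_mul_inv_smul (fun d => S d j) i

/-- The operator `A ↦ ∑ L_{ab} A L_{ba}` on operators from `lam`- to `mu`-densities. -/
def casimirKernel (n : ℕ) (lam mu : ℂ) : Module.End ℂ (Module.End ℂ (SmoothFn n)) :=
  ∑ a : Fin (n + 1), ∑ b : Fin (n + 1),
    LinearMap.mulLeft ℂ (lieDensity mu (slField a b)) *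
      LinearMap.mulRight ℂ (lieDensity lam (slField b a))

theorem casimirKernel_apply (lam mu : ℂ) (A : Module.End ℂ (SmoothFn n)) :
    casimirKernel n lam mu A = ∑ a : Fin (n + 1), ∑ b : Fin (n + 1),
      lieDensity mu (slField a b) * (A * lieDensity lam (slField b a)) := by
  simp [casimirKernel]

theorem sum_rotate {ι V : Type*} [Fintype ι] [AddCommMonoid V] (F : ι → ι → ι → V) :
    ∑ b, ∑ e, ∑ f, F b e f = ∑ f, ∑ b, ∑ e, F b e f :=
  (Finset.sum_congr rfl fun _ _ => Finset.sum_comm).trans Finset.sum_comm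

/-- Invariance of the tensor `∑ E_ab ⊗ E_ba` under the adjoint action: two pairs of `g` and `g⁻¹`
cancel. The multilinear quantity `S` stands for the left and right multiplications in
`casimirKernel`. -/
theorem sum_adjoint_adjoint_smul {V : Type*} [AddCommGroup V] [Module ℂ V]
    (S : Fin (n + 1) → Fin (n + 1) → Fin (n + 1) → Fin (n + 1) → V) :
    ∑ a, ∑ b, ∑ e, ∑ f,
      ((g e b : ℂ) * ((g⁻¹ : Matrix.SpecialLinearGroup (Fin (n + 1)) ℝ) a f : ℂ)) •
      ∑ c, ∑ d, ((g c a : ℂ) * ((g⁻¹ : Matrix.SpecialLinearGroup (Fin (n + 1)) ℝ) b d : ℂ)) •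
        S f e d c = ∑ f, ∑ e, S f e e f := by
  have h : ∀ a f b e, ((g e b : ℂ) * ((g⁻¹ : Matrix.SpecialLinearGroup (Fin (n + 1)) ℝ) a f : ℂ)) •
      ∑ c, ∑ d, ((g c a : ℂ) * ((g⁻¹ : Matrix.SpecialLinearGroup (Fin (n + 1)) ℝ) b d : ℂ)) •
        S f e d c =
      ∑ c, ((g c a : ℂ) * ((g⁻¹ : Matrix.SpecialLinearGroup (Fin (n + 1)) ℝ) a f : ℂ)) •
        ∑ d, ((g e b : ℂ) * ((g⁻¹ : Matrix.SpecialLinearGroup (Fin (n + 1)) ℝ) b d : ℂ)) •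
          S f e d c := by
    intro a f b e
    simp only [Finset.smul_sum, smul_smul]
    refine Finset.sum_congr rfl fun c _ => Finset.sum_congr rfl fun d _ => ?_
    congr 1
    ring
  have h1 : ∀ f c, ∑ b, ∑ e, ∑ d,
      ((g e b : ℂ) * ((g⁻¹ : Matrix.SpecialLinearGroup (Fin (n + 1)) ℝ) b d : ℂ)) • S f e d c =
      ∑ e, S f e e c := by
    intro f c
    rw [Finset.sum_comm]
    exact Finset.sum_congr rfl fun e _ => sum_mul_inv_smul (fun d => S f e d c) e
  calc _ = ∑ a, ∑ f, ∑ c,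
        ((g c a : ℂ) * ((g⁻¹ : Matrix.SpecialLinearGroup (Fin (n + 1)) ℝ) a f : ℂ)) •
          ∑ e, S f e e c := by
        refine Finset.sum_congr rfl fun a _ => ?_
        rw [sum_rotate]
        refine Finset.sum_congr rfl fun f _ => ?_
        simp only [h]
        rw [sum_rotate]
        refine Finset.sum_congr rfl fun c _ => ?_
        simp only [← Finset.smul_sum, h1]
    _ = _ := by
        rw [Finset.sum_comm]
        exact Finset.sum_congr rfl fun f _ => sum_inv_mul_smul (fun c => ∑ e, S f e e c) f

theorem OpRelated.casimirKernel (hU : IsOpen U) (hpos : ∀ x ∈ U, 0 < projVec g x 0)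
    {lam mu : ℂ} {A A' : Module.End ℂ (SmoothFn n)} (h : OpRelated g U lam mu A A') :
    OpRelated g U lam mu (casimirKernel n lam mu A) (casimirKernel n lam mu A') := by
  intro φ φ' hφ
  have key := DensityRelated.sum Finset.univ fun a => DensityRelated.sum Finset.univ fun b =>
    densityRelated_lieDensity_slField hU hpos
      (h _ _ (densityRelated_lieDensity_slField hU hpos hφ b a)) a b
  have e := sum_adjoint_adjoint_smul (g := g) fun f e d c =>
    lieDensity mu (slField f e) (A' (lieDensity lam (slField d c) φ'))
  simp only [map_sum, map_smul] at key
  rw [e] at key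
  rw [casimirKernel_apply, casimirKernel_apply]
  simpa only [LinearMap.sum_apply, Module.End.mul_apply] using key

/-- The eigenvalue of `casimirKernel` on quantizations of symbols of degree `k`. -/
def kernelValue (n : ℕ) (lam mu : ℂ) (k : ℕ) : ℂ :=
  (casimirValue n mu 0 + casimirValue n lam 0 - casimirValue n (mu - lam) k) / 2

/-- Expanding the Casimir operator of the action on operators gives the scalar Casimir operators of
`mu`- and `lam`-densities and twice a mixed term, which is `casimirKernel`. So the kernel is
diagonal wherever the Casimir operator is. -/
theorem sum_lieOp_lieOp (lam mu : ℂ) (A : Module.End ℂ (SmoothFn n)) :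
    ∑ a : Fin (n + 1), ∑ b : Fin (n + 1),
      lieOp lam mu (slField a b) (lieOp lam mu (slField b a) A) =
      (casimirValue n mu 0 + casimirValue n lam 0) • A - (2 : ℂ) • casimirKernel n lam mu A := by
  have h : ∀ a b : Fin (n + 1), lieOp lam mu (slField a b) (lieOp lam mu (slField b a) A) =
      lieDensity mu (slField a b) * lieDensity mu (slField b a) * A
        + A * (lieDensity lam (slField b a) * lieDensity lam (slField a b))
        - lieDensity mu (slField a b) * (A * lieDensity lam (slField b a))
        - lieDensity mu (slField b a) * (A * lieDensity lam (slField a b)) := by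
    intro a b
    simp only [lieOp, mul_sub, sub_mul, mul_assoc]
    abel
  have h1 : ∑ a : Fin (n + 1), ∑ b : Fin (n + 1),
      lieDensity mu (slField b a) * (A * lieDensity lam (slField a b)) =
      casimirKernel n lam mu A := by
    rw [Finset.sum_comm, casimirKernel_apply]
  have h2 : ∑ a : Fin (n + 1), ∑ b : Fin (n + 1),
      lieDensity lam (slField b a) * lieDensity lam (slField a b) =
      casimirValue n lam 0 • (1 : Module.End ℂ (SmoothFn n)) := by
    rw [Finset.sum_comm, casimir_lieDensity]
  simp only [h, Finset.sum_add_distrib, Finset.sum_sub_distrib, ← Finset.sum_mul,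
    ← Finset.mul_sum, h2, casimir_lieDensity]
  simp only [h1, ← casimirKernel_apply, smul_mul_assoc, one_mul, mul_smul_comm,
    mul_one]
  module

theorem casimirKernel_quantEnd {lam mu : ℂ}
    (hb : ∀ l : ℕ, (l : ℂ) + ((n : ℂ) + 1) * (1 - (mu - lam)) ≠ 0) {c : ℂ} (hc : c ≠ 0)
    (P : Symb n) : casimirKernel n lam mu (quantEnd n lam mu hc P) =
      quantEnd n lam mu hc (degOp (kernelValue n lam mu) P) := by
  have h1 := sum_lieOp_lieOp lam mu (quantEnd n lam mu hc P)
  have h2 := LinearMap.congr_fun (casimir_lieSymb (n := n) (mu - lam)) P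
  simp only [← quantEnd_equivariant hb hc (slField_mem _ _)] at h1
  simp only [LinearMap.sum_apply, Module.End.mul_apply] at h2
  simp only [← map_sum] at h1
  rw [h2] at h1
  have h3 : degOp (n := n) (kernelValue n lam mu) =
      ((casimirValue n mu 0 + casimirValue n lam 0) / 2) • 1
        - (2 : ℂ)⁻¹ • degOp (casimirValue n (mu - lam)) := by
    rw [eq_sub_iff_add_eq, ← degOp_const, ← degOp_smul, ← degOp_add]
    congr 1
    ext k
    simp [kernelValue]
    ring
  rw [h3, LinearMap.sub_apply, LinearMap.smul_apply, LinearMap.smul_apply, map_sub, map_smul,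
    map_smul, h1, Module.End.one_apply]
  module

/-- A multiple of the projection onto the quantizations of symbols of degree `k`, on operators of
order at most `k`. -/
def casimirProj (n : ℕ) (lam mu : ℂ) : ℕ → Module.End ℂ (Module.End ℂ (SmoothFn n))
  | 0 => 1
  | k + 1 => (casimirKernel n lam mu - kernelValue n lam mu k • 1) * casimirProj n lam mu k

theorem OpRelated.casimirProj (hU : IsOpen U) (hpos : ∀ x ∈ U, 0 < projVec g x 0)
    {lam mu : ℂ} {A A' : Module.End ℂ (SmoothFn n)} (h : OpRelated g U lam mu A A') (k : ℕ) :
    OpRelated g U lam mu (casimirProj n lam mu k A) (casimirProj n lam mu k A') := by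
  induction k with
  | zero => exact h
  | succ k ih =>
    have := (ih.casimirKernel hU hpos).add (ih.smul (-kernelValue n lam mu k))
    have e : ∀ B : Module.End ℂ (SmoothFn n), ProjQuant.casimirProj n lam mu (k + 1) B =
        ProjQuant.casimirKernel n lam mu (ProjQuant.casimirProj n lam mu k B) +
          (-kernelValue n lam mu k) • ProjQuant.casimirProj n lam mu k B := by
      intro B
      rw [ProjQuant.casimirProj, Module.End.mul_apply, LinearMap.sub_apply, LinearMap.smul_apply,
        Module.End.one_apply]
      module
    rwa [e, e]

theorem casimirProj_quantEnd {lam mu : ℂ}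
    (hb : ∀ l : ℕ, (l : ℂ) + ((n : ℂ) + 1) * (1 - (mu - lam)) ≠ 0) {c : ℂ} (hc : c ≠ 0)
    (k : ℕ) (P : Symb n) : casimirProj n lam mu k (quantEnd n lam mu hc P) =
      quantEnd n lam mu hc (degOp (fun j => ∏ l ∈ Finset.range k,
        (kernelValue n lam mu j - kernelValue n lam mu l)) P) := by
  induction k with
  | zero =>
    have : (fun j : ℕ => ∏ l ∈ Finset.range 0, (kernelValue n lam mu j - kernelValue n lam mu l)) =
        1 := by
      ext j; simp
    rw [this, degOp_one]
    rfl
  | succ k ih =>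
    rw [casimirProj, Module.End.mul_apply, ih, LinearMap.sub_apply, casimirKernel_quantEnd hb,
      LinearMap.smul_apply, Module.End.one_apply, ← map_smul, ← map_sub, ← Module.End.mul_apply,
      degOp_mul, ← LinearMap.smul_apply, ← degOp_smul, ← LinearMap.sub_apply, sub_eq_add_neg,
      ← neg_one_smul ℂ (degOp _), ← degOp_smul, ← degOp_add]
    congr 3
    ext j
    simp only [Pi.add_apply, Pi.mul_apply, Pi.smul_apply, smul_eq_mul, Finset.prod_range_succ]
    ring

/-- Such an `A` is the quantization of `P + R` with `R` of degree below `k`. The factor with index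
`l` kills the part of degree `l`, so only the contribution of `P` survives. -/
theorem casimirProj_eq {lam mu : ℂ}
    (hb : ∀ l : ℕ, (l : ℂ) + ((n : ℂ) + 1) * (1 - (mu - lam)) ≠ 0) {c : ℂ} (hc : c ≠ 0)
    {k : ℕ} {P : Symb n} (hP : P.IsHomogeneous k) {A : Module.End ℂ (SmoothFn n)}
    (hA : A - normalEnd n c P ∈ DiffOpLT n k) :
    casimirProj n lam mu k A = (∏ l ∈ Finset.range k,
      (kernelValue n lam mu k - kernelValue n lam mu l)) • quantEnd n lam mu hc P := by
  have h1 := sub_mem hA (quantEnd_sub_mem lam mu hc (mem_symbLT_of_isHomogeneous hP))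
  rw [sub_sub_sub_cancel_right, ← map_symbLT_quantEnd lam mu hc] at h1
  obtain ⟨R, hR, hRe⟩ := h1
  have hA' : A = quantEnd n lam mu hc (P + R) := by
    rw [map_add, hRe]
    abel
  have hR0 : degOp (fun j => ∏ l ∈ Finset.range k,
      (kernelValue n lam mu j - kernelValue n lam mu l)) R = 0 := by
    apply MvPolynomial.ext
    intro α
    rw [coeff_degOp, MvPolynomial.coeff_zero]
    by_cases hα : k ≤ α.degree
    · rw [hR α hα, smul_zero]
    · rw [Finset.prod_eq_zero (Finset.mem_range.2 (not_le.1 hα)) (sub_self _), zero_smul]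
  rw [hA', casimirProj_quantEnd hb, map_add, hR0, add_zero, degOp_isHomogeneous _ hP, map_smul]

/-- `casimirProj` respects related operators and sends `A`, `A'` to the same multiple of the two
quantizations. The multiple is nonzero because differences of `kernelValue` are, up to sign, half
the differences of `casimirValue`. -/
theorem opRelated_quantEnd (hU : IsOpen U) (hpos : ∀ x ∈ U, 0 < projVec g x 0) {lam mu : ℂ}
    (hb : ∀ l : ℕ, (l : ℂ) + ((n : ℂ) + 1) * (1 - (mu - lam)) ≠ 0) {c : ℂ} (hc : c ≠ 0)
    {k : ℕ} {P P' : Symb n} (hP : P.IsHomogeneous k) (hP' : P'.IsHomogeneous k)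
    {A A' : Module.End ℂ (SmoothFn n)} (hA : A - normalEnd n c P ∈ DiffOpLT n k)
    (hA' : A' - normalEnd n c P' ∈ DiffOpLT n k) (h : OpRelated g U lam mu A A') :
    OpRelated g U lam mu (quantEnd n lam mu hc P) (quantEnd n lam mu hc P') := by
  have h1 := h.casimirProj hU hpos k
  rw [casimirProj_eq hb hc hP hA, casimirProj_eq hb hc hP' hA'] at h1
  have hne : (∏ l ∈ Finset.range k,
      (kernelValue n lam mu k - kernelValue n lam mu l)) ≠ 0 := by
    refine Finset.prod_ne_zero_iff.2 fun l hl => ?_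
    have := casimirValue_ne hb (Finset.mem_range.1 hl)
    intro h0
    apply this
    simp only [kernelValue] at h0
    linear_combination 2 * h0
  have h2 := h1.smul (∏ l ∈ Finset.range k,
      (kernelValue n lam mu k - kernelValue n lam mu l))⁻¹
  rwa [smul_smul, smul_smul, inv_mul_cancel₀ hne, one_smul, one_smul] at h2

/-! ### Principal symbols of products with Lie derivatives -/

/-- The symbol `Yⁱ ξᵢ` of a vector field. -/
def fieldSymbol (Y : VField n) : Symb n := ∑ i, C (Y i) * X i

theorem fieldSymbol_isHomogeneous (Y : VField n) : (fieldSymbol Y).IsHomogeneous 1 :=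
  MvPolynomial.IsHomogeneous.sum _ _ _ fun i _ => by
    simpa using (MvPolynomial.isHomogeneous_C (Fin n) (Y i)).mul (MvPolynomial.isHomogeneous_X _ i)

theorem fieldSymbol_mul_mem (Y : VField n) {k : ℕ} {R : Symb n} (hR : R ∈ symbLT n k) :
    fieldSymbol Y * R ∈ symbLT n (k + 1) := by
  rw [fieldSymbol, Finset.sum_mul]
  refine Submodule.sum_mem _ fun i _ => ?_
  rw [mul_assoc]
  exact C_mul_mem (Y i) (X_mul_mem i hR)

theorem lieSymb_mem (δ : ℂ) (Y : VField n) {k : ℕ} {R : Symb n} (hR : R ∈ symbLT n k) :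
    lieSymb δ Y R ∈ symbLT n k := by
  have h : ∀ i j, mulSymb (X i) (xiD j R) ∈ symbLT n k := by
    intro i j
    cases k with
    | zero =>
      rw [symbLT_zero, Submodule.mem_bot] at hR
      simp [hR]
    | succ k => exact X_mul_mem i (xiD_mem j hR)
  simp only [lieSymb, LinearMap.add_apply, LinearMap.sub_apply, LinearMap.sum_apply,
    LinearMap.smul_apply, mulSymb_mul, Module.End.mul_apply]
  refine add_mem (sub_mem ?_ ?_) (Submodule.smul_mem _ _ (C_mul_mem _ hR))
  · exact Submodule.sum_mem _ fun i _ => C_mul_mem _ (xD_mem i hR)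
  · exact Submodule.sum_mem _ fun i _ => Submodule.sum_mem _ fun j _ => C_mul_mem _ (h i j)

theorem normalEnd_mem {c : ℂ} (hc : c ≠ 0) {k : ℕ} {R : Symb n} (hR : R ∈ symbLT n k) :
    normalEnd n c R ∈ DiffOpLT n k := by
  rw [← map_symbLT_normalEnd hc]
  exact ⟨R, hR, rfl⟩

theorem lieDensity_mul_normalEnd (mu : ℂ) {c : ℂ} (hc : c ≠ 0) (Y : VField n) {k : ℕ}
    {R : Symb n} (hR : R ∈ symbLT n k) :
    lieDensity mu Y * normalEnd n c R - normalEnd n c (c⁻¹ • (fieldSymbol Y * R)) ∈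
      DiffOpLT n k := by
  have h : lieDensity mu Y * normalEnd n c R - normalEnd n c (c⁻¹ • (fieldSymbol Y * R)) =
      normalEnd n c (∑ i, mulSymb (C (Y i)) (xD i R) + mu • mulSymb (C (vdiv Y)) R) := by
    have h1 : fieldSymbol Y * R = ∑ i, mulSymb (C (Y i)) (momOp i R) := by
      simp [fieldSymbol, Finset.sum_mul, mulSymb_apply, momOp, mul_assoc]
    rw [h1, lieDensity]
    simp only [add_mul, Finset.sum_mul, mul_assoc, partialD_mul_normalEnd' hc, map_add, mul_add,
      LinearMap.add_apply, LinearMap.smul_apply, map_smul, mul_smul_comm, ← normalEnd_C_mul,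
      smul_mul_assoc, map_sum,
      Finset.sum_add_distrib, Finset.smul_sum]
    abel
  rw [h]
  refine normalEnd_mem hc (add_mem ?_ (Submodule.smul_mem _ _ (C_mul_mem _ hR)))
  exact Submodule.sum_mem _ fun i _ => C_mul_mem _ (xD_mem i hR)

/-- Left and right multiplication by a Lie derivative differ by `lieOp`. For projective fields this
does not raise the order, by equivariance of the quantization, so the expansion of the right product
by iterated Leibniz rules is avoided. -/
theorem normalEnd_mul_lieDensity {lam mu : ℂ}
    (hb : ∀ l : ℕ, (l : ℂ) + ((n : ℂ) + 1) * (1 - (mu - lam)) ≠ 0) {c : ℂ} (hc : c ≠ 0)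
    {Y : VField n} (hY : Y ∈ projFields n) {k : ℕ} {R : Symb n} (hR : R ∈ symbLT n k) :
    normalEnd n c R * lieDensity lam Y - normalEnd n c (c⁻¹ • (fieldSymbol Y * R)) ∈
      DiffOpLT n k := by
  have h1 : lieOp lam mu Y (normalEnd n c R) ∈ DiffOpLT n k := by
    rw [← quantEnd_symbolEquiv lam mu hc, ← quantEnd_equivariant hb hc hY,
      ← map_symbLT_quantEnd lam mu hc]
    exact ⟨_, lieSymb_mem _ _ (symbolEquiv_mem_symbLT lam mu c hR), rfl⟩
  have h2 := sub_mem (lieDensity_mul_normalEnd mu hc Y hR) h1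
  rw [lieOp] at h2
  convert h2 using 1
  abel

theorem mul_lieDensity_sub_mem {lam mu : ℂ}
    (hb : ∀ l : ℕ, (l : ℂ) + ((n : ℂ) + 1) * (1 - (mu - lam)) ≠ 0) {c : ℂ} (hc : c ≠ 0)
    {Y : VField n} (hY : Y ∈ projFields n) {k : ℕ} {P : Symb n} (hP : P.IsHomogeneous k)
    {A : Module.End ℂ (SmoothFn n)} (hA : A - normalEnd n c P ∈ DiffOpLT n k) :
    c • (A * lieDensity lam Y) - normalEnd n c (fieldSymbol Y * P) ∈ DiffOpLT n (k + 1) := by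
  rw [← map_symbLT_normalEnd hc] at hA
  obtain ⟨R, hR, hRe⟩ := hA
  have h1 := normalEnd_mul_lieDensity hb hc hY (mem_symbLT_of_isHomogeneous hP)
  have h2 := normalEnd_mul_lieDensity hb hc hY (symbLT_mono (Nat.le_succ k) hR)
  have h3 := normalEnd_mem hc (Submodule.smul_mem _ c⁻¹ (fieldSymbol_mul_mem Y hR))
  have h4 := Submodule.smul_mem _ c (add_mem (add_mem h1 h2) h3)
  convert h4 using 1
  have hA' : A = normalEnd n c R + normalEnd n c P := by
    rw [hRe]
    abel
  have h5 : normalEnd n c (fieldSymbol Y * P) =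
      c • normalEnd n c (c⁻¹ • (fieldSymbol Y * P)) := by
    rw [map_smul, smul_smul, mul_inv_cancel₀ hc, one_smul]
  rw [hA', h5, add_mul]
  module

/-! ### The pull-back of the constant vector fields -/

/-- The projective vector field that `projMap g` carries to `∂/∂xʲ`. -/
def pullField (g : Matrix.SpecialLinearGroup (Fin (n + 1)) ℝ) (j : Fin n) : VField n :=
  ∑ a, ∑ b, ((g 0 a : ℂ) *
    ((g⁻¹ : Matrix.SpecialLinearGroup (Fin (n + 1)) ℝ) b j.succ : ℂ)) • slField a b

theorem pullField_mem (j : Fin n) : pullField g j ∈ projFields n := by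
  refine Submodule.sum_mem _ fun a _ => Submodule.sum_mem _ fun b _ => ?_
  rw [← Complex.ofReal_mul]
  exact Submodule.smul_mem _ (g 0 a * (g⁻¹ : Matrix.SpecialLinearGroup (Fin (n + 1)) ℝ) b j.succ)
    (slField_mem a b)

/-- The adjoint action turns the coefficients of `pullField` into those of the single matrix unit
with indices `0` and `j.succ`, which is `∂/∂xʲ`. -/
theorem opRelated_pullField (hU : IsOpen U) (hpos : ∀ x ∈ U, 0 < projVec g x 0) (lam : ℂ)
    (j : Fin n) : OpRelated g U lam lam (lieDensity lam (pullField g j)) (partialD j) := by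
  intro φ φ' hφ
  have h1 := DensityRelated.sum Finset.univ fun a => DensityRelated.sum Finset.univ fun b =>
    (densityRelated_lieDensity_slField hU hpos hφ a b).smul ((g 0 a : ℂ) *
      ((g⁻¹ : Matrix.SpecialLinearGroup (Fin (n + 1)) ℝ) b j.succ : ℂ))
  rw [sum_adjoint_smul (fun d c => lieDensity lam (slField d c) φ') 0 j.succ, slField_zero_succ,
    lieDensity_transField] at h1
  have h2 : lieDensity lam (pullField g j) φ = ∑ a, ∑ b, ((g 0 a : ℂ) *
      ((g⁻¹ : Matrix.SpecialLinearGroup (Fin (n + 1)) ℝ) b j.succ : ℂ)) •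
        lieDensity lam (slField a b) φ := by
    rw [← lieDensityHom_apply, pullField]
    simp only [map_sum, map_smul, LinearMap.sum_apply, LinearMap.smul_apply, lieDensityHom_apply]
  rwa [h2]

/-- The degree and value in `homGrad` are zero because a covector is the differential of a function,
homogeneous of degree zero, whose value plays no role. -/
theorem sum_slField_mul (a b : Fin (n + 1)) (x : Fin n → ℝ) (v : Fin n → ℂ) :
    ∑ i, slField a b i x * v i = homCoord x a * homGrad 0 0 x v b := by
  have hlin : ∀ p q : Fin n, ∑ i, linField p q i x * v i = x p * v q := by
    intro p q
    rw [Finset.sum_eq_single q]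
    · simp [linField, coordFn_apply]
    · intro i _ hi
      simp [linField, hi]
    · simp
  refine Fin.cases ?_ (fun p => ?_) a <;> refine Fin.cases ?_ (fun q => ?_) b
  · simp only [slField_zero_zero, homCoord, homGrad, Fin.cons_zero, Pi.neg_apply,
      Finset.sum_apply, map_neg, map_sum, neg_mul, Finset.sum_neg_distrib, Finset.sum_mul]
    rw [Finset.sum_comm]
    simp [hlin]
  · simp only [slField_zero_succ, homCoord, homGrad, Fin.cons_zero, Fin.cons_succ]
    rw [Finset.sum_eq_single q]
    · simp [transField]
    · intro i _ hi
      simp [transField, hi]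
    · simp
  · simp only [slField_succ_zero, homCoord, homGrad, Fin.cons_zero, Fin.cons_succ, Pi.neg_apply,
      map_neg, quadField, map_mul, Pi.mul_apply, coordFn_apply, neg_mul, Finset.sum_neg_distrib,
      mul_assoc, ← Finset.mul_sum]
    ring
  · simp only [slField_succ_succ, homCoord, homGrad, Fin.cons_succ, hlin]

/-- The differential of `projMap g` carries `pullField g j` to `∂/∂xʲ`, expressed by pairing with a
pulled-back covector. This makes `fieldSymbol (pullField g j)` the pull-back of the symbol `ξⱼ`. -/
theorem sum_pullField_mul {x : Fin n → ℝ} (hx : projVec g x 0 ≠ 0) (j : Fin n) (v' : Fin n → ℂ) :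
    ∑ k, pullField g j k x * (∑ i, v' i * projJac g x i k) = v' j := by
  set v : Fin n → ℂ := fun k => ∑ i, v' i * projJac g x i k with hv
  have h1 : ∑ k, pullField g j k x * v k = ∑ a, ∑ b, ((g 0 a : ℂ) *
      ((g⁻¹ : Matrix.SpecialLinearGroup (Fin (n + 1)) ℝ) b j.succ : ℂ)) *
        (homCoord x a * homGrad 0 0 x v b) := by
    simp only [← sum_slField_mul, pullField, Finset.sum_apply, Pi.smul_apply, map_sum, map_smul,
      Finset.sum_mul, Finset.mul_sum, smul_eq_mul]
    rw [Finset.sum_comm]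
    refine Finset.sum_congr rfl fun a _ => ?_
    rw [Finset.sum_comm]
    exact Finset.sum_congr rfl fun b _ => Finset.sum_congr rfl fun k _ => by ring
  have h2 : ∀ b, (projVec g x 0 : ℂ) * homGrad 0 0 x v b =
      ∑ c, (g c b : ℂ) * homGrad 0 0 (projMap g x) v' c :=
    homGrad_projMap hx 0 0 v v' fun k => by simp [hv]
  have h3 : ∑ a, (g 0 a : ℂ) * homCoord x a = projVec g x 0 := by
    rw [sum_mul_homCoord_projMap hx]
    simp [homCoord]
  rw [h1]
  calc _ = (∑ a, (g 0 a : ℂ) * homCoord x a) *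
        ∑ b, ((g⁻¹ : Matrix.SpecialLinearGroup (Fin (n + 1)) ℝ) b j.succ : ℂ) *
          homGrad 0 0 x v b := by
        rw [Finset.sum_mul_sum]
        exact Finset.sum_congr rfl fun a _ => Finset.sum_congr rfl fun b _ => by ring
    _ = ∑ b, ∑ c, ((g c b : ℂ) *
        ((g⁻¹ : Matrix.SpecialLinearGroup (Fin (n + 1)) ℝ) b j.succ : ℂ)) •
          homGrad 0 0 (projMap g x) v' c := by
        rw [h3, Finset.mul_sum]
        refine Finset.sum_congr rfl fun b _ => ?_
        rw [mul_left_comm, h2, Finset.mul_sum]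
        exact Finset.sum_congr rfl fun c _ => by rw [smul_eq_mul]; ring
    _ = v' j := by
        rw [sum_inv_mul_smul]
        rfl

/-! ### Related symbols -/

theorem symbEval_add (P R : Symb n) (x ξ : Fin n → ℝ) :
    symbEval (P + R) x ξ = symbEval P x ξ + symbEval R x ξ := MvPolynomial.eval₂_add _ _

theorem symbEval_mul (P R : Symb n) (x ξ : Fin n → ℝ) :
    symbEval (P * R) x ξ = symbEval P x ξ * symbEval R x ξ := MvPolynomial.eval₂_mul _ _

theorem symbEval_C (f : SmoothFn n) (x ξ : Fin n → ℝ) : symbEval (C f) x ξ = f x :=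
  MvPolynomial.eval₂_C _ _ _

theorem symbEval_X (i : Fin n) (x ξ : Fin n → ℝ) : symbEval (X i) x ξ = ξ i :=
  MvPolynomial.eval₂_X _ _ _

theorem symbEval_fieldSymbol (Y : VField n) (x ξ : Fin n → ℝ) :
    symbEval (fieldSymbol Y) x ξ = ∑ i, Y i x * ξ i := by
  rw [fieldSymbol, symbEval, ← MvPolynomial.coe_eval₂Hom, map_sum]
  refine Finset.sum_congr rfl fun i _ => ?_
  rw [map_mul, MvPolynomial.coe_eval₂Hom]
  exact congrArg₂ (· * ·) (symbEval_C _ x ξ) (symbEval_X i x ξ)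

theorem SymbRelated.mono {V : Set (Fin n → ℝ)} (hVU : V ⊆ U) {δ : ℂ} {P P' : Symb n}
    (h : SymbRelated g U δ P P') : SymbRelated g V δ P P' :=
  fun x hx => h x (hVU hx)

theorem OpRelated.of_densityRelated {lam mu : ℂ} {f f' : SmoothFn n}
    (hpos : ∀ x ∈ U, 0 < projVec g x 0) (h : DensityRelated g U (mu - lam) f f') :
    OpRelated g U lam mu (mulOp f) (mulOp f') := by
  intro φ φ' hφ x hx
  have hw : (projVec g x 0 : ℂ) ≠ 0 := by exact_mod_cast (hpos x hx).ne'
  rw [mulOp_apply, mulOp_apply, map_mul, map_mul, Pi.mul_apply, Pi.mul_apply, h x hx, hφ x hx,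
    jacPow_eq _ (hpos x hx), jacPow_eq _ (hpos x hx), jacPow_eq _ (hpos x hx), mul_mul_mul_comm,
    ← Complex.cpow_add _ _ hw]
  congr 2
  ring

/-! ### Smooth functions with prescribed germ -/

theorem contDiffAt_projVec_cpow (s : ℂ) {x : Fin n → ℝ} (hx : 0 < projVec g x 0) :
    ContDiffAt ℝ ∞ (fun y => (projVec g y 0 : ℂ) ^ s) x := by
  have h1 : ContDiffAt ℝ ∞ (fun y => Complex.exp ((Real.log (projVec g y 0) : ℂ) * s)) x :=
    ((Complex.ofRealCLM.contDiff.contDiffAt.comp x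
      ((contDiff_projVec 0).contDiffAt.log hx.ne')).mul contDiffAt_const).cexp
  refine h1.congr_of_eventuallyEq ?_
  have hev : ∀ᶠ y in nhds x, 0 < projVec g y 0 :=
    (contDiff_projVec (g := g) 0).continuous.continuousAt.eventually (lt_mem_nhds hx)
  filter_upwards [hev] with y hy
  rw [Complex.cpow_def_of_ne_zero (by exact_mod_cast hy.ne'), Complex.ofReal_log hy.le]

theorem contDiffAt_projMap {x : Fin n → ℝ} (hx : projVec g x 0 ≠ 0) :
    ContDiffAt ℝ ∞ (projMap g) x :=
  contDiffAt_pi.2 fun i =>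
    (contDiff_projVec i.succ).contDiffAt.div (contDiff_projVec 0).contDiffAt hx

/-- Pull-backs by `projMap g` are smooth only where the denominator does not vanish, while
coefficients must be defined on the whole chart. A bump function extends the germ. -/
theorem exists_smoothFn_eq {F : (Fin n → ℝ) → ℂ} (hU : IsOpen U)
    (hF : ∀ y ∈ U, ContDiffAt ℝ ∞ F y) {x : Fin n → ℝ} (hx : x ∈ U) :
    ∃ (f : SmoothFn n) (V : Set (Fin n → ℝ)), IsOpen V ∧ x ∈ V ∧ V ⊆ U ∧ ∀ y ∈ V, f y = F y := by
  obtain ⟨ε, hε, hball⟩ := Metric.isOpen_iff.1 hU x hx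
  let χ : ContDiffBump x := ⟨ε / 3, ε / 2, by positivity, by linarith⟩
  have hts : tsupport χ ⊆ U := by
    rw [χ.tsupport_eq]
    exact (Metric.closedBall_subset_ball (by change ε / 2 < ε; linarith)).trans hball
  refine ⟨SmoothFn.mk (fun y => ((χ y : ℝ) : ℂ) * F y) ?_, Metric.ball x (ε / 3),
    Metric.isOpen_ball, Metric.mem_ball_self (by positivity),
    (Metric.ball_subset_ball (by linarith)).trans hball, fun y hy => ?_⟩
  · rw [contDiff_iff_contDiffAt]
    intro y
    by_cases hy : y ∈ tsupport χ
    · exact (Complex.ofRealCLM.contDiff.contDiffAt.comp y χ.contDiffAt).mul (hF y (hts hy))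
    · refine (contDiffAt_const (c := (0 : ℂ))).congr_of_eventuallyEq ?_
      filter_upwards [notMem_tsupport_iff_eventuallyEq.1 hy] with z hz
      simp [hz]
  · change ((χ y : ℝ) : ℂ) * F y = F y
    rw [χ.one_of_mem_closedBall (Metric.ball_subset_closedBall hy), Complex.ofReal_one, one_mul]

theorem exists_densityRelated (hU : IsOpen U) (hpos : ∀ x ∈ U, 0 < projVec g x 0)
    {x : Fin n → ℝ} (hx : x ∈ U) (s : ℂ) (f' : SmoothFn n) :
    ∃ (f : SmoothFn n) (V : Set (Fin n → ℝ)), IsOpen V ∧ x ∈ V ∧ V ⊆ U ∧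
      DensityRelated g V s f f' := by
  obtain ⟨f, V, hV, hxV, hVU, hf⟩ := exists_smoothFn_eq hU
    (F := fun y => (projVec g y 0 : ℂ) ^ (-((n : ℂ) + 1) * s) * f' (projMap g y))
    (fun y hy => (contDiffAt_projVec_cpow _ (hpos y hy)).mul
      (f'.contDiff.contDiffAt.comp y (contDiffAt_projMap (hpos y hy).ne'))) hx
  refine ⟨f, V, hV, hxV, hVU, fun y hy => ?_⟩
  rw [hf y hy, jacPow_eq s (hpos y (hVU hy))]

/-! ### Chart independence -/

/-- Induction on the factors `ξⱼ`: coefficients are pulled back directly, and a factor `ξⱼ` is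
matched by right multiplication with the Lie derivative along `pullField g j`. The operator `A` only
needs the correct principal symbol. The clause for all open `W ⊆ V` allows the models of several
monomials to be restricted to a common neighbourhood. -/
theorem exists_local_model_monomial (hU : IsOpen U) (hpos : ∀ x ∈ U, 0 < projVec g x 0)
    {lam mu : ℂ} (hb : ∀ l : ℕ, (l : ℂ) + ((n : ℂ) + 1) * (1 - (mu - lam)) ≠ 0) {c : ℂ}
    (hc : c ≠ 0) {x : Fin n → ℝ} (hx : x ∈ U) (α : Fin n →₀ ℕ) (f' : SmoothFn n) :
    ∃ (V : Set (Fin n → ℝ)) (k : ℕ) (P : Symb n) (A : Module.End ℂ (SmoothFn n)),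
      IsOpen V ∧ x ∈ V ∧ V ⊆ U ∧ P.IsHomogeneous k ∧ (monomial α f' : Symb n).IsHomogeneous k ∧
      A - normalEnd n c P ∈ DiffOpLT n k ∧
      (∀ W ⊆ V, IsOpen W → OpRelated g W lam mu A (normalEnd n c (monomial α f'))) ∧
      SymbRelated g V (mu - lam) P (monomial α f') := by
  refine MvPolynomial.induction_on_monomial (motive := fun P' : Symb n =>
    ∃ (V : Set (Fin n → ℝ)) (k : ℕ) (P : Symb n) (A : Module.End ℂ (SmoothFn n)),
      IsOpen V ∧ x ∈ V ∧ V ⊆ U ∧ P.IsHomogeneous k ∧ P'.IsHomogeneous k ∧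
      A - normalEnd n c P ∈ DiffOpLT n k ∧
      (∀ W ⊆ V, IsOpen W → OpRelated g W lam mu A (normalEnd n c P')) ∧
      SymbRelated g V (mu - lam) P P') (fun f' => ?_) (fun P' j ih => ?_) α f'
  · obtain ⟨f, V, hV, hxV, hVU, hf⟩ := exists_densityRelated hU hpos hx (mu - lam) f'
    refine ⟨V, 0, C f, mulOp f, hV, hxV, hVU, MvPolynomial.isHomogeneous_C _ _,
      MvPolynomial.isHomogeneous_C _ _, ?_, ?_, ?_⟩
    · rw [normalEnd_C, sub_self]
      exact zero_mem _
    · intro W hW _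
      rw [normalEnd_C]
      exact OpRelated.of_densityRelated (fun y hy => hpos y (hVU (hW hy))) (hf.mono hW)
    · intro y hy η
      rw [symbEval_C, symbEval_C, hf y hy]
  · obtain ⟨V, k, P, A, hV, hxV, hVU, hP, hP', hA, hrel, hsymb⟩ := ih
    refine ⟨V, k + 1, fieldSymbol (pullField g j) * P,
      c • (A * lieDensity lam (pullField g j)), hV, hxV, hVU, ?_,
      hP'.mul (MvPolynomial.isHomogeneous_X _ j),
      mul_lieDensity_sub_mem hb hc (pullField_mem j) hP
        hA, ?_, ?_⟩
    · rw [add_comm]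
      exact (fieldSymbol_isHomogeneous _).mul hP
    · have h : P' * X j = mulSymb (X j) P' := by rw [mulSymb_apply, mul_comm]
      intro W hW hWo
      rw [h, normalEnd_X_mul]
      exact ((hrel W hW hWo).mul
        (opRelated_pullField hWo (fun y hy => hpos y (hVU (hW hy))) lam j)).smul c
    · intro y hy η
      have hy0 := (hpos y (hVU hy)).ne'
      have h := sum_pullField_mul hy0 j (fun i => (η i : ℂ))
      rw [symbEval_mul, symbEval_mul, hsymb y hy, symbEval_X, symbEval_fieldSymbol]
      simp only [fderiv_projMap_single hy0]
      push_cast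
      rw [h]
      ring

theorem exists_local_model (hU : IsOpen U) (hpos : ∀ x ∈ U, 0 < projVec g x 0)
    {lam mu : ℂ} (hb : ∀ l : ℕ, (l : ℂ) + ((n : ℂ) + 1) * (1 - (mu - lam)) ≠ 0) {c : ℂ}
    (hc : c ≠ 0) {x : Fin n → ℝ} (hx : x ∈ U) (P' : Symb n) :
    ∃ (V : Set (Fin n → ℝ)) (P : Symb n), IsOpen V ∧ x ∈ V ∧ V ⊆ U ∧
      (∀ W ⊆ V, IsOpen W →
        OpRelated g W lam mu (quantEnd n lam mu hc P) (quantEnd n lam mu hc P')) ∧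
      SymbRelated g V (mu - lam) P P' := by
  have hmon : ∀ α f', ∃ (V : Set (Fin n → ℝ)) (P : Symb n), IsOpen V ∧ x ∈ V ∧ V ⊆ U ∧
      (∀ W ⊆ V, IsOpen W →
        OpRelated g W lam mu (quantEnd n lam mu hc P) (quantEnd n lam mu hc (monomial α f'))) ∧
      SymbRelated g V (mu - lam) P (monomial α f') := by
    intro α f'
    obtain ⟨V, k, P, A, hV, hxV, hVU, hP, hP', hA, hrel, hsymb⟩ :=
      exists_local_model_monomial hU hpos hb hc hx α f'
    refine ⟨V, P, hV, hxV, hVU, fun W hW hWo => opRelated_quantEnd hWo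
      (fun y hy => hpos y (hVU (hW hy))) hb hc hP hP' hA ?_ (hrel W hW hWo), hsymb⟩
    rw [sub_self]
    exact zero_mem _
  induction P' using MvPolynomial.monomial_add_induction_on with
  | C a => exact hmon 0 a
  | monomial_add α f' R' _ _ ih =>
    obtain ⟨V₁, P₁, hV₁, hx₁, hU₁, hr₁, hs₁⟩ := hmon α f'
    obtain ⟨V₂, P₂, hV₂, hx₂, -, hr₂, hs₂⟩ := ih
    refine ⟨V₁ ∩ V₂, P₁ + P₂, hV₁.inter hV₂, ⟨hx₁, hx₂⟩, Set.inter_subset_left.trans hU₁, ?_, ?_⟩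
    · intro W hW hWo
      rw [map_add, map_add]
      exact (hr₁ W (hW.trans Set.inter_subset_left) hWo).add
        (hr₂ W (hW.trans Set.inter_subset_right) hWo)
    · intro y hy η
      rw [symbEval_add, symbEval_add, hs₁ y hy.1, hs₂ y hy.2, mul_add]

/-- The symbols whose coefficients vanish on `V`. -/
def vanishingSymb (V : Set (Fin n → ℝ)) : Submodule ℂ (Symb n) where
  carrier := {P | ∀ α, ∀ y ∈ V, P.coeff α y = 0}
  add_mem' hP hR α y hy := by
    rw [MvPolynomial.coeff_add, map_add, Pi.add_apply, hP α y hy, hR α y hy, add_zero]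
  zero_mem' α y _ := by simp
  smul_mem' a P hP α y hy := by
    rw [MvPolynomial.coeff_smul, map_smul, Pi.smul_apply, hP α y hy, smul_zero]

/-- The symbol map is built from derivatives and degree scalars, hence is local; openness of `V`
lets derivatives vanish there too. Locality passes to the inverse by `symbolEquiv_symm_mem`. -/
theorem symbolEquiv_mem_vanishingSymb (lam mu c : ℂ) {V : Set (Fin n → ℝ)} (hV : IsOpen V)
    {P : Symb n} (hP : P ∈ vanishingSymb V) : symbolEquiv n lam mu c P ∈ vanishingSymb V := by
  have hD : ∀ R ∈ vanishingSymb V, divD n R ∈ vanishingSymb V := by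
    intro R hR
    rw [divD, LinearMap.sum_apply]
    refine Submodule.sum_mem _ fun i _ α y hy => ?_
    have hz : ∀ z ∈ V, (xiD i R).coeff α z = 0 := by
      intro z hz
      rw [xiD_apply, MvPolynomial.coeff_pderiv, map_mul, Pi.mul_apply, hR _ z hz, zero_mul]
    have hev : ((xiD i R).coeff α).toFun =ᶠ[nhds y] fun _ => 0 := by
      filter_upwards [hV.mem_nhds hy] with z hzV using hz z hzV
    rw [Module.End.mul_apply, coeff_xD, partialD_apply, hev.fderiv_eq]
    simp
  have hDm : ∀ m : ℕ, ∀ R ∈ vanishingSymb V, (divD n ^ m) R ∈ vanishingSymb V := by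
    intro m
    induction m with
    | zero => exact fun R hR => hR
    | succ m ih =>
      intro R hR
      rw [pow_succ, Module.End.mul_apply]
      exact ih _ (hD R hR)
  obtain ⟨k, hk⟩ := exists_mem_symbLT P
  rw [symbolEquiv_apply, symbolMap_eq_sum _ _ _ hk]
  refine Submodule.sum_mem _ fun m _ => ?_
  rw [hypTerm, smul_pow, Module.End.mul_apply, LinearMap.smul_apply, map_smul]
  refine Submodule.smul_mem _ _ fun α y hy => ?_
  rw [coeff_degOp, map_smul, Pi.smul_apply, hDm m P hP α y hy, smul_zero]

theorem normalEnd_apply_eq_zero (c : ℂ) {V : Set (Fin n → ℝ)} {P : Symb n}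
    (hP : P ∈ vanishingSymb V) (φ : SmoothFn n) {y : Fin n → ℝ} (hy : y ∈ V) :
    normalEnd n c P φ y = 0 := by
  rw [MvPolynomial.as_sum P, map_sum, LinearMap.sum_apply, map_sum, Finset.sum_apply]
  refine Finset.sum_eq_zero fun α _ => ?_
  rw [normalEnd_monomial, LinearMap.smul_apply, Module.End.mul_apply, mulOp_apply, map_smul,
    map_mul, Pi.smul_apply, Pi.mul_apply, hP α y hy, zero_mul, smul_zero]

theorem quantEnd_apply_eq_zero (lam mu : ℂ) {c : ℂ} (hc : c ≠ 0) {V : Set (Fin n → ℝ)}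
    (hV : IsOpen V) {P : Symb n} (hP : P ∈ vanishingSymb V) (φ : SmoothFn n) {y : Fin n → ℝ}
    (hy : y ∈ V) : quantEnd n lam mu hc P φ y = 0 := by
  rw [quantEnd_apply]
  exact normalEnd_apply_eq_zero c (symbolEquiv_symm_mem lam mu c _
    (fun R hR => symbolEquiv_mem_vanishingSymb lam mu c hV hR) hP) φ hy

theorem exists_covector {x : Fin n → ℝ} (hx : projVec g x 0 ≠ 0) (ξ : Fin n → ℝ) :
    ∃ η : Fin n → ℝ, ∀ j, ∑ i, η i * fderiv ℝ (projMap g) x (Pi.single j 1) i = ξ j := by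
  have hdet : IsUnit (projJac g x).det := by
    rw [det_projJac hx]
    exact isUnit_iff_ne_zero.2 (inv_ne_zero (pow_ne_zero _ hx))
  refine ⟨ξ ᵥ* (projJac g x)⁻¹, fun j => ?_⟩
  simp only [fderiv_projMap_single hx]
  change ((ξ ᵥ* (projJac g x)⁻¹) ᵥ* projJac g x) j = ξ j
  rw [Matrix.vecMul_vecMul, Matrix.nonsing_inv_mul _ hdet, Matrix.vecMul_one]

/-- The transposed differential of `projMap g` is surjective on covectors, so the pull-back relation
fixes the values at all real covectors over `V`. -/
theorem sub_mem_vanishingSymb {V : Set (Fin n → ℝ)} (hpos : ∀ x ∈ V, 0 < projVec g x 0) {δ : ℂ}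
    {P R P' : Symb n} (hP : SymbRelated g V δ P P') (hR : SymbRelated g V δ R P') :
    P - R ∈ vanishingSymb V := by
  intro α y hy
  let ev : SmoothFn n →+* ℂ :=
    (Pi.evalRingHom (fun _ : Fin n → ℝ => ℂ) y).comp (SmoothFn.toFun (n := n)).toRingHom
  have h1 : MvPolynomial.map ev P = MvPolynomial.map ev R := by
    -- Only real covectors are tested, but polynomials over `ℂ` that agree on a product of infinite
    -- sets are equal.
    refine MvPolynomial.funext_set (fun _ => Set.range ((↑) : ℝ → ℂ))
      (fun _ => Set.infinite_range_of_injective Complex.ofReal_injective) fun z hz => ?_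
    choose ξ hξ using fun i => hz i (Set.mem_univ i)
    obtain ⟨η, hη⟩ := exists_covector (hpos y hy).ne' ξ
    have h2 := (hP y hy η).trans (hR y hy η).symm
    simp only [hη] at h2
    have hz' : z = fun i => ((ξ i : ℝ) : ℂ) := funext fun i => (hξ i).symm
    rw [MvPolynomial.eval_map, MvPolynomial.eval_map, hz']
    exact h2
  have h3 := congrArg (MvPolynomial.coeff α) h1
  rw [MvPolynomial.coeff_map, MvPolynomial.coeff_map] at h3
  rw [MvPolynomial.coeff_sub, map_sub, Pi.sub_apply, sub_eq_zero]
  exact h3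

theorem isChartIndependent_quantization {lam mu : ℂ}
    (hb : ∀ l : ℕ, (l : ℂ) + ((n : ℂ) + 1) * (1 - (mu - lam)) ≠ 0) {c : ℂ} (hc : c ≠ 0) :
    IsChartIndependent n lam mu (quantization n lam mu hc).toLinearMap := by
  intro g U hU hpos P P' hPP' φ φ' hφ x hx
  -- The local model `R` and the given `P` are pull-backs of the same symbol on `V`. They agree
  -- there, and so do their quantizations.
  obtain ⟨V, R, hV, hxV, hVU, hrel, hsymb⟩ := exists_local_model hU hpos hb hc hx P'
  have h1 := hrel V subset_rfl hV φ φ' (hφ.mono hVU) x hxV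
  have h2 := quantEnd_apply_eq_zero lam mu hc hV
    (sub_mem_vanishingSymb (fun y hy => hpos y (hVU hy)) (hPP'.mono hVU) hsymb) φ hxV
  rw [map_sub, LinearMap.sub_apply, map_sub, Pi.sub_apply, sub_eq_zero, h1] at h2
  exact h2

end ProjQuant

end

open ProjQuant in
theorem theorem3p5 (n : ℕ) (lam mu c : ℂ) (hc : c ≠ 0)
    (hδ : ∀ l : ℕ, mu - lam ≠ 1 + (l : ℂ) / ((n : ℂ) + 1)) :
    ∃ Q : Symb n ≃ₗ[ℂ] DiffOp n,
      IsProjEquivQuantization n lam mu c Q.toLinearMap ∧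
      (∀ Q' : Symb n →ₗ[ℂ] DiffOp n,
        IsProjEquivQuantization n lam mu c Q' → Q' = Q.toLinearMap) ∧
      IsChartIndependent n lam mu Q.toLinearMap ∧
      Function.Bijective (normalOrder n c) ∧
      (∀ m : ℕ, IsUnit
        (pochOp ((2 : ℂ) • euler n + (((n : ℂ) + 1) * (1 - (mu - lam))) • 1) m)) ∧
      (∀ P : Symb n, ∃ N : ℕ, ∀ m ≥ N, ((-c • divD n) ^ m) P = 0) ∧
      ∀ P : Symb n,
        Q.symm (normalOrder n c P) =
          confluentF (euler n + (((n : ℂ) + 1) * lam) • 1)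
            ((2 : ℂ) • euler n + (((n : ℂ) + 1) * (1 - (mu - lam))) • 1)
            (-c • divD n) P := by
  -- The exclusion of the values `1 + l/(n+1)` for `δ`, multiplied by `n + 1`: this is the form in
  -- which it enters both the hypergeometric denominators and the Casimir eigenvalues.
  have hb : ∀ l : ℕ, (l : ℂ) + ((n : ℂ) + 1) * (1 - (mu - lam)) ≠ 0 := by
    intro l h
    have hn : (n : ℂ) + 1 ≠ 0 := Nat.cast_add_one_ne_zero n
    apply hδ l
    field_simp
    linear_combination -h
  refine ⟨quantization n lam mu hc, isProjEquivQuantization_quantization hb hc,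
    fun Q' hQ' => quantization_unique hb hc hQ', isChartIndependent_quantization hb hc,
    normalOrder_bijective hc, fun m => ?_, fun P => ?_, fun P => ?_⟩
  · rw [two_smul_euler_add_smul, pochOp_degOp]
    exact isUnit_degOp (pochOp_denominator hb m)
  · obtain ⟨k, hk⟩ := exists_mem_symbLT P
    refine ⟨k, fun m hm => ?_⟩
    rw [smul_pow, LinearMap.smul_apply, divD_pow_eq_zero (symbLT_mono hm hk), smul_zero]
  · rw [quantization_symm_normalOrder, symbolEquiv_apply, symbolMap_eq_confluentF _ _ hb]
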